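/- Let $(\mathcal X,\mathcal F,\lambda)$ be a measure space, $N\ge 1$, and let $\pi_0,\dots,\pi_N$ be probability densities with respect to $\lambda$; write $\pi_k[A]=\int_A\pi_k\,d\lambda$. For $k=0,\dots,N$ let $T_k$ be a $\pi_k$-reversible Markov transition kernel on $\mathcal X$. On $\mathcal X^{N+1}$, with the product distribution $\pi_{sc}(dx)=\prod_{k=0}^N\pi_k(x_{[k]})\,\lambda(dx_{[k]})$, define two moves. The update move is $$T(x,dy)=\tfrac12\,\delta_x(dy)+\frac1{2(N+1)}\sum_{k=0}^N T_k(x_{[k]},dy_{[k]})\,\prod_{i\ne k}\delta_{x_{[i]}}(dy_{[i]}).$$ With $(k,k+1)x$ denoting $x$ with its entries at levels $k$ and $k+1$ exchanged and $\rho_k(x)=\min\Big\{1,\frac{\pi_k(x_{[k+1]})\pi_{k+1}(x_{[k]})}{\pi_k(x_{[k]})\pi_{k+1}(x_{[k+1]})}\Big\}$, the swap move is $$Q(x,A)=\frac1{2N}\sum_{k=0}^{N-1}\mathbf 1_A((k,k+1)x)\,\rho_k(x)+\mathbf 1_A(x)\Big[1-\frac1{2N}\sum_{k=0}^{N-1}\rho_k(x)\Big].$$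 The swapping chain is $P_{sc}=QTQ$. For a kernel $P$ reversible with respect to a probability distribution $\mu$, let $$\mathbf{Gap}(P)=\inf\Big\{\frac{(f,(I-P)f)_\mu}{\mathrm{Var}_\mu(f)}:\ f\in L_2(\mu),\ \mathrm{Var}_\mu(f)>0\Big\},$$ with the convention $\mathbf{Gap}(P)=1$ if there is no such $f$. For a measurable set $A$ with $\mu(A)>0$ let $P|_A(x,B)=P(x,B)+\mathbf 1_B(x)P(x,A^c)$ for $x\in A$, $B\subset A$; it is reversible with respect to the normalized restriction of $\mu$ to $A$. For a finite partition $\{A_1,\dots,A_J\}$ with $\mu(A_j)>0$ for all $j$, let $\bar P(i,j)=\mu(A_i)^{-1}\int_{A_i}P(x,A_j)\,\mu(dx)$; it is reversible with respect to the distribution giving mass $\mu(A_j)$ to $j$. All gaps below are taken with respect to these distributions. Let $\mathcal A=\{A_1,\dots,A_J\}$ be any finite measurable partition of $\mathcal X$ with $\pi_k[A_j]>0$ for all $k,j$, and set $$\delta(\mathcal A)=\min_{|k-l|=1,\;1\le j\le J}\frac{\int_{A_j}\min\{\pi_k,\pi_l\}\,d\lambda}{\pi_k[A_j]},\qquad \gamma(\mathcal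 A)=\min_{1\le j\le J}\prod_{k=1}^N\min\Big\{1,\frac{\pi_{k-1}[A_j]}{\pi_k[A_j]}\Big\}.$$ Then $$\mathbf{Gap}(P_{sc})\ \ge\ \frac{\gamma(\mathcal A)^{J+3}\,\delta(\mathcal A)^2}{2^{12}(N+1)^4J^3}\ \mathbf{Gap}(\bar T_0)\ \min_{k,j}\mathbf{Gap}(T_k|_{A_j}).$$ In particular, the bound holds for parallel tempering, i.e. when $\pi_k\propto\pi^{\beta_k}$ for a probability density $\pi$ and inverse temperatures $0\le\beta_0<\dots<\beta_N=1$ with $\int\pi^{\beta_0}\,d\lambda<\infty$. -/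

import Mathlib

open MeasureTheory ProbabilityTheory
open scoped NNReal ENNReal

noncomputable section

namespace SwappingChain

variable {X : Type*} [MeasurableSpace X]

/-- The Dirichlet form `(f, (I - P) f)_μ`. -/
def dirichletForm (P : Kernel X X) (μ : Measure X) (f : X → ℝ) : ℝ :=
  ∫ x, f x * (f x - ∫ y, f y ∂(P x)) ∂μ

open Classical in
/-- The spectral gap of `P` with respect to the probability distribution `μ`: the infimum of
`𝓔(f, f) / Var_μ(f)` over all `f ∈ L²(μ)` with `Var_μ(f) > 0`. If there is no such `f` (for
instance on a one-point space) the infimum is over the empty set, and the gap is `1` by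
convention. -/
def spectralGap (P : Kernel X X) (μ : Measure X) : ℝ :=
  if ∃ f : X → ℝ, MemLp f 2 μ ∧ 0 < variance f μ then
    sInf {r : ℝ | ∃ f : X → ℝ, MemLp f 2 μ ∧ 0 < variance f μ ∧
      r = dirichletForm P μ f / variance f μ}
  else 1

/-- The restriction `P|_A` of `P` to a measurable set `A`, as a kernel on `A`:
`P|_A(x, B) = P(x, B) + 1_B(x) P(x, Aᶜ)`. -/
def restrictKernel (P : Kernel X X) {A : Set X} (hA : MeasurableSet A) : Kernel A A where
  toFun x := (P x).comap Subtype.val + (P x Aᶜ) • Measure.dirac x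
  measurable' := by
    refine Measure.measurable_of_measurable_coe _ fun s hs => ?_
    have h1 : ∀ x : A, ((P x).comap Subtype.val) s = P x (Subtype.val '' s) := fun x =>
      (MeasurableEmbedding.subtype_coe hA).comap_apply _ _
    have h2 : ∀ x : A, (Measure.dirac x) s = s.indicator 1 x := fun x =>
      Measure.dirac_apply' _ hs
    simp only [Measure.add_apply, Measure.smul_apply, smul_eq_mul, h1, h2]
    refine Measurable.add ?_ (Measurable.mul ?_ ?_)
    · exact (P.measurable_coe (hA.subtype_image hs)).comp measurable_subtype_coe
    · exact (P.measurable_coe hA.compl).comp measurable_subtype_coe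
    · exact measurable_one.indicator hs

/-- The normalized restriction of `μ` to `A`, as a measure on `A`. -/
def restrictMeasure (μ : Measure X) (A : Set X) : Measure A :=
  (cond μ A).comap Subtype.val

/-- The projection `P̄(i, j) = μ(A i)⁻¹ ∫_{A i} P(x, A j) μ(dx)` of `P` with respect to the
partition `A`, as a Markov chain on the index set. -/
def projKernel (P : Kernel X X) (μ : Measure X) {J : ℕ} (A : Fin J → Set X) :
    Kernel (Fin J) (Fin J) where
  toFun i := ∑ j, ((μ (A i))⁻¹ * ∫⁻ x in A i, P x (A j) ∂μ) • Measure.dirac j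
  measurable' := measurable_of_countable _

/-- The distribution on the index set of the partition giving mass `μ(A j)` to `j`. -/
def projMeasure (μ : Measure X) {J : ℕ} (A : Fin J → Set X) : Measure (Fin J) :=
  ∑ j, μ (A j) • Measure.dirac j

/-- `p` is a probability density with respect to `ν`. -/
def IsProbDensity (ν : Measure X) (p : X → ℝ≥0) : Prop :=
  Measurable p ∧ ∫⁻ z, (p z : ℝ≥0∞) ∂ν = 1

/-- The distribution with density `p` with respect to `ν`. -/
def densityMeasure (ν : Measure X) (p : X → ℝ≥0) : Measure X :=
  ν.withDensity fun z => (p z : ℝ≥0∞)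

/-- The tempered density proportional to `π ^ β`. -/
def temperedDensity (ν : Measure X) (π : X → ℝ≥0) (β : ℝ) : X → ℝ≥0 :=
  fun z => π z ^ β / (∫⁻ w, ((π w ^ β : ℝ≥0) : ℝ≥0∞) ∂ν).toNNReal

theorem measurable_temperedDensity (ν : Measure X) {π : X → ℝ≥0} (hπ : Measurable π) (β : ℝ) :
    Measurable (temperedDensity ν π β) :=
  (hπ.pow_const β).div_const _

variable {N : ℕ}

theorem measurable_of_eq_temperedDensity {ν : Measure X} {π : X → ℝ≥0}
    (hπ : IsProbDensity ν π) {β : Fin (N + 1) → ℝ} {p : Fin (N + 1) → X → ℝ≥0}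
    (hp : ∀ k, p k = temperedDensity ν π (β k)) (k : Fin (N + 1)) : Measurable (p k) := by
  rw [hp k]
  exact measurable_temperedDensity ν hπ.1 (β k)

/-- The joint distribution `π_sc` on `X^{N+1}`: the product of the distributions with
densities `p k`. -/
def swapMeasure (ν : Measure X) (p : Fin (N + 1) → X → ℝ≥0) : Measure (Fin (N + 1) → X) :=
  Measure.pi fun k => densityMeasure ν (p k)

/-- The state `(k, k+1) x`, with the entries at levels `k` and `k + 1` exchanged. -/
def swapState (k : Fin N) (x : Fin (N + 1) → X) : Fin (N + 1) → X :=
  fun i => x (Equiv.swap k.castSucc k.succ i)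

/-- The Metropolis acceptance probability of the swap of levels `k` and `k + 1`. (The value
where the denominator vanishes is irrelevant: such `x` form a null set of `π_sc`.) -/
def swapAccept (p : Fin (N + 1) → X → ℝ≥0) (k : Fin N) (x : Fin (N + 1) → X) : ℝ≥0 :=
  min 1 ((p k.castSucc (x k.succ) * p k.succ (x k.castSucc)) /
    (p k.castSucc (x k.castSucc) * p k.succ (x k.succ)))

theorem measurable_swapState (k : Fin N) : Measurable (swapState (X := X) k) :=
  measurable_pi_lambda _ fun _ => measurable_pi_apply _

theorem measurable_swapAccept {p : Fin (N + 1) → X → ℝ≥0} (hp : ∀ k, Measurable (p k))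
    (k : Fin N) : Measurable (swapAccept p k) := by
  have h : ∀ i j, Measurable fun x : Fin (N + 1) → X => p i (x j) := fun i j =>
    (hp i).comp (measurable_pi_apply j)
  exact measurable_const.min (((h _ _).mul (h _ _)).div ((h _ _).mul (h _ _)))

/-- The swap move `Q`: choose `k` uniformly in `{0, …, N - 1}`, propose the swap of levels `k`
and `k + 1`, with holding probability `1/2`. -/
def swapKernel (p : Fin (N + 1) → X → ℝ≥0) (hp : ∀ k, Measurable (p k)) :
    Kernel (Fin (N + 1) → X) (Fin (N + 1) → X) where
  toFun x :=
    (∑ k : Fin N, ((swapAccept p k x / (2 * N) : ℝ≥0) : ℝ≥0∞) • Measure.dirac (swapState k x))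
      + ((1 - ∑ k : Fin N, swapAccept p k x / (2 * N) : ℝ≥0) : ℝ≥0∞) • Measure.dirac x
  measurable' := by
    refine Measure.measurable_of_measurable_coe _ fun s hs => ?_
    simp only [Measure.add_apply, Measure.smul_apply, smul_eq_mul, Measure.finsetSum_apply,
      Measure.dirac_apply' _ hs]
    have ha : ∀ k : Fin N, Measurable fun x => swapAccept p k x / (2 * N) := fun k =>
      (measurable_swapAccept hp k).div_const _
    refine Measurable.add (Finset.measurable_sum _ fun k _ => ?_) (Measurable.mul ?_ ?_)
    · exact (ha k).coe_nnreal_ennreal.mul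
        ((measurable_one.indicator hs).comp (measurable_swapState k))
    · exact (measurable_const.sub (Finset.measurable_sum _ fun k _ => ha k)).coe_nnreal_ennreal
    · exact measurable_one.indicator hs

/-- The update of the `k`-th entry according to `T k`, the other entries being kept. -/
def coordKernel (T : Fin (N + 1) → Kernel X X) [∀ k, IsMarkovKernel (T k)] (k : Fin (N + 1)) :
    Kernel (Fin (N + 1) → X) (Fin (N + 1) → X) where
  toFun x := (T k (x k)).map (Function.update x k)
  measurable' := by
    refine Measure.measurable_of_measurable_coe _ fun s hs => ?_
    have hu : Measurable fun q : (Fin (N + 1) → X) × X => Function.update q.1 k q.2 := by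
      refine measurable_pi_lambda _ fun i => ?_
      by_cases h : i = k
      · subst h; simpa using measurable_snd
      · simp only [Function.update_of_ne h]
        exact (measurable_pi_apply i).comp measurable_fst
    simp only [Measure.map_apply (measurable_update _) hs]
    exact Kernel.measurable_kernel_prodMk_left
      (κ := (T k).comap (fun x : Fin (N + 1) → X => x k) (measurable_pi_apply k)) (hu hs)

/-- The update move `T`: choose `k` uniformly in `{0, …, N}` and update the `k`-th entry
according to `T k`, with holding probability `1/2`. -/
def updateKernel (T : Fin (N + 1) → Kernel X X) [∀ k, IsMarkovKernel (T k)] :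
    Kernel (Fin (N + 1) → X) (Fin (N + 1) → X) where
  toFun x := (2⁻¹ : ℝ≥0∞) • Measure.dirac x
    + ∑ k, ((2 * (N + 1) : ℝ≥0∞)⁻¹) • coordKernel T k x
  measurable' := by
    refine Measure.measurable_of_measurable_coe _ fun s hs => ?_
    simp only [Measure.add_apply, Measure.smul_apply, smul_eq_mul, Measure.finsetSum_apply,
      Measure.dirac_apply' _ hs]
    refine Measurable.add ((measurable_one.indicator hs).const_mul _)
      (Finset.measurable_sum _ fun k _ => ?_)
    exact ((coordKernel T k).measurable_coe hs).const_mul _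

/-- The swapping chain `P_sc = Q T Q`. -/
def swappingKernel (p : Fin (N + 1) → X → ℝ≥0) (hp : ∀ k, Measurable (p k))
    (T : Fin (N + 1) → Kernel X X) [∀ k, IsMarkovKernel (T k)] :
    Kernel (Fin (N + 1) → X) (Fin (N + 1) → X) :=
  Kernel.comp (swapKernel p hp) (Kernel.comp (updateKernel T) (swapKernel p hp))

/-- The overlap `δ(A)`: the minimum over adjacent levels `k, l` and partition elements of
`(∫_{A j} min{p k, p l} dν) / p_k[A j]`. -/
def overlap (ν : Measure X) (p : Fin (N + 1) → X → ℝ≥0) {J : ℕ} (A : Fin J → Set X) : ℝ :=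
  ⨅ q : {q : Fin (N + 1) × Fin (N + 1) // |((q.1 : ℕ) : ℤ) - ((q.2 : ℕ) : ℤ)| = 1} × Fin J,
    (∫ z in A q.2, ((min (p q.1.1.1 z) (p q.1.1.2 z) : ℝ≥0) : ℝ) ∂ν) /
      (densityMeasure ν (p q.1.1.1)).real (A q.2)

/-- `γ(A) = min_j ∏_{k=1}^N min{1, p_{k-1}[A j] / p_k[A j]}`. -/
def levelRatio (ν : Measure X) (p : Fin (N + 1) → X → ℝ≥0) {J : ℕ} (A : Fin J → Set X) : ℝ :=
  ⨅ j, ∏ k : Fin N, min 1 ((densityMeasure ν (p k.castSucc)).real (A j) /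
    (densityMeasure ν (p k.succ)).real (A j))

/-- `min_{k, j} Gap(T_k|_{A j})`. -/
def minRestrictedGap (ν : Measure X) (p : Fin (N + 1) → X → ℝ≥0)
    (T : Fin (N + 1) → Kernel X X) {J : ℕ} (A : Fin J → Set X)
    (hA : ∀ j, MeasurableSet (A j)) : ℝ :=
  ⨅ q : Fin (N + 1) × Fin J,
    spectralGap (restrictKernel (T q.1) (hA q.2))
      (restrictMeasure (densityMeasure ν (p q.1)) (A q.2))

end SwappingChain

end

open MeasureTheory ProbabilityTheory
open scoped NNReal ENNReal

noncomputable section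

namespace SwappingChain

/-! ### Quadratic forms, Dirichlet forms and the spectral gap -/

variable {X : Type*} [MeasurableSpace X]

/-! Write `E_P(f) = ∬ (f x - f y)² P(x, dy) μ(dx)`. A gap bound for the swapping chain says that the
variance of `f` is at most a constant times `E_{QTQ}(f)`. Both `Q` and `T` hold with probability at
least 1/2, so `E_{QTQ}` dominates a quarter of `E_T` and of `E_Q`. It therefore suffices to control
the variance by single-coordinate updates and adjacent swaps (`quarter_mul_sqForm_le_of_lazy`).

Label each state `x` by its vector of cells `σ = (c(x_0), …, c(x_N))`. The total variance splits as
`D + V`, where `D` is the mean variance inside the boxes `{σ}` and `V` is the variance of the box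
means `φ(σ)`. Conditioned on a box, the law is still a product, so the Efron–Stein inequality
(`variance_pi_le`) and the gaps of the restricted `T_k` bound `D`.

The law of `σ` is a product as well, so Efron–Stein bounds `V` by the forms `R_k(φ)` of resampling
the cell at level `k`. Jensen's inequality and the decomposition of `T_0` into its projection and
its restrictions (`le_sqForm_of_projectedGap`) bound `R_0`. For `k > 0`, resampling at level `k` is
simulated by drawing a new entry at level 0, exchanging levels 0 and `k`, and resampling level 0
again (`resampleForm_le`). The exchange is performed by adjacent swaps.

Two estimates price this simulation. The intermediate distributions along the swap path exceed the
product law by at most a factor `γ^{-(J+1)}` (`movedWeight_le`). The exponent involves `J` and not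
`N`, because the ratios lost at different levels can be regrouped by cell. Secondly, the mean
acceptance probability of an adjacent swap inside any box is at least `δ²`
(`sq_le_lintegral_swapAccept_cond`), so `Q` dominates the swaps of cell labels. Passing from `f` to
`φ` in the form of `Q` costs a multiple of `D`, already controlled. The inequalities are assembled
in `mul_variance_le_of_comparison`. The argument gives the exponent `J + 1` and no factor `J³`, so
the claimed bound has room to spare. -/

/-- The quadratic form `∫∫ (f x - f y)² P(x, dy) μ(dx)`, twice the Dirichlet form when `μ` is
invariant under the Markov kernel `P` and `f` is square integrable. -/
def sqForm (P : Kernel X X) (μ : Measure X) (f : X → ℝ) : ℝ≥0∞ :=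
  ∫⁻ x, ∫⁻ y, ENNReal.ofReal ((f x - f y) ^ 2) ∂(P x) ∂μ

theorem measurable_sq_sub {f : X → ℝ} (hf : Measurable f) :
    Measurable fun z : X × X => ENNReal.ofReal ((f z.1 - f z.2) ^ 2) :=
  (((hf.comp measurable_fst).sub (hf.comp measurable_snd)).pow_const 2).ennreal_ofReal

theorem sqForm_eq_lintegral_compProd (P : Kernel X X) [IsSFiniteKernel P] (μ : Measure X)
    [SFinite μ] {f : X → ℝ} (hf : Measurable f) :
    sqForm P μ f = ∫⁻ z, ENNReal.ofReal ((f z.1 - f z.2) ^ 2) ∂(μ.compProd P) := by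
  rw [Measure.lintegral_compProd (measurable_sq_sub hf)]
  rfl

theorem measurable_lintegral_sq_sub (P : Kernel X X) [IsSFiniteKernel P] {f : X → ℝ}
    (hf : Measurable f) :
    Measurable fun x => ∫⁻ y, ENNReal.ofReal ((f x - f y) ^ 2) ∂(P x) :=
  (measurable_sq_sub hf).lintegral_kernel_prod_right'

theorem ofReal_sq_add_le (a b : ℝ) :
    ENNReal.ofReal ((a + b) ^ 2) ≤ 2 * ENNReal.ofReal (a ^ 2) + 2 * ENNReal.ofReal (b ^ 2) := by
  rw [show (2 : ℝ≥0∞) = ENNReal.ofReal 2 by simp, ← ENNReal.ofReal_mul zero_le_two,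
    ← ENNReal.ofReal_mul zero_le_two, ← ENNReal.ofReal_add (by positivity) (by positivity)]
  exact ENNReal.ofReal_le_ofReal (by nlinarith [sq_nonneg (a - b)])

theorem sqForm_add_le (P : Kernel X X) [IsSFiniteKernel P] (μ : Measure X) [SFinite μ]
    {f g : X → ℝ} (hf : Measurable f) (hg : Measurable g) :
    sqForm P μ (fun x => f x + g x) ≤ 2 * sqForm P μ f + 2 * sqForm P μ g := by
  rw [sqForm_eq_lintegral_compProd P μ hf, sqForm_eq_lintegral_compProd P μ hg,
    sqForm_eq_lintegral_compProd P μ (hf.fun_add hg),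
    ← lintegral_const_mul _ (measurable_sq_sub hf), ← lintegral_const_mul _ (measurable_sq_sub hg),
    ← lintegral_add_left ((measurable_sq_sub hf).const_mul 2)]
  refine lintegral_mono fun z => ?_
  convert ofReal_sq_add_le (f z.1 - f z.2) (g z.1 - g z.2) using 3
  ring

theorem lintegral_lintegral_of_invariant {P : Kernel X X} {μ : Measure X} (h : P.Invariant μ)
    {g : X → ℝ≥0∞} (hg : Measurable g) : ∫⁻ x, ∫⁻ y, g y ∂(P x) ∂μ = ∫⁻ x, g x ∂μ := by
  conv_rhs => rw [← h.def]
  rw [Measure.lintegral_bind P.aemeasurable hg.aemeasurable]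

/-- Use `(a - b)² ≤ 2(a - c)² + 2(b - c)²`; invariance gives both terms the same integral. -/
theorem sqForm_le_of_invariant {P : Kernel X X} [IsMarkovKernel P] {μ : Measure X} [SFinite μ]
    (h : P.Invariant μ) {f : X → ℝ} (hf : Measurable f) (c : ℝ) :
    sqForm P μ f ≤ 4 * ∫⁻ x, ENNReal.ofReal ((f x - c) ^ 2) ∂μ := by
  have hm : Measurable fun x => ENNReal.ofReal ((f x - c) ^ 2) :=
    ((hf.sub_const c).pow_const 2).ennreal_ofReal
  calc sqForm P μ f
      ≤ ∫⁻ x, ∫⁻ y, (2 * ENNReal.ofReal ((f x - c) ^ 2) + 2 * ENNReal.ofReal ((f y - c) ^ 2))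
          ∂(P x) ∂μ := by
        refine lintegral_mono fun x => lintegral_mono fun y => ?_
        convert ofReal_sq_add_le (f x - c) (-(f y - c)) using 2
        · congr 1; ring
        · rw [neg_sq]
    _ = ∫⁻ x, (2 * ENNReal.ofReal ((f x - c) ^ 2)
          + 2 * ∫⁻ y, ENNReal.ofReal ((f y - c) ^ 2) ∂(P x)) ∂μ := by
        refine lintegral_congr fun x => ?_
        rw [lintegral_add_left measurable_const, lintegral_const_mul _ hm]
        simp
    _ = 4 * ∫⁻ x, ENNReal.ofReal ((f x - c) ^ 2) ∂μ := by
        rw [lintegral_add_left (hm.const_mul 2), lintegral_const_mul _ hm,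
          lintegral_const_mul _ hm.lintegral_kernel, lintegral_lintegral_of_invariant h hm]
        ring

theorem lintegral_ofReal_sq_eq {μ : Measure X} {f : X → ℝ} (hf : MemLp f 2 μ) :
    ∫⁻ x, ENNReal.ofReal (f x ^ 2) ∂μ = ENNReal.ofReal (∫ x, f x ^ 2 ∂μ) :=
  (ofReal_integral_eq_lintegral_ofReal hf.integrable_sq (.of_forall fun x => sq_nonneg (f x))).symm

theorem sqForm_ne_top {P : Kernel X X} [IsMarkovKernel P] {μ : Measure X} [IsFiniteMeasure μ]
    (h : P.Invariant μ) {f : X → ℝ} (hf : Measurable f) (hL : MemLp f 2 μ) :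
    sqForm P μ f ≠ ∞ := by
  refine ne_top_of_le_ne_top ?_ (sqForm_le_of_invariant h hf 0)
  simp only [sub_zero]
  rw [lintegral_ofReal_sq_eq hL]
  finiteness

theorem measurePreserving_fst_compProd (P : Kernel X X) [IsMarkovKernel P] (μ : Measure X)
    [SFinite μ] : MeasurePreserving Prod.fst (μ.compProd P) μ :=
  ⟨measurable_fst, Measure.fst_compProd μ P⟩

theorem measurePreserving_snd_compProd {P : Kernel X X} [IsMarkovKernel P] {μ : Measure X}
    [SFinite μ] (h : P.Invariant μ) : MeasurePreserving Prod.snd (μ.compProd P) μ :=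
  ⟨measurable_snd, (Measure.snd_compProd μ P).trans h⟩

theorem integral_comp_of_measurePreserving {Y : Type*} [MeasurableSpace Y] {μ : Measure X}
    {ν : Measure Y} {φ : X → Y} (h : MeasurePreserving φ μ ν) {g : Y → ℝ} (hg : Measurable g) :
    ∫ x, g (φ x) ∂μ = ∫ y, g y ∂ν := by
  rw [← h.map_eq, integral_map h.measurable.aemeasurable hg.aestronglyMeasurable]

/-- Integrate `(a - b)² = 2a(a - b) - (a² - b²)` with `a = f x`, `b = f y`. Both marginals of `μ ⊗
P` equal `μ`, so the last bracket integrates to zero. Invariance is enough here; reversibility is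
not needed. -/
theorem dirichletForm_eq_sqForm {P : Kernel X X} [IsMarkovKernel P] {μ : Measure X}
    [IsFiniteMeasure μ] (h : P.Invariant μ) {f : X → ℝ} (hf : Measurable f) (hL : MemLp f 2 μ) :
    dirichletForm P μ f = (sqForm P μ f).toReal / 2 := by
  have h1 : MemLp (fun z : X × X => f z.1) 2 (μ.compProd P) :=
    hL.comp_measurePreserving (measurePreserving_fst_compProd P μ)
  have h2 : MemLp (fun z : X × X => f z.2) 2 (μ.compProd P) :=
    hL.comp_measurePreserving (measurePreserving_snd_compProd h)
  have h12 : MemLp (fun z : X × X => f z.1 - f z.2) 2 (μ.compProd P) := h1.sub h2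
  have hi : Integrable (fun z : X × X => f z.1 * (f z.1 - f z.2)) (μ.compProd P) :=
    h1.integrable_mul h12
  have hsq : (sqForm P μ f).toReal = ∫ z, (f z.1 - f z.2) ^ 2 ∂(μ.compProd P) := by
    rw [sqForm_eq_lintegral_compProd P μ hf, lintegral_ofReal_sq_eq h12,
      ENNReal.toReal_ofReal (integral_nonneg fun z => sq_nonneg _)]
  have hint : Integrable (fun z : X × X => f z.2) (μ.compProd P) := h2.integrable one_le_two
  have hd : dirichletForm P μ f = ∫ z, f z.1 * (f z.1 - f z.2) ∂(μ.compProd P) := by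
    rw [Measure.integral_compProd hi]
    refine integral_congr_ae ?_
    filter_upwards [((Measure.integrable_compProd_iff hint.aestronglyMeasurable).1 hint).1] with x hx
    rw [integral_const_mul, integral_sub (integrable_const _) hx]
    simp
  have e1 : ∫ z, f z.1 ^ 2 ∂(μ.compProd P) = ∫ x, f x ^ 2 ∂μ :=
    integral_comp_of_measurePreserving (measurePreserving_fst_compProd P μ) (hf.pow_const 2)
  have e2 : ∫ z, f z.2 ^ 2 ∂(μ.compProd P) = ∫ x, f x ^ 2 ∂μ :=
    integral_comp_of_measurePreserving (measurePreserving_snd_compProd h) (hf.pow_const 2)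
  have e3 : ∫ z, (f z.1 - f z.2) ^ 2 ∂(μ.compProd P)
      = ∫ z, (2 * (f z.1 * (f z.1 - f z.2)) - (f z.1 ^ 2 - f z.2 ^ 2)) ∂(μ.compProd P) :=
    integral_congr_ae (.of_forall fun z => by ring)
  have hs : Integrable (fun z : X × X => f z.1 ^ 2 - f z.2 ^ 2) (μ.compProd P) :=
    h1.integrable_sq.sub h2.integrable_sq
  rw [hsq, hd, e3, integral_sub (hi.const_mul 2) hs,
    integral_sub h1.integrable_sq h2.integrable_sq, e1, e2, integral_const_mul]
  ring

theorem invariant_const (μ : Measure X) [IsProbabilityMeasure μ] :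
    (Kernel.const X μ).Invariant μ := by
  ext s hs
  rw [Measure.bind_apply hs (Kernel.aemeasurable _)]
  simp

theorem sqForm_const (μ : Measure X) [IsProbabilityMeasure μ] {f : X → ℝ} (hf : Measurable f)
    (hL : MemLp f 2 μ) : sqForm (Kernel.const X μ) μ f = ENNReal.ofReal (2 * variance f μ) := by
  have h := dirichletForm_eq_sqForm (invariant_const μ) hf hL
  have hi := hL.integrable one_le_two
  have hv : dirichletForm (Kernel.const X μ) μ f = variance f μ := by
    rw [variance_eq_sub hL]
    simp only [dirichletForm, Kernel.const_apply, mul_sub, ← pow_two]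
    rw [integral_sub hL.integrable_sq (hi.mul_const _), integral_mul_const]
    simp [pow_two]
  rw [← ENNReal.ofReal_toReal (sqForm_ne_top (invariant_const μ) hf hL), ← hv, h]
  congr 1; ring

/-- By invariance a `μ`-null set is `P(x, ·)`-null for almost every `x`, so the inner integral does
not depend on the representative either. -/
theorem dirichletForm_congr_ae {P : Kernel X X} [IsMarkovKernel P] {μ : Measure X}
    (h : P.Invariant μ) {f g : X → ℝ} (hfg : f =ᵐ[μ] g) :
    dirichletForm P μ f = dirichletForm P μ g := by
  have h2 : ∀ᵐ x ∂μ, ∀ᵐ y ∂(P x), f y = g y := by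
    refine Measure.ae_ae_of_ae_comp ?_
    rw [h.def]; exact hfg
  refine integral_congr_ae ?_
  filter_upwards [hfg, h2] with x hx hx2
  rw [hx, integral_congr_ae hx2]

/-- Every `L²` function may be replaced by a measurable representative. The condition `c ≤ 1` covers
the conventional value 1 of the gap when no function has positive variance. -/
theorem le_spectralGap {P : Kernel X X} [IsMarkovKernel P] {μ : Measure X}
    (h : P.Invariant μ) {c : ℝ} (hc : c ≤ 1)
    (hf : ∀ f : X → ℝ, Measurable f → MemLp f 2 μ → c * variance f μ ≤ dirichletForm P μ f) :
    c ≤ spectralGap P μ := by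
  unfold spectralGap
  split_ifs with hex
  · obtain ⟨f, hf1, hf2⟩ := hex
    refine le_csInf ⟨_, f, hf1, hf2, rfl⟩ ?_
    rintro r ⟨g, hg1, hg2, rfl⟩
    rw [le_div_iff₀ hg2]
    have e := hg1.1.ae_eq_mk
    rw [variance_congr e, dirichletForm_congr_ae h e]
    exact hf _ hg1.1.stronglyMeasurable_mk.measurable ((memLp_congr_ae e).1 hg1)
  · exact hc

theorem dirichletForm_nonneg {P : Kernel X X} [IsMarkovKernel P] {μ : Measure X}
    [IsFiniteMeasure μ] (h : P.Invariant μ) {f : X → ℝ} (hL : MemLp f 2 μ) :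
    0 ≤ dirichletForm P μ f := by
  have e := hL.1.ae_eq_mk
  rw [dirichletForm_congr_ae h e, dirichletForm_eq_sqForm h hL.1.stronglyMeasurable_mk.measurable
    ((memLp_congr_ae e).1 hL)]
  positivity

theorem spectralGap_nonneg {P : Kernel X X} [IsMarkovKernel P] {μ : Measure X}
    [IsFiniteMeasure μ] (h : P.Invariant μ) : 0 ≤ spectralGap P μ := by
  unfold spectralGap
  split_ifs with hex
  · refine Real.sInf_nonneg ?_
    rintro r ⟨g, hg1, hg2, rfl⟩
    exact div_nonneg (dirichletForm_nonneg h hg1) hg2.le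
  · exact zero_le_one

theorem spectralGap_mul_variance_le {P : Kernel X X} [IsMarkovKernel P] {μ : Measure X}
    [IsFiniteMeasure μ] (h : P.Invariant μ) {f : X → ℝ} (hL : MemLp f 2 μ) :
    spectralGap P μ * variance f μ ≤ dirichletForm P μ f := by
  rcases (variance_nonneg f μ).eq_or_lt with h0 | h0
  · rw [← h0, mul_zero]; exact dirichletForm_nonneg h hL
  · rw [spectralGap, if_pos ⟨f, hL, h0⟩, ← le_div_iff₀ h0]
    refine csInf_le ⟨0, ?_⟩ ⟨f, hL, h0, rfl⟩
    rintro r ⟨g, hg1, hg2, rfl⟩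
    exact div_nonneg (dirichletForm_nonneg h hg1) hg2.le

/-- The gap as a comparison of forms: independent resampling from `μ` has form `2 Var`, so gap
estimates become inequalities between kernels, which can be lifted to product spaces. -/
theorem spectralGap_mul_sqForm_const_le {P : Kernel X X} [IsMarkovKernel P] {μ : Measure X}
    [IsProbabilityMeasure μ] (h : P.Invariant μ) {f : X → ℝ} (hf : Measurable f)
    (hL : MemLp f 2 μ) :
    ENNReal.ofReal (spectralGap P μ) * sqForm (Kernel.const X μ) μ f ≤ sqForm P μ f := by
  have h1 := spectralGap_mul_variance_le h hL
  rw [dirichletForm_eq_sqForm h hf hL] at h1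
  rw [sqForm_const μ hf hL, ← ENNReal.ofReal_mul (spectralGap_nonneg h),
    ← ENNReal.ofReal_toReal (sqForm_ne_top h hf hL)]
  exact ENNReal.ofReal_le_ofReal (by linarith)

theorem lintegral_sq_sub_integral {μ : Measure X} [IsProbabilityMeasure μ] {f : X → ℝ}
    (hL : MemLp f 2 μ) :
    ∫⁻ x, ENNReal.ofReal ((f x - ∫ y, f y ∂μ) ^ 2) ∂μ = ENNReal.ofReal (variance f μ) := by
  rw [ofReal_variance hL, evariance_eq_lintegral_ofReal]

/-- The fourfold bound for the form, centred at the mean, gives `E/2 ≤ 2 Var`. The ceiling is 2 and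
not 1, since nothing excludes spectrum near -1. -/
theorem spectralGap_le_two {P : Kernel X X} [IsMarkovKernel P] {μ : Measure X}
    [IsProbabilityMeasure μ] (h : P.Invariant μ) : spectralGap P μ ≤ 2 := by
  by_cases hex : ∃ f : X → ℝ, MemLp f 2 μ ∧ 0 < variance f μ
  · obtain ⟨g, hg1, hg2⟩ := hex
    have e := hg1.1.ae_eq_mk
    rw [variance_congr e] at hg2
    obtain ⟨f, hf, hL, hpos⟩ : ∃ f : X → ℝ, Measurable f ∧ MemLp f 2 μ ∧ 0 < variance f μ :=
      ⟨_, hg1.1.stronglyMeasurable_mk.measurable, (memLp_congr_ae e).1 hg1, hg2⟩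
    have h1 := spectralGap_mul_variance_le h hL
    have h2 := sqForm_le_of_invariant h hf (∫ y, f y ∂μ)
    rw [lintegral_sq_sub_integral hL, show (4 : ℝ≥0∞) = ENNReal.ofReal 4 by simp,
      ← ENNReal.ofReal_mul (by norm_num)] at h2
    have h3 := ENNReal.toReal_mono ENNReal.ofReal_ne_top h2
    rw [ENNReal.toReal_ofReal (by positivity)] at h3
    rw [dirichletForm_eq_sqForm h hf hL] at h1
    exact le_of_mul_le_mul_right (by linarith) hpos
  · rw [spectralGap, if_neg hex]; exact one_le_two

/-! ### Conditioning on the cells of a finite partition -/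

section Cells

variable {Y I : Type*} [MeasurableSpace Y] [MeasurableSpace I] [MeasurableSingletonClass I]
  [Fintype I]

/-- The mean of `f` over the cell `c⁻¹{i}`. -/
def cellMean (μ : Measure Y) (c : Y → I) (f : Y → ℝ) (i : I) : ℝ :=
  ∫ y, f y ∂(cond μ (c ⁻¹' {i}))

/-- The kernel that resamples from `μ` conditioned on the current cell. -/
def cellKernel (μ : Measure Y) {c : Y → I} (hc : Measurable c) : Kernel Y Y where
  toFun y := cond μ (c ⁻¹' {c y})
  measurable' := (measurable_of_countable fun i : I => cond μ (c ⁻¹' {i})).comp hc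

theorem cellKernel_apply (μ : Measure Y) {c : Y → I} (hc : Measurable c) (y : Y) :
    cellKernel μ hc y = cond μ (c ⁻¹' {c y}) := rfl

theorem isMarkovKernel_cellKernel (μ : Measure Y) [IsFiniteMeasure μ] {c : Y → I}
    (hc : Measurable c) (hpos : ∀ i, μ (c ⁻¹' {i}) ≠ 0) : IsMarkovKernel (cellKernel μ hc) :=
  ⟨fun y => cond_isProbabilityMeasure (hpos (c y))⟩

theorem lintegral_eq_sum_cells (μ : Measure Y) [IsFiniteMeasure μ] {c : Y → I}
    (hc : Measurable c) (g : Y → ℝ≥0∞) :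
    ∫⁻ y, g y ∂μ = ∑ i, μ (c ⁻¹' {i}) * ∫⁻ y, g y ∂(cond μ (c ⁻¹' {i})) := by
  conv_lhs => rw [← sum_meas_smul_cond_fiber hc μ]
  simp [lintegral_finsetSum_measure]

theorem memLp_cond {μ : Measure Y} [IsFiniteMeasure μ] {s : Set Y} (hs : μ s ≠ 0) {f : Y → ℝ}
    (hf : MemLp f 2 μ) : MemLp f 2 (cond μ s) :=
  (hf.restrict s).smul_measure (ENNReal.inv_ne_top.2 hs)

theorem integral_eq_sum_cells (μ : Measure Y) [IsFiniteMeasure μ] {c : Y → I}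
    (hc : Measurable c) {g : Y → ℝ} (hg : Integrable g μ) :
    ∫ y, g y ∂μ = ∑ i, μ.real (c ⁻¹' {i}) * cellMean μ c g i := by
  have hi : ∀ i ∈ Finset.univ, Integrable g (μ (c ⁻¹' {i}) • cond μ (c ⁻¹' {i})) := by
    intro i _
    refine hg.mono_measure ?_
    conv_rhs => rw [← sum_meas_smul_cond_fiber hc μ]
    exact Finset.single_le_sum (f := fun i => μ (c ⁻¹' {i}) • cond μ (c ⁻¹' {i}))
      (fun _ _ => Measure.zero_le _) (Finset.mem_univ i)
  conv_lhs => rw [← sum_meas_smul_cond_fiber hc μ]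
  rw [integral_finsetSum_measure hi]
  simp [cellMean, integral_smul_measure, Measure.real]

theorem integral_map_eq_sum (μ : Measure Y) [IsFiniteMeasure μ] {c : Y → I}
    (hc : Measurable c) (φ : I → ℝ) :
    ∫ i, φ i ∂(μ.map c) = ∑ i, μ.real (c ⁻¹' {i}) * φ i := by
  rw [integral_fintype .of_finite]
  refine Finset.sum_congr rfl fun i _ => ?_
  rw [map_measureReal_apply hc (measurableSet_singleton i), smul_eq_mul]

/-- The law of total variance, which produces the split `D + V` both on the base space and on the
product space. -/
theorem variance_eq_sum_cells (μ : Measure Y) [IsProbabilityMeasure μ] {c : Y → I}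
    (hc : Measurable c) (hpos : ∀ i, μ (c ⁻¹' {i}) ≠ 0) {f : Y → ℝ} (hf : MemLp f 2 μ) :
    variance f μ = ∑ i, μ.real (c ⁻¹' {i}) * variance f (cond μ (c ⁻¹' {i}))
      + variance (cellMean μ c f) (μ.map c) := by
  have : IsProbabilityMeasure (μ.map c) := Measure.isProbabilityMeasure_map hc.aemeasurable
  have hL : ∀ g : I → ℝ, MemLp g 2 (μ.map c) := fun g => .of_discrete
  have hv : ∀ i, variance f (cond μ (c ⁻¹' {i}))
      = cellMean μ c (fun y => f y ^ 2) i - cellMean μ c f i ^ 2 := fun i => by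
    have := cond_isProbabilityMeasure (hpos i)
    rw [variance_eq_sub (memLp_cond (hpos i) hf)]
    rfl
  rw [variance_eq_sub hf, variance_eq_sub (hL _)]
  have e1 : μ[f ^ 2] = ∑ i, μ.real (c ⁻¹' {i}) * cellMean μ c (fun y => f y ^ 2) i :=
    integral_eq_sum_cells μ hc hf.integrable_sq
  have e2 : μ[f] = ∑ i, μ.real (c ⁻¹' {i}) * cellMean μ c f i :=
    integral_eq_sum_cells μ hc (hf.integrable one_le_two)
  rw [e1, e2, integral_map_eq_sum μ hc, integral_map_eq_sum μ hc]
  simp only [hv, mul_sub, Finset.sum_sub_distrib, Pi.pow_apply]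
  ring

theorem lintegral_sq_sub_cellMean (μ : Measure Y) [IsProbabilityMeasure μ] {c : Y → I}
    (hc : Measurable c) (hpos : ∀ i, μ (c ⁻¹' {i}) ≠ 0) {f : Y → ℝ} (hf : MemLp f 2 μ) :
    ∫⁻ y, ENNReal.ofReal ((f y - cellMean μ c f (c y)) ^ 2) ∂μ
      = ∑ i, μ (c ⁻¹' {i}) * ENNReal.ofReal (variance f (cond μ (c ⁻¹' {i}))) := by
  rw [lintegral_eq_sum_cells μ hc]
  refine Finset.sum_congr rfl fun i _ => ?_
  have := cond_isProbabilityMeasure (hpos i)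
  rw [← lintegral_sq_sub_integral (memLp_cond (hpos i) hf)]
  congr 1
  refine lintegral_congr_ae ?_
  filter_upwards [ae_cond_mem (hc (measurableSet_singleton i))] with y hy
  rw [show c y = i from hy]
  rfl

theorem sum_cells_toReal {I : Type*} [Fintype I] (μ : Measure Y) [IsProbabilityMeasure μ]
    {c : Y → I} (f : Y → ℝ) :
    ∑ i, μ (c ⁻¹' {i}) * ENNReal.ofReal (variance f (cond μ (c ⁻¹' {i})))
      = ENNReal.ofReal (∑ i, μ.real (c ⁻¹' {i}) * variance f (cond μ (c ⁻¹' {i}))) := by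
  rw [ENNReal.ofReal_sum_of_nonneg fun i _ => mul_nonneg measureReal_nonneg (variance_nonneg _ _)]
  refine Finset.sum_congr rfl fun i _ => ?_
  rw [ENNReal.ofReal_mul measureReal_nonneg, ofReal_measureReal]

theorem sqForm_cellKernel (μ : Measure Y) [IsProbabilityMeasure μ] {c : Y → I}
    (hc : Measurable c) (hpos : ∀ i, μ (c ⁻¹' {i}) ≠ 0) {f : Y → ℝ} (hf : Measurable f)
    (hL : MemLp f 2 μ) :
    sqForm (cellKernel μ hc) μ f
      = 2 * ∑ i, μ (c ⁻¹' {i}) * ENNReal.ofReal (variance f (cond μ (c ⁻¹' {i}))) := by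
  rw [sqForm, lintegral_eq_sum_cells μ hc, Finset.mul_sum]
  refine Finset.sum_congr rfl fun i _ => ?_
  have := cond_isProbabilityMeasure (hpos i)
  rw [mul_left_comm, show (2 : ℝ≥0∞) = ENNReal.ofReal 2 by simp, ← ENNReal.ofReal_mul zero_le_two,
    ← sqForm_const _ hf (memLp_cond (hpos i) hL), sqForm]
  congr 1
  refine lintegral_congr_ae ?_
  filter_upwards [ae_cond_mem (hc (measurableSet_singleton i))] with y hy
  rw [cellKernel_apply, show c y = i from hy, Kernel.const_apply]

theorem measurable_cellMean_comp (μ : Measure Y) {c : Y → I} (hc : Measurable c) (f : Y → ℝ) :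
    Measurable fun y => cellMean μ c f (c y) :=
  (measurable_of_countable (cellMean μ c f)).comp hc

theorem memLp_comp_of_fintype (μ : Measure Y) [IsFiniteMeasure μ] {c : Y → I}
    (hc : Measurable c) (φ : I → ℝ) : MemLp (fun y => φ (c y)) 2 μ := by
  have h : MemLp φ 2 (μ.map c) := .of_discrete
  exact h.comp_measurePreserving ⟨hc, rfl⟩

end Cells

/-! ### Restricted chains -/

section Restriction

variable {X : Type*} [MeasurableSpace X]

theorem restrictKernel_apply_apply (T : Kernel X X) {A : Set X} (hA : MeasurableSet A) (x : A)
    {s : Set A} (hs : MeasurableSet s) :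
    restrictKernel T hA x s
      = T x (Subtype.val '' s) + T x Aᶜ * (Subtype.val '' s).indicator 1 (x : X) := by
  have h : restrictKernel T hA x = (T x).comap Subtype.val + (T x Aᶜ) • Measure.dirac x := rfl
  rw [h, Measure.add_apply, Measure.smul_apply, smul_eq_mul, Measure.dirac_apply' _ hs,
    (MeasurableEmbedding.subtype_coe hA).comap_apply]
  by_cases hx : x ∈ s <;> simp [Set.indicator, hx]

theorem isMarkovKernel_restrictKernel (T : Kernel X X) [IsMarkovKernel T] {A : Set X}
    (hA : MeasurableSet A) : IsMarkovKernel (restrictKernel T hA) := by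
  refine ⟨fun x => ⟨?_⟩⟩
  rw [restrictKernel_apply_apply T hA x .univ]
  simp [prob_add_prob_compl hA]

theorem measurePreserving_restrictMeasure (μ : Measure X) {A : Set X} (hA : MeasurableSet A) :
    MeasurePreserving Subtype.val (restrictMeasure μ A) (cond μ A) := by
  refine ⟨measurable_subtype_coe, ?_⟩
  rw [restrictMeasure, (MeasurableEmbedding.subtype_coe hA).map_comap, Subtype.range_coe]
  exact Measure.restrict_eq_self_of_ae_mem (ae_cond_mem hA)

theorem isProbabilityMeasure_restrictMeasure (μ : Measure X) [IsFiniteMeasure μ] {A : Set X}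
    (hA : MeasurableSet A) (h0 : μ A ≠ 0) : IsProbabilityMeasure (restrictMeasure μ A) := by
  have := cond_isProbabilityMeasure h0
  have h := (measurePreserving_restrictMeasure μ hA).measure_preimage
    MeasurableSet.univ.nullMeasurableSet
  exact ⟨by simpa using h⟩

/-- For `s ⊆ A`, reversibility turns the mass entering `s` from `A` into `∫_s T(x, A) dμ`. The
rejected moves contribute `∫_s T(x, Aᶜ) dμ`, and the two add up to `μ(s)`. -/
theorem invariant_restrictKernel {T : Kernel X X} [IsMarkovKernel T] {μ : Measure X}
    (hT : T.IsReversible μ) {A : Set X} (hA : MeasurableSet A) :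
    (restrictKernel T hA).Invariant (restrictMeasure μ A) := by
  ext s hs
  have hS : MeasurableSet (Subtype.val '' s) := hA.subtype_image hs
  have hSA : Subtype.val '' s ⊆ A := by rintro _ ⟨y, _, rfl⟩; exact y.2
  have hmp := measurePreserving_restrictMeasure μ hA
  have hm1 : Measurable fun x => T x (Subtype.val '' s) := T.measurable_coe hS
  have hm2 : Measurable fun x => T x Aᶜ * (Subtype.val '' s).indicator 1 x :=
    (T.measurable_coe hA.compl).mul (measurable_one.indicator hS)
  rw [Measure.bind_apply hs (Kernel.aemeasurable _)]
  simp only [restrictKernel_apply_apply T hA _ hs]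
  rw [hmp.lintegral_comp (hm1.fun_add hm2)]
  have hs' : s = Subtype.val ⁻¹' (Subtype.val '' s : Set X) :=
    (Set.preimage_image_eq s Subtype.val_injective).symm
  conv_rhs => rw [hs', hmp.measure_preimage hS.nullMeasurableSet]
  rw [cond_apply hA, ProbabilityTheory.cond, lintegral_smul_measure, smul_eq_mul]
  congr 1
  rw [lintegral_add_left hm1, Set.inter_eq_self_of_subset_right hSA, hT hA hS]
  have e : ∀ x, T x Aᶜ * (Subtype.val '' s).indicator 1 x
      = (Subtype.val '' s).indicator (fun x => T x Aᶜ) x := fun x => by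
    by_cases hx : x ∈ (Subtype.val '' s : Set X) <;> simp [hx]
  simp only [e]
  rw [lintegral_indicator hS, Measure.restrict_restrict hS, Set.inter_eq_self_of_subset_left hSA,
    ← lintegral_add_left (T.measurable_coe hA)]
  simp [prob_add_prob_compl hA]

/-- A rejected move stays put and adds nothing to the squared increment; the remaining moves are
among those of `T`. -/
theorem lintegral_restrictKernel_sq_sub_le (T : Kernel X X) {A : Set X}
    (hA : MeasurableSet A) {f : X → ℝ} (hf : Measurable f) (x : A) :
    ∫⁻ y, ENNReal.ofReal ((f x - f y) ^ 2) ∂(restrictKernel T hA x)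
      ≤ ∫⁻ y, ENNReal.ofReal ((f x - f y) ^ 2) ∂(T x) := by
  have h : restrictKernel T hA x = (T x).comap Subtype.val + (T x Aᶜ) • Measure.dirac x := rfl
  have hm : Measurable fun y : A => ENNReal.ofReal ((f x - f y) ^ 2) :=
    ((measurable_const.sub (hf.comp measurable_subtype_coe)).pow_const 2).ennreal_ofReal
  rw [h, lintegral_add_measure, lintegral_smul_measure, lintegral_dirac' _ hm]
  simp only [sub_self, ne_eq, OfNat.ofNat_ne_zero, not_false_eq_true, zero_pow, ENNReal.ofReal_zero,
    smul_zero, add_zero]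
  rw [lintegral_subtype_comap hA (fun y => ENNReal.ofReal ((f x - f y) ^ 2))]
  exact setLIntegral_le_lintegral _ _

theorem spectralGap_restrict_mul_variance_le {T : Kernel X X} [IsMarkovKernel T] {μ : Measure X}
    [IsFiniteMeasure μ] (hT : T.IsReversible μ) {A : Set X} (hA : MeasurableSet A) (h0 : μ A ≠ 0)
    {f : X → ℝ} (hf : Measurable f) (hL : MemLp f 2 μ) :
    ENNReal.ofReal (spectralGap (restrictKernel T hA) (restrictMeasure μ A))
        * ENNReal.ofReal (2 * variance f (cond μ A))
      ≤ ∫⁻ x, ∫⁻ y, ENNReal.ofReal ((f x - f y) ^ 2) ∂(T x) ∂(cond μ A) := by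
  have := isMarkovKernel_restrictKernel T hA
  have := isProbabilityMeasure_restrictMeasure μ hA h0
  have hmp := measurePreserving_restrictMeasure μ hA
  have hfm : Measurable fun x : A => f x := hf.comp measurable_subtype_coe
  have hfL : MemLp (fun x : A => f x) 2 (restrictMeasure μ A) :=
    (memLp_cond h0 hL).comp_measurePreserving hmp
  have h1 := spectralGap_mul_sqForm_const_le (invariant_restrictKernel hT hA) hfm hfL
  rw [sqForm_const _ hfm hfL, hmp.variance_fun_comp hf.aemeasurable] at h1
  refine h1.trans ?_
  rw [← hmp.lintegral_comp (measurable_lintegral_sq_sub T hf)]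
  exact lintegral_mono fun x => lintegral_restrictKernel_sq_sub_le T hA hf x

/-- Sum the gap inequalities of the restrictions over the cells: resampling inside the current cell
is dominated by `T`. -/
theorem le_sqForm_of_restrictedGap {I : Type*} [MeasurableSpace I] [MeasurableSingletonClass I]
    [Fintype I] {T : Kernel X X} [IsMarkovKernel T] {μ : Measure X} [IsProbabilityMeasure μ]
    (hT : T.IsReversible μ) {c : X → I} (hc : Measurable c) (hpos : ∀ i, μ (c ⁻¹' {i}) ≠ 0)
    {l : ℝ}
    (hl : ∀ i, l ≤ spectralGap (restrictKernel T (hc (measurableSet_singleton i)))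
      (restrictMeasure μ (c ⁻¹' {i})))
    {f : X → ℝ} (hf : Measurable f) (hL : MemLp f 2 μ) :
    ENNReal.ofReal l * sqForm (cellKernel μ hc) μ f ≤ sqForm T μ f := by
  rw [sqForm_cellKernel μ hc hpos hf hL, sqForm, lintegral_eq_sum_cells μ hc, Finset.mul_sum,
    Finset.mul_sum]
  refine Finset.sum_le_sum fun i _ => ?_
  refine le_trans ?_ (mul_le_mul_right (spectralGap_restrict_mul_variance_le hT
    (hc (measurableSet_singleton i)) (hpos i) hf hL) _)
  rw [ENNReal.ofReal_mul zero_le_two, ENNReal.ofReal_ofNat]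
  calc _ = μ (c ⁻¹' {i}) * (ENNReal.ofReal l
        * (2 * ENNReal.ofReal (variance f (cond μ (c ⁻¹' {i}))))) := by ring
    _ ≤ _ := by gcongr; exact hl i

end Restriction

/-! ### The projected chain and the decomposition of a gap -/

section Projection

variable {X : Type*} [MeasurableSpace X] {J : ℕ}

theorem projMeasure_eq_map (μ : Measure X) {c : X → Fin J} (hc : Measurable c) :
    projMeasure μ (fun j => c ⁻¹' {j}) = μ.map c := by
  refine Measure.ext_of_singleton fun j => ?_
  rw [Measure.map_apply hc (measurableSet_singleton j)]
  simp [projMeasure, Measure.finsetSum_apply, Set.indicator]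

/-- A step of the projected chain draws a point from the current cell, moves it by `T` and reads off
the new cell. -/
theorem projKernel_eq_map (T : Kernel X X) (μ : Measure X) {c : X → Fin J} (hc : Measurable c)
    (i : Fin J) :
    projKernel T μ (fun j => c ⁻¹' {j}) i = ((cond μ (c ⁻¹' {i})).bind T).map c := by
  refine Measure.ext_of_singleton fun j => ?_
  have h : projKernel T μ (fun j => c ⁻¹' {j}) i
      = ∑ j, ((μ (c ⁻¹' {i}))⁻¹ * ∫⁻ x in c ⁻¹' {i}, T x (c ⁻¹' {j}) ∂μ) • Measure.dirac j := rfl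
  rw [Measure.map_apply hc (measurableSet_singleton j), Measure.bind_apply
    (hc (measurableSet_singleton j)) T.aemeasurable, h, ProbabilityTheory.cond,
    lintegral_smul_measure]
  simp [Measure.finsetSum_apply, Set.indicator]

theorem isMarkovKernel_projKernel (T : Kernel X X) [IsMarkovKernel T] (μ : Measure X)
    [IsFiniteMeasure μ] {c : X → Fin J} (hc : Measurable c) (hpos : ∀ i, μ (c ⁻¹' {i}) ≠ 0) :
    IsMarkovKernel (projKernel T μ (fun j => c ⁻¹' {j})) := by
  refine ⟨fun i => ?_⟩
  rw [projKernel_eq_map T μ hc]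
  have := cond_isProbabilityMeasure (hpos i)
  exact Measure.isProbabilityMeasure_map hc.aemeasurable

theorem lintegral_projKernel (T : Kernel X X) (μ : Measure X) {c : X → Fin J}
    (hc : Measurable c) (i : Fin J) (g : Fin J → ℝ≥0∞) :
    ∫⁻ j, g j ∂(projKernel T μ (fun j => c ⁻¹' {j}) i)
      = ∫⁻ x, ∫⁻ y, g (c y) ∂(T x) ∂(cond μ (c ⁻¹' {i})) := by
  have hg : Measurable g := measurable_of_countable g
  rw [projKernel_eq_map T μ hc, lintegral_map hg hc,
    Measure.lintegral_bind T.aemeasurable (f := fun y => g (c y)) (hg.comp hc).aemeasurable]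

theorem lintegral_map_cells (μ : Measure X) {c : X → Fin J} (hc : Measurable c)
    (g : Fin J → ℝ≥0∞) : ∫⁻ i, g i ∂(μ.map c) = ∑ i, μ (c ⁻¹' {i}) * g i := by
  rw [lintegral_fintype]
  refine Finset.sum_congr rfl fun i _ => ?_
  rw [Measure.map_apply hc (measurableSet_singleton i), mul_comm]

theorem invariant_projKernel {T : Kernel X X} {μ : Measure X} [IsFiniteMeasure μ]
    (hT : T.Invariant μ) {c : X → Fin J} (hc : Measurable c) :
    (projKernel T μ (fun j => c ⁻¹' {j})).Invariant (μ.map c) := by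
  ext s hs
  rw [Measure.bind_apply hs (Kernel.aemeasurable _), lintegral_map_cells μ hc,
    Measure.map_apply hc hs]
  have e : ∀ i, projKernel T μ (fun j => c ⁻¹' {j}) i s
      = ∫⁻ x, T x (c ⁻¹' s) ∂(cond μ (c ⁻¹' {i})) := fun i => by
    rw [projKernel_eq_map T μ hc, Measure.map_apply hc hs,
      Measure.bind_apply (hc hs) T.aemeasurable]
  simp only [e]
  rw [← lintegral_eq_sum_cells μ hc, ← Measure.bind_apply (hc hs) T.aemeasurable, hT.def]

theorem sqForm_projKernel (T : Kernel X X) (μ : Measure X) [IsFiniteMeasure μ]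
    {c : X → Fin J} (hc : Measurable c) (φ : Fin J → ℝ) :
    sqForm (projKernel T μ (fun j => c ⁻¹' {j})) (μ.map c) φ = sqForm T μ (fun x => φ (c x)) := by
  rw [sqForm, lintegral_map_cells μ hc, sqForm, lintegral_eq_sum_cells μ hc]
  refine Finset.sum_congr rfl fun i _ => ?_
  rw [lintegral_projKernel T μ hc]
  congr 1
  refine lintegral_congr_ae ?_
  filter_upwards [ae_cond_mem (hc (measurableSet_singleton i))] with y hy
  rw [show c y = i from hy]

/-- Split the variance into `D` inside the cells and `V` between them. The hypothesis on `l` bounds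
`D`. For `V`, apply the gap of the projected chain to the cell means, and compare the form of the
cell means with that of `f`: their difference has second moment `D`, so it costs at most `8D`. -/
theorem le_sqForm_of_projectedGap {T : Kernel X X} [IsMarkovKernel T] {μ : Measure X}
    [IsProbabilityMeasure μ] (hT : T.Invariant μ) {c : X → Fin J} (hc : Measurable c)
    (hpos : ∀ i, μ (c ⁻¹' {i}) ≠ 0) {l : ℝ} (hl0 : 0 ≤ l) (hl2 : l ≤ 2) {f : X → ℝ}
    (hf : Measurable f) (hL : MemLp f 2 μ)
    (hl : ENNReal.ofReal l * sqForm (cellKernel μ hc) μ f ≤ sqForm T μ f) :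
    ENNReal.ofReal (l * spectralGap (projKernel T μ (fun j => c ⁻¹' {j})) (μ.map c))
      * sqForm (Kernel.const X μ) μ f ≤ 16 * sqForm T μ f := by
  have := isMarkovKernel_projKernel T μ hc hpos
  have : IsProbabilityMeasure (μ.map c) := Measure.isProbabilityMeasure_map hc.aemeasurable
  have hinv := invariant_projKernel hT hc
  set G := spectralGap (projKernel T μ (fun j => c ⁻¹' {j})) (μ.map c) with hG
  have hG0 : 0 ≤ G := spectralGap_nonneg hinv
  have hG2 : G ≤ 2 := spectralGap_le_two hinv
  set D := ∑ i, μ.real (c ⁻¹' {i}) * variance f (cond μ (c ⁻¹' {i})) with hD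
  have hD0 : 0 ≤ D :=
    Finset.sum_nonneg fun i _ => mul_nonneg measureReal_nonneg (variance_nonneg _ _)
  have hgm := measurable_cellMean_comp μ hc f
  have hgL : MemLp (fun y => cellMean μ c f (c y)) 2 μ := memLp_comp_of_fintype μ hc _
  have hfin := sqForm_ne_top hT hf hL
  set a := (sqForm T μ f).toReal with ha
  have ha0 : 0 ≤ a := ENNReal.toReal_nonneg
  have haE : sqForm T μ f = ENNReal.ofReal a := (ENNReal.ofReal_toReal hfin).symm
  have h1 : l * (2 * D) ≤ a := by
    rw [sqForm_cellKernel μ hc hpos hf hL, sum_cells_toReal, ← hD, haE,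
      show (2 : ℝ≥0∞) = ENNReal.ofReal 2 by simp, ← ENNReal.ofReal_mul zero_le_two,
      ← ENNReal.ofReal_mul hl0] at hl
    exact (ENNReal.ofReal_le_ofReal_iff ha0).1 hl
  have h2 : G * (2 * variance (cellMean μ c f) (μ.map c)) ≤ 2 * a + 8 * D := by
    have e1 := spectralGap_mul_sqForm_const_le hinv (measurable_of_countable (cellMean μ c f))
      MemLp.of_discrete
    rw [sqForm_const _ (measurable_of_countable _) MemLp.of_discrete, sqForm_projKernel T μ hc,
      ← hG] at e1
    have e2 := sqForm_add_le T μ hf (hgm.sub hf)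
    simp only [Pi.sub_apply, add_sub_cancel] at e2
    have e3 := sqForm_le_of_invariant hT (hgm.sub hf) 0
    simp only [Pi.sub_apply, sub_zero] at e3
    have e4 : ∀ x, (cellMean μ c f (c x) - f x) ^ 2 = (f x - cellMean μ c f (c x)) ^ 2 :=
      fun x => by ring
    simp only [e4] at e3
    rw [lintegral_sq_sub_cellMean μ hc hpos hL, sum_cells_toReal, ← hD] at e3
    have e5 := e1.trans (e2.trans (add_le_add_right (mul_le_mul_right e3 2) _))
    rw [haE, ← ENNReal.ofReal_mul hG0, show (2 : ℝ≥0∞) = ENNReal.ofReal 2 by simp,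
      show (4 : ℝ≥0∞) = ENNReal.ofReal 4 by simp, ← ENNReal.ofReal_mul (by norm_num),
      ← ENNReal.ofReal_mul (by norm_num), ← ENNReal.ofReal_mul (by norm_num),
      ← ENNReal.ofReal_add (by positivity) (by positivity)] at e5
    have := (ENNReal.ofReal_le_ofReal_iff (by positivity)).1 e5
    linarith
  rw [sqForm_const _ hf hL, variance_eq_sum_cells μ hc hpos hL, ← hD, haE,
    show (16 : ℝ≥0∞) = ENNReal.ofReal 16 by simp, ← ENNReal.ofReal_mul (by positivity),
    ← ENNReal.ofReal_mul (by norm_num)]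
  refine ENNReal.ofReal_le_ofReal ?_
  -- With `a` the form of `T`, `l G · 2D ≤ G a ≤ 2a` and `l G · 2V ≤ 2 l a + 8 l D ≤ 8a`, a total of
  -- `10a ≤ 16a`.
  have h3 := mul_le_mul_of_nonneg_left h2 hl0
  have h4 := mul_le_mul_of_nonneg_left h1 hG0
  have h5 : G * a ≤ 2 * a := mul_le_mul_of_nonneg_right hG2 ha0
  have h6 : l * a ≤ 2 * a := mul_le_mul_of_nonneg_right hl2 ha0
  nlinarith

end Projection

/-! ### Product measures, coordinate updates and the Efron–Stein inequality -/

section Product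

variable {X : Type*} [MeasurableSpace X] {N : ℕ}

theorem measurable_update_pair (k : Fin (N + 1)) :
    Measurable fun q : (Fin (N + 1) → X) × X => Function.update q.1 k q.2 := by
  refine measurable_pi_lambda _ fun i => ?_
  by_cases h : i = k
  · subst h; simpa using measurable_snd
  · simp only [Function.update_of_ne h]
    exact (measurable_pi_apply i).comp measurable_fst

theorem measurePreserving_update (m : Fin (N + 1) → Measure X) [∀ k, IsProbabilityMeasure (m k)]
    (m' : Measure X) [IsProbabilityMeasure m'] (k : Fin (N + 1)) :
    MeasurePreserving (fun q : (Fin (N + 1) → X) × X => Function.update q.1 k q.2)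
      ((Measure.pi m).prod m') (Measure.pi (Function.update m k m')) := by
  have hprob : ∀ i, IsProbabilityMeasure (Function.update m k m' i) := fun i => by
    by_cases h : i = k
    · subst h; simpa
    · rw [Function.update_of_ne h]; infer_instance
  refine ⟨measurable_update_pair k, (Measure.pi_eq fun s hs => ?_).symm⟩
  rw [Measure.map_apply (measurable_update_pair k) (.univ_pi hs)]
  have e : (fun q : (Fin (N + 1) → X) × X => Function.update q.1 k q.2) ⁻¹' Set.univ.pi s
      = (Set.univ.pi (Function.update s k Set.univ)) ×ˢ s k := by
    ext q
    simp only [Set.mem_preimage, Set.mem_pi, Set.mem_univ, true_implies, Set.mem_prod]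
    constructor
    · refine fun h => ⟨fun i => ?_, by simpa using h k⟩
      by_cases hi : i = k
      · subst hi; simp
      · simpa [Function.update_of_ne hi] using h i
    · rintro ⟨h, h'⟩ i
      by_cases hi : i = k
      · subst hi; simpa
      · simpa [Function.update_of_ne hi] using h i
  rw [e, Measure.prod_prod, Measure.pi_pi, ← Finset.mul_prod_erase _ _ (Finset.mem_univ k),
    ← Finset.mul_prod_erase _ (fun i => Function.update m k m' i (s i)) (Finset.mem_univ k)]
  have e2 : ∏ i ∈ Finset.univ.erase k, m i (Function.update s k Set.univ i)
      = ∏ i ∈ Finset.univ.erase k, Function.update m k m' i (s i) := by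
    refine Finset.prod_congr rfl fun i hi => ?_
    rw [Function.update_of_ne (Finset.ne_of_mem_erase hi),
      Function.update_of_ne (Finset.ne_of_mem_erase hi)]
  rw [e2]
  simp [mul_comm]

variable (m : Fin (N + 1) → Measure X) [∀ k, IsProbabilityMeasure (m k)]

theorem measurePreserving_update_self (k : Fin (N + 1)) :
    MeasurePreserving (fun q : (Fin (N + 1) → X) × X => Function.update q.1 k q.2)
      ((Measure.pi m).prod (m k)) (Measure.pi m) := by
  simpa using measurePreserving_update m (m k) k

theorem lintegral_pi_eq_lintegral_update (k : Fin (N + 1)) {g : (Fin (N + 1) → X) → ℝ≥0∞}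
    (hg : Measurable g) :
    ∫⁻ x, g x ∂(Measure.pi m) = ∫⁻ x, ∫⁻ t, g (Function.update x k t) ∂(m k) ∂(Measure.pi m) := by
  rw [← (measurePreserving_update_self m k).lintegral_comp hg,
    lintegral_prod (fun q => g (Function.update q.1 k q.2))
      (hg.comp (measurable_update_pair k)).aemeasurable]

variable (T : Fin (N + 1) → Kernel X X) [∀ k, IsMarkovKernel (T k)]

theorem lintegral_coordKernel (k : Fin (N + 1)) (x : Fin (N + 1) → X)
    {g : (Fin (N + 1) → X) → ℝ≥0∞} (hg : Measurable g) :
    ∫⁻ y, g y ∂(coordKernel T k x) = ∫⁻ t, g (Function.update x k t) ∂(T k (x k)) :=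
  lintegral_map hg (measurable_update _)

instance isMarkovKernel_coordKernel (k : Fin (N + 1)) : IsMarkovKernel (coordKernel T k) :=
  ⟨fun x => Measure.isProbabilityMeasure_map (measurable_update x).aemeasurable⟩

theorem sqForm_coordKernel (k : Fin (N + 1)) (μ : Measure (Fin (N + 1) → X))
    {f : (Fin (N + 1) → X) → ℝ} (hf : Measurable f) :
    sqForm (coordKernel T k) μ f
      = ∫⁻ x, ∫⁻ t, ENNReal.ofReal ((f x - f (Function.update x k t)) ^ 2) ∂(T k (x k)) ∂μ := by
  refine lintegral_congr fun x => ?_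
  exact lintegral_coordKernel T k x ((measurable_const.sub hf).pow_const 2).ennreal_ofReal

/-- Under the product measure coordinate `k` may be redrawn from `m k` before the update. The form
is then an average of one-dimensional forms along the fibres, so that comparisons of kernels on the
base space lift to the product. -/
theorem sqForm_coordKernel_eq_lintegral (k : Fin (N + 1)) {f : (Fin (N + 1) → X) → ℝ}
    (hf : Measurable f) :
    sqForm (coordKernel T k) (Measure.pi m) f
      = ∫⁻ x, sqForm (T k) (m k) (fun t => f (Function.update x k t)) ∂(Measure.pi m) := by
  have hm := measurable_lintegral_sq_sub (coordKernel T k) hf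
  rw [sqForm, lintegral_pi_eq_lintegral_update m k hm]
  refine lintegral_congr fun x => lintegral_congr fun t => ?_
  rw [lintegral_coordKernel T k _ ((measurable_const.fun_sub hf).pow_const 2).ennreal_ofReal]
  simp

theorem ae_memLp_update (k : Fin (N + 1)) {f : (Fin (N + 1) → X) → ℝ} (hf : Measurable f)
    (hL : MemLp f 2 (Measure.pi m)) :
    ∀ᵐ x ∂(Measure.pi m), MemLp (fun t => f (Function.update x k t)) 2 (m k) := by
  have h := (hL.comp_measurePreserving (measurePreserving_update_self m k)).integrable_sq
  filter_upwards [h.prod_right_ae] with x hx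
  exact (memLp_two_iff_integrable_sq (hf.comp (measurable_update x)).aestronglyMeasurable).2 hx

theorem sqForm_coordKernel_mono (S : Fin (N + 1) → Kernel X X) [∀ k, IsMarkovKernel (S k)]
    (k : Fin (N + 1)) {a b : ℝ≥0∞} (hb : b ≠ ∞) (ha : a ≠ ∞)
    (h : ∀ f : X → ℝ, Measurable f → MemLp f 2 (m k) →
      a * sqForm (S k) (m k) f ≤ b * sqForm (T k) (m k) f)
    {f : (Fin (N + 1) → X) → ℝ} (hf : Measurable f) (hL : MemLp f 2 (Measure.pi m)) :
    a * sqForm (coordKernel S k) (Measure.pi m) f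
      ≤ b * sqForm (coordKernel T k) (Measure.pi m) f := by
  rw [sqForm_coordKernel_eq_lintegral m S k hf, sqForm_coordKernel_eq_lintegral m T k hf,
    ← lintegral_const_mul' _ _ ha, ← lintegral_const_mul' _ _ hb]
  refine lintegral_mono_ae ?_
  filter_upwards [ae_memLp_update m k hf hL] with x hx
  exact h _ (hf.comp (measurable_update x)) hx

theorem invariant_coordKernel (k : Fin (N + 1)) (h : (T k).Invariant (m k)) :
    (coordKernel T k).Invariant (Measure.pi m) := by
  ext s hs
  rw [Measure.bind_apply hs (Kernel.aemeasurable _),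
    lintegral_pi_eq_lintegral_update m k ((coordKernel T k).measurable_coe hs)]
  have e : ∀ x : Fin (N + 1) → X, ∫⁻ t, coordKernel T k (Function.update x k t) s ∂(m k)
      = ∫⁻ t, s.indicator 1 (Function.update x k t) ∂(m k) := fun x => by
    rw [← lintegral_lintegral_of_invariant h (g := fun t => s.indicator 1 (Function.update x k t))
      ((measurable_one.indicator hs).comp (measurable_update x))]
    refine lintegral_congr fun t => ?_
    rw [← lintegral_indicator_one hs, lintegral_coordKernel T k _ (measurable_one.indicator hs)]
    simp
  simp only [e]
  rw [← lintegral_pi_eq_lintegral_update m k (measurable_one.indicator hs),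
    lintegral_indicator_one hs]

/-- For a pair of states given coordinatewise, the state with the second entries at the
coordinates in `s` and the first entries elsewhere. -/
def mixState (s : Finset (Fin (N + 1))) (w : Fin (N + 1) → X × X) : Fin (N + 1) → X :=
  fun i => if i ∈ s then (w i).2 else (w i).1

/-- Exchange the two entries of a pair of states at the coordinates in `s`. -/
def exchangeState (s : Finset (Fin (N + 1))) (w : Fin (N + 1) → X × X) : Fin (N + 1) → X × X :=
  fun i => if i ∈ s then (w i).swap else w i

theorem measurePreserving_mixState (s : Finset (Fin (N + 1))) :
    MeasurePreserving (mixState (X := X) s) (Measure.pi fun i => (m i).prod (m i))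
      (Measure.pi m) := by
  have h : ∀ i, MeasurePreserving (fun q : X × X => if i ∈ s then q.2 else q.1)
      ((m i).prod (m i)) (m i) := fun i => by
    by_cases hi : i ∈ s
    · simpa only [hi, if_true] using measurePreserving_snd
    · simpa only [hi, if_false] using measurePreserving_fst
  exact measurePreserving_pi _ _ h

theorem measurePreserving_exchangeState (s : Finset (Fin (N + 1))) :
    MeasurePreserving (exchangeState (X := X) s) (Measure.pi fun i => (m i).prod (m i))
      (Measure.pi fun i => (m i).prod (m i)) := by
  have h : ∀ i, MeasurePreserving (fun q : X × X => if i ∈ s then q.swap else q)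
      ((m i).prod (m i)) ((m i).prod (m i)) := fun i => by
    by_cases hi : i ∈ s
    · simpa only [hi, if_true] using Measure.measurePreserving_swap
    · simp only [hi, if_false]
      exact MeasurePreserving.id ((m i).prod (m i))
  exact measurePreserving_pi _ _ h

theorem mixState_exchangeState {X : Type*} (s t : Finset (Fin (N + 1)))
    (w : Fin (N + 1) → X × X) :
    mixState s (exchangeState t w) = mixState (symmDiff s t) w := by
  funext i
  by_cases hs : i ∈ s <;> by_cases ht : i ∈ t <;>
    simp [mixState, exchangeState, Finset.mem_symmDiff, hs, ht]

theorem integral_sub_mul_sub {Y : Type*} [MeasurableSpace Y] {ρ : Measure Y} {a b c d : Y → ℝ}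
    (ha : MemLp a 2 ρ) (hb : MemLp b 2 ρ) (hc : MemLp c 2 ρ) (hd : MemLp d 2 ρ) :
    ∫ y, (a y - b y) * (c y - d y) ∂ρ
      = ∫ y, a y * c y ∂ρ - ∫ y, a y * d y ∂ρ - (∫ y, b y * c y ∂ρ - ∫ y, b y * d y ∂ρ) := by
  have hac : Integrable (fun y => a y * c y) ρ := ha.integrable_mul hc
  have had : Integrable (fun y => a y * d y) ρ := ha.integrable_mul hd
  have hbc : Integrable (fun y => b y * c y) ρ := hb.integrable_mul hc
  have hbd : Integrable (fun y => b y * d y) ρ := hb.integrable_mul hd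
  have h1 : Integrable (fun y => a y * c y - a y * d y) ρ := hac.sub had
  have h2 : Integrable (fun y => b y * c y - b y * d y) ρ := hbc.sub hbd
  rw [← integral_sub hac had, ← integral_sub hbc hbd, ← integral_sub h1 h2]
  exact integral_congr_ae (.of_forall fun y => by ring)

/-- The Efron–Stein inequality. -/
theorem variance_pi_le {f : (Fin (N + 1) → X) → ℝ} (hf : Measurable f)
    (hL : MemLp f 2 (Measure.pi m)) :
    variance f (Measure.pi m) ≤ ∑ k : Fin (N + 1), (∫ w, (f (mixState ∅ w) - f (mixState {k} w)) ^ 2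
      ∂(Measure.pi fun i => (m i).prod (m i))) / 2 := by
  set ρ := Measure.pi fun i => (m i).prod (m i) with hρ
  have hmem : ∀ s : Finset (Fin (N + 1)), MemLp (fun w => f (mixState s w)) 2 ρ := fun s =>
    hL.comp_measurePreserving (measurePreserving_mixState m s)
  have hmeas : ∀ s : Finset (Fin (N + 1)), Measurable fun w => f (mixState (X := X) s w) :=
    fun s => hf.comp (measurePreserving_mixState m s).measurable
  -- For two independent states, `I s t` correlates `f` at two mixtures of them. The variance is `I
  -- ∅ ∅ - I ∅ univ`, since disjoint choices of coordinates give independent states.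
  set I : Finset (Fin (N + 1)) → Finset (Fin (N + 1)) → ℝ := fun s t =>
    ∫ w, f (mixState s w) * f (mixState t w) ∂ρ with hI
  have hIcomm : ∀ s t, I s t = I t s := fun s t => by simp only [hI, mul_comm]
  have hsq : ∀ s t, ∫ w, (f (mixState s w) - f (mixState t w)) ^ 2 ∂ρ
      = I s s - I s t - (I t s - I t t) := fun s t => by
    rw [← integral_sub_mul_sub (hmem s) (hmem t) (hmem s) (hmem t)]
    simp only [pow_two]
  -- Exchanging the two copies on `u` preserves the measure, so `I s t` depends only on the
  -- symmetric difference of `s` and `t`.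
  have hex : ∀ s t u, I (symmDiff s u) (symmDiff t u) = I s t := fun s t u => by
    simp only [hI]
    rw [← integral_comp_of_measurePreserving (measurePreserving_exchangeState m u)
      ((hmeas s).fun_mul (hmeas t))]
    simp only [mixState_exchangeState, hρ]
  have hemp : ∀ s : Finset (Fin (N + 1)), symmDiff ∅ s = s := fun s => bot_symmDiff s
  let L : ℕ → Finset (Fin (N + 1)) := fun k => Finset.univ.filter fun i => (i : ℕ) < k
  have hdiag : ∀ s, I s s = I ∅ ∅ := fun s => by
    have := hex ∅ ∅ s
    rwa [hemp] at this
  have hvar : variance f (Measure.pi m) = I ∅ (L 0) - I ∅ (L (N + 1)) := by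
    have hL0 : L 0 = ∅ := by simp [L]
    have hLn : L (N + 1) = Finset.univ := by ext i; simp only [L, Finset.mem_filter]; simp; omega
    rw [variance_eq_sub hL, hL0, hLn]
    congr 1
    · have h := integral_comp_of_measurePreserving (measurePreserving_mixState m ∅)
        (hf.pow_const 2)
      simp only [pow_two] at h
      simp only [Pi.pow_apply, pow_two]
      exact h.symm
    · have h := integral_prod_mul (μ := Measure.pi m) (ν := Measure.pi m) f f
      rw [pow_two, ← h]
      have hmp := measurePreserving_arrowProdEquivProdArrow X X (Fin (N + 1)) m m
      rw [← integral_comp_of_measurePreserving hmp (g := fun z => f z.1 * f z.2)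
        ((hf.comp measurable_fst).fun_mul (hf.comp measurable_snd))]
      refine integral_congr_ae (.of_forall fun w => ?_)
      change f _ * f _ = f _ * f _
      congr 2
      funext i
      simp [mixState, MeasurableEquiv.arrowProdEquivProdArrow, Equiv.arrowProdEquivProdArrow]
  -- The telescoping increment is half the expected product of two increments of `f` in coordinate
  -- `k`, one based at `∅` and one at `L k`. These have the same second moment, so `ab ≤ (a² +
  -- b²)/2` gives the bound.
  have hstep : ∀ k : Fin (N + 1), I ∅ (L k) - I ∅ (L (k + 1))
      ≤ (∫ w, (f (mixState ∅ w) - f (mixState {k} w)) ^ 2 ∂ρ) / 2 := fun k => by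
    have hLk : symmDiff (L k) {k} = L (k + 1) := by
      ext i
      simp only [L, Finset.mem_symmDiff, Finset.mem_filter, Finset.mem_univ, true_and,
        Finset.mem_singleton, Fin.ext_iff]
      omega
    have hLk' : symmDiff (L (k + 1)) {k} = L k := by
      rw [← hLk, symmDiff_symmDiff_cancel_right]
    have hLk'' : symmDiff {k} (L k) = L (k + 1) := by rw [symmDiff_comm, hLk]
    have e1 : I {k} (L (k + 1)) = I ∅ (L k) := by
      rw [← hex ∅ (L k) {k}, hLk, hemp]
    have e2 : I {k} (L k) = I ∅ (L (k + 1)) := by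
      rw [← hex ∅ (L (k + 1)) {k}, hLk', hemp]
    have e3 : I (L k) (L (k + 1)) = I ∅ {k} := by
      rw [← hex ∅ {k} (L k), hLk'', hemp]
    have h1 := hsq ∅ {k}
    have h2 := hsq (L k) (L (k + 1))
    have h3 := integral_sub_mul_sub (hmem ∅) (hmem {k}) (hmem (L k)) (hmem (L (k + 1)))
    have hle : ∫ w, (f (mixState ∅ w) - f (mixState {k} w))
          * (f (mixState (L k) w) - f (mixState (L (k + 1)) w)) ∂ρ
        ≤ ∫ w, ((f (mixState ∅ w) - f (mixState {k} w)) ^ 2 / 2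
          + (f (mixState (L k) w) - f (mixState (L (k + 1)) w)) ^ 2 / 2) ∂ρ := by
      refine integral_mono (((hmem _).sub (hmem _)).integrable_mul ((hmem _).sub (hmem _)))
        ((((hmem _).sub (hmem _)).integrable_sq.div_const 2).add
          (((hmem _).sub (hmem _)).integrable_sq.div_const 2)) fun w => ?_
      change (f (mixState ∅ w) - f (mixState {k} w))
          * (f (mixState (L k) w) - f (mixState (L (k + 1)) w)) ≤ _
      nlinarith [sq_nonneg ((f (mixState ∅ w) - f (mixState {k} w))
        - (f (mixState (L k) w) - f (mixState (L (k + 1)) w)))]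
    have hadd : ∫ w, ((f (mixState ∅ w) - f (mixState {k} w)) ^ 2 / 2
          + (f (mixState (L k) w) - f (mixState (L (k + 1)) w)) ^ 2 / 2) ∂ρ
        = (∫ w, (f (mixState ∅ w) - f (mixState {k} w)) ^ 2 ∂ρ) / 2
          + (∫ w, (f (mixState (L k) w) - f (mixState (L (k + 1)) w)) ^ 2 ∂ρ) / 2 := by
      rw [← integral_div, ← integral_div]
      exact integral_add (((hmem _).sub (hmem _)).integrable_sq.div_const 2)
          (((hmem _).sub (hmem _)).integrable_sq.div_const 2)
    have h4 : ∫ w, (f (mixState ∅ w) - f (mixState {k} w))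
          * (f (mixState (L k) w) - f (mixState (L (k + 1)) w)) ∂ρ
        = I ∅ (L k) - I ∅ (L (k + 1)) - (I {k} (L k) - I {k} (L (k + 1))) := h3
    rw [hadd, h4, h1, h2, e1, e2, hIcomm (L (k + 1)), e3, hIcomm {k} ∅, hdiag {k}, hdiag (L k),
      hdiag (L (k + 1))] at hle
    rw [h1, hIcomm {k} ∅, hdiag {k}]
    linarith
  rw [hvar, ← Finset.sum_range_sub' (fun k => I ∅ (L k)) (N + 1), Finset.sum_range]
  exact Finset.sum_le_sum fun k _ => hstep k

/-- The two mixtures at `∅` and `{k}` are jointly distributed as a state and its update by a fresh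
draw at level `k`. -/
theorem sqForm_coordKernel_const (k : Fin (N + 1)) {f : (Fin (N + 1) → X) → ℝ}
    (hf : Measurable f) (hL : MemLp f 2 (Measure.pi m)) :
    sqForm (coordKernel (fun k => Kernel.const X (m k)) k) (Measure.pi m) f
      = ENNReal.ofReal (∫ w, (f (mixState ∅ w) - f (mixState {k} w)) ^ 2
        ∂(Measure.pi fun i => (m i).prod (m i))) := by
  have hmem : ∀ s : Finset (Fin (N + 1)), MemLp (fun w => f (mixState s w)) 2
      (Measure.pi fun i => (m i).prod (m i)) := fun s =>
    hL.comp_measurePreserving (measurePreserving_mixState m s)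
  have hd : MemLp (fun w => f (mixState ∅ w) - f (mixState {k} w)) 2
      (Measure.pi fun i => (m i).prod (m i)) := (hmem _).sub (hmem _)
  rw [← lintegral_ofReal_sq_eq hd, sqForm_coordKernel _ k _ hf]
  have hg : Measurable fun q : (Fin (N + 1) → X) × X =>
      ENNReal.ofReal ((f q.1 - f (Function.update q.1 k q.2)) ^ 2) :=
    (((hf.comp measurable_fst).sub (hf.comp (measurable_update_pair k))).pow_const 2).ennreal_ofReal
  have hmp : MeasurePreserving (fun w : Fin (N + 1) → X × X => ((fun i => (w i).1), (w k).2))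
      (Measure.pi fun i => (m i).prod (m i)) ((Measure.pi m).prod (m k)) :=
    ((MeasurePreserving.id _).prod (measurePreserving_eval m k)).comp
      (measurePreserving_arrowProdEquivProdArrow X X (Fin (N + 1)) m m)
  simp only [Kernel.const_apply]
  rw [← lintegral_prod _ hg.aemeasurable, ← hmp.lintegral_comp hg]
  refine lintegral_congr fun w => ?_
  have e1 : mixState ∅ w = fun i => (w i).1 := by funext i; simp [mixState]
  have e2 : mixState {k} w = Function.update (fun i => (w i).1) k (w k).2 := by
    funext i
    by_cases h : i = k
    · subst h; simp [mixState]
    · simp [mixState, h]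
  rw [e1, e2]

theorem sqForm_const_pi_le {f : (Fin (N + 1) → X) → ℝ} (hf : Measurable f)
    (hL : MemLp f 2 (Measure.pi m)) :
    sqForm (Kernel.const _ (Measure.pi m)) (Measure.pi m) f
      ≤ ∑ k, sqForm (coordKernel (fun k => Kernel.const X (m k)) k) (Measure.pi m) f := by
  rw [sqForm_const _ hf hL]
  simp only [sqForm_coordKernel_const m _ hf hL]
  rw [← ENNReal.ofReal_sum_of_nonneg fun k _ => integral_nonneg fun w => sq_nonneg _]
  refine ENNReal.ofReal_le_ofReal ?_
  have h := variance_pi_le m hf hL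
  rw [← Finset.sum_div] at h
  exact (le_div_iff₀' (zero_lt_two' ℝ)).1 h

end Product

/-! ### Product measures on boxes of cells -/

section ProductCells

variable {X : Type*} [MeasurableSpace X]

theorem lintegral_pi_prod {n : ℕ} (m : Fin n → Measure X) [∀ i, SigmaFinite (m i)]
    {g : Fin n → X → ℝ≥0∞} (hg : ∀ i, Measurable (g i)) :
    ∫⁻ x, ∏ i, g i (x i) ∂(Measure.pi m) = ∏ i, ∫⁻ z, g i z ∂(m i) := by
  induction n with
  | zero => simp
  | succ n ih =>
    have hmp := measurePreserving_piFinSuccAbove m 0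
    have hm : Measurable fun q : X × (Fin n → X) => g 0 q.1 * ∏ i, g (Fin.succ i) (q.2 i) :=
      ((hg 0).comp measurable_fst).mul (Finset.measurable_prod _ fun i _ =>
        (hg i.succ).comp ((measurable_pi_apply i).comp measurable_snd))
    have h := hmp.lintegral_comp hm
    simp only [Fin.prod_univ_succ]
    rw [← ih (fun i => m i.succ) fun i => hg i.succ]
    rw [← lintegral_prod_mul (hg 0).aemeasurable (Finset.measurable_prod _ fun i _ =>
        (hg i.succ).comp (measurable_pi_apply i)).aemeasurable]
    exact h

variable {N : ℕ}

theorem cond_pi (m : Fin (N + 1) → Measure X) [∀ i, IsProbabilityMeasure (m i)]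
    {A : Fin (N + 1) → Set X} (hA : ∀ i, MeasurableSet (A i)) (h0 : ∀ i, m i (A i) ≠ 0) :
    cond (Measure.pi m) (Set.univ.pi A) = Measure.pi fun i => cond (m i) (A i) := by
  have := fun i => cond_isProbabilityMeasure (h0 i)
  refine (Measure.pi_eq fun s hs => ?_).symm
  rw [cond_apply (.univ_pi hA), ← Set.pi_inter_distrib, Measure.pi_pi, Measure.pi_pi,
    ENNReal.prod_inv_distrib, ← Finset.prod_mul_distrib]
  · exact Finset.prod_congr rfl fun i _ => (cond_apply (hA i) _ _).symm
  · intro i _ j _ _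
    exact Or.inl (h0 i)

/-- The vector of cells of the entries of a state. -/
def cellVector {I : Type*} (c : X → I) (x : Fin (N + 1) → X) : Fin (N + 1) → I :=
  fun i => c (x i)

theorem measurable_cellVector {I : Type*} [MeasurableSpace I] {c : X → I} (hc : Measurable c) :
    Measurable (cellVector (N := N) c) :=
  measurable_pi_lambda _ fun i => hc.comp (measurable_pi_apply i)

theorem cellVector_preimage {X : Type*} {I : Type*} (c : X → I) (σ : Fin (N + 1) → I) :
    cellVector c ⁻¹' {σ} = Set.univ.pi fun i => c ⁻¹' {σ i} := by
  ext x
  simp [cellVector, funext_iff]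

theorem map_cellVector {I : Type*} [MeasurableSpace I] (m : Fin (N + 1) → Measure X)
    [∀ i, IsProbabilityMeasure (m i)] {c : X → I} (hc : Measurable c) :
    (Measure.pi m).map (cellVector c) = Measure.pi fun i => (m i).map c :=
  have : ∀ i, IsProbabilityMeasure ((m i).map c) := fun _ =>
    Measure.isProbabilityMeasure_map hc.aemeasurable
  (measurePreserving_pi m _ fun _ => ⟨hc, rfl⟩).map_eq

theorem cellVector_swapState {X : Type*} {I : Type*} (c : X → I) (k : Fin N)
    (x : Fin (N + 1) → X) : cellVector c (swapState k x) = swapState k (cellVector c x) := rfl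

end ProductCells

/-! ### Detailed balance for swaps -/

section Swap

variable {X : Type*} [MeasurableSpace X] {N : ℕ}

theorem pi_withDensity (τ : Measure X) [SigmaFinite τ] {q : Fin (N + 1) → X → ℝ≥0∞}
    (hq : ∀ i, Measurable (q i)) [∀ i, SigmaFinite (τ.withDensity (q i))] :
    Measure.pi (fun i => τ.withDensity (q i))
      = (Measure.pi fun _ : Fin (N + 1) => τ).withDensity fun x => ∏ i, q i (x i) := by
  refine Measure.pi_eq fun s hs => ?_
  rw [withDensity_apply _ (.univ_pi hs), ← lintegral_indicator (.univ_pi hs)]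
  have e : ∀ x : Fin (N + 1) → X, (Set.univ.pi s).indicator (fun x => ∏ i, q i (x i)) x
      = ∏ i, (s i).indicator (q i) (x i) := fun x => by
    by_cases hx : x ∈ Set.univ.pi s
    · rw [Set.indicator_of_mem hx]
      exact Finset.prod_congr rfl fun i _ => (Set.indicator_of_mem (hx i trivial) _).symm
    · rw [Set.indicator_of_notMem hx]
      simp only [Set.mem_pi, Set.mem_univ, true_implies, not_forall] at hx
      obtain ⟨i, hi⟩ := hx
      exact (Finset.prod_eq_zero (Finset.mem_univ i) (Set.indicator_of_notMem hi _)).symm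
  simp only [e]
  rw [lintegral_pi_prod _ fun i => (hq i).indicator (hs i)]
  exact Finset.prod_congr rfl fun i _ => by
    rw [lintegral_indicator (hs i), withDensity_apply _ (hs i)]

theorem swapState_swapState {X : Type*} (k : Fin N) (x : Fin (N + 1) → X) :
    swapState k (swapState k x) = x := by
  funext i; simp [swapState]

theorem measurePreserving_swapState (τ : Measure X) [SigmaFinite τ] (k : Fin N) :
    MeasurePreserving (swapState (X := X) k) (Measure.pi fun _ => τ) (Measure.pi fun _ => τ) := by
  refine ⟨measurable_swapState k, (Measure.pi_eq fun s hs => ?_).symm⟩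
  rw [Measure.map_apply (measurable_swapState k) (.univ_pi hs)]
  have e : swapState k ⁻¹' Set.univ.pi s
      = Set.univ.pi fun i => s (Equiv.swap k.castSucc k.succ i) := by
    ext x
    simp only [Set.mem_preimage, Set.mem_pi, Set.mem_univ, true_implies, swapState]
    constructor
    · intro h i; simpa using h (Equiv.swap k.castSucc k.succ i)
    · intro h i; simpa using h (Equiv.swap k.castSucc k.succ i)
  rw [e, Measure.pi_pi]
  exact Equiv.prod_comp (Equiv.swap k.castSucc k.succ) fun i => τ (s i)

theorem swapAccept_mul {X : Type*} (p : Fin (N + 1) → X → ℝ≥0) (k : Fin N) (x : Fin (N + 1) → X) :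
    swapAccept p k x * (p k.castSucc (x k.castSucc) * p k.succ (x k.succ))
      = min (p k.castSucc (x k.castSucc) * p k.succ (x k.succ))
        (p k.castSucc (x k.succ) * p k.succ (x k.castSucc)) := by
  unfold swapAccept
  by_cases h : p k.castSucc (x k.castSucc) * p k.succ (x k.succ) = 0
  · simp [h]
  · rw [min_mul_of_nonneg _ _ zero_le, one_mul, div_mul_cancel₀ _ h]

/-- Detailed balance for the densities `p i / s`. The acceptance probability times the two affected
factors of the joint density is a minimum of two products, which the swap merely interchanges; the
factors of `s` at these levels are interchanged too. -/
theorem swapAccept_mul_prod_swapState {X : Type*} (p : Fin (N + 1) → X → ℝ≥0) (s : X → ℝ≥0)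
    (k : Fin N)
    (x : Fin (N + 1) → X) :
    swapAccept p k (swapState k x) * ∏ i, p i (swapState k x i) / s (swapState k x i)
      = swapAccept p k x * ∏ i, p i (x i) / s (x i) := by
  have hne : k.succ ≠ k.castSucc := (Fin.castSucc_lt_succ).ne'
  have hmem : k.succ ∈ Finset.univ.erase k.castSucc :=
    Finset.mem_erase.2 ⟨hne, Finset.mem_univ _⟩
  have key : ∀ y : Fin (N + 1) → X, swapAccept p k y * ∏ i, p i (y i) / s (y i)
      = min (p k.castSucc (y k.castSucc) * p k.succ (y k.succ))
        (p k.castSucc (y k.succ) * p k.succ (y k.castSucc))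
        / (s (y k.castSucc) * s (y k.succ))
        * ∏ i ∈ (Finset.univ.erase k.castSucc).erase k.succ, p i (y i) / s (y i) := fun y => by
    rw [← swapAccept_mul, ← Finset.mul_prod_erase _ _ (Finset.mem_univ k.castSucc),
      ← Finset.mul_prod_erase _ _ hmem]
    simp only [div_eq_mul_inv, mul_inv]
    ring
  have e1 : swapState k x k.castSucc = x k.succ := by simp [swapState]
  have e2 : swapState k x k.succ = x k.castSucc := by simp [swapState]
  rw [key, key, e1, e2, min_comm, mul_comm (s (x k.succ))]
  congr 1
  refine Finset.prod_congr rfl fun i hi => ?_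
  simp only [Finset.mem_erase] at hi
  rw [show swapState k x i = x i by simp [swapState, Equiv.swap_apply_of_ne_of_ne hi.2.1 hi.1]]

variable {ν : Measure X} {p : Fin (N + 1) → X → ℝ≥0}

theorem isProbabilityMeasure_densityMeasure {q : X → ℝ≥0} (hq : IsProbDensity ν q) :
    IsProbabilityMeasure (densityMeasure ν q) :=
  ⟨by rw [densityMeasure, withDensity_apply _ .univ, Measure.restrict_univ]; exact hq.2⟩

/-- Since `ν` need not be σ-finite, its product cannot serve as reference measure. The finite
measure `τ` with density `s = ∑ p i` takes its place: each `p i` vanishes where `s` does, so it has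
density `p i / s` with respect to `τ`, and the product of copies of `τ` is invariant under the swap.
-/
theorem lintegral_swapAccept_mul_swapState (hp : ∀ k, IsProbDensity ν (p k)) (k : Fin N)
    {g : (Fin (N + 1) → X) → ℝ≥0∞} (hg : Measurable g) :
    ∫⁻ x, swapAccept p k x * g (swapState k x) ∂(swapMeasure ν p)
      = ∫⁻ x, swapAccept p k x * g x ∂(swapMeasure ν p) := by
  have hprob := fun i => isProbabilityMeasure_densityMeasure (hp i)
  let s : X → ℝ≥0 := fun z => ∑ i, p i z
  have hs : Measurable s := Finset.measurable_sum _ fun i _ => (hp i).1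
  let τ : Measure X := ν.withDensity fun z => (s z : ℝ≥0∞)
  have hτ : IsFiniteMeasure τ := by
    refine isFiniteMeasure_withDensity ?_
    simp only [s, ENNReal.ofNNReal_finsetSum]
    rw [lintegral_finsetSum _ fun i _ => (hp i).1.coe_nnreal_ennreal]
    simp [fun i => (hp i).2]
  have hq : ∀ i, Measurable fun z => ((p i z / s z : ℝ≥0) : ℝ≥0∞) := fun i =>
    ((hp i).1.div hs).coe_nnreal_ennreal
  have hdens : ∀ i, densityMeasure ν (p i) = τ.withDensity fun z => ((p i z / s z : ℝ≥0) : ℝ≥0∞) :=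
    fun i => by
      rw [← withDensity_mul _ hs.coe_nnreal_ennreal (hq i), densityMeasure]
      congr 1
      funext z
      have : s z = 0 → p i z = 0 := fun h =>
        (Finset.sum_eq_zero_iff.1 h) i (Finset.mem_univ i)
      simp only [Pi.mul_apply]
      rw [← ENNReal.coe_mul, mul_div_cancel_of_imp' this]
  have hfin : ∀ i, SigmaFinite (τ.withDensity fun z => ((p i z / s z : ℝ≥0) : ℝ≥0∞)) := fun i => by
    rw [← hdens i]; infer_instance
  have hmeas : Measurable fun x : Fin (N + 1) → X => ∏ i, ((p i (x i) / s (x i) : ℝ≥0) : ℝ≥0∞) :=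
    Finset.measurable_prod _ fun i _ => (hq i).comp (measurable_pi_apply i)
  have hsw : swapMeasure ν p = (Measure.pi fun _ : Fin (N + 1) => τ).withDensity
      fun x => ∏ i, ((p i (x i) / s (x i) : ℝ≥0) : ℝ≥0∞) := by
    rw [swapMeasure, ← pi_withDensity τ hq]
    congr 1
    exact funext hdens
  have ha : Measurable fun x => (swapAccept p k x : ℝ≥0∞) :=
    (measurable_swapAccept (fun i => (hp i).1) k).coe_nnreal_ennreal
  have hm : Measurable fun x => (swapAccept p k x : ℝ≥0∞) * g (swapState k x) :=
    ha.mul (hg.comp (measurable_swapState k))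
  rw [hsw, lintegral_withDensity_eq_lintegral_mul _ hmeas hm,
    lintegral_withDensity_eq_lintegral_mul _ hmeas (ha.fun_mul hg),
    ← (measurePreserving_swapState τ k).lintegral_comp (hmeas.mul (ha.fun_mul hg))]
  refine lintegral_congr fun x => ?_
  have h := congrArg (fun r : ℝ≥0 => (r : ℝ≥0∞)) (swapAccept_mul_prod_swapState p s k x)
  simp only [ENNReal.coe_mul, ENNReal.ofNNReal_finsetProd] at h
  simp only [Pi.mul_apply]
  rw [← mul_assoc, ← mul_assoc, mul_comm _ (swapAccept p k (swapState k x) : ℝ≥0∞), h,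
    mul_comm (swapAccept p k x : ℝ≥0∞)]

end Swap

/-! ### The swap move: laziness, invariance and mean acceptance -/

section SwapKernel

variable {X : Type*} [MeasurableSpace X] {N : ℕ} {ν : Measure X} {p : Fin (N + 1) → X → ℝ≥0}

theorem sum_swapAccept_le {X : Type*} (p : Fin (N + 1) → X → ℝ≥0) (x : Fin (N + 1) → X) :
    ∑ k : Fin N, swapAccept p k x / (2 * N) ≤ 1 / 2 := by
  rcases Nat.eq_zero_or_pos N with rfl | hN
  · simp
  have hN' : (N : ℝ≥0) ≠ 0 := by exact_mod_cast hN.ne'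
  calc ∑ k : Fin N, swapAccept p k x / (2 * N) ≤ ∑ _k : Fin N, 1 / (2 * (N : ℝ≥0)) := by
        gcongr; exact min_le_left _ _
    _ = 1 / 2 := by
        rw [Finset.sum_const, Finset.card_univ, Fintype.card_fin, nsmul_eq_mul]
        field_simp

theorem lintegral_swapKernel (hp : ∀ k, Measurable (p k)) (x : Fin (N + 1) → X)
    {g : (Fin (N + 1) → X) → ℝ≥0∞} (hg : Measurable g) :
    ∫⁻ y, g y ∂(swapKernel p hp x)
      = ∑ k : Fin N, ((swapAccept p k x / (2 * N) : ℝ≥0) : ℝ≥0∞) * g (swapState k x)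
        + ((1 - ∑ k : Fin N, swapAccept p k x / (2 * N) : ℝ≥0) : ℝ≥0∞) * g x := by
  have h : swapKernel p hp x =
    (∑ k : Fin N, ((swapAccept p k x / (2 * N) : ℝ≥0) : ℝ≥0∞) • Measure.dirac (swapState k x))
      + ((1 - ∑ k : Fin N, swapAccept p k x / (2 * N) : ℝ≥0) : ℝ≥0∞) • Measure.dirac x := rfl
  rw [h, lintegral_add_measure, lintegral_finsetSum_measure, lintegral_smul_measure,
    lintegral_dirac' _ hg]
  simp only [lintegral_smul_measure, lintegral_dirac' _ hg, smul_eq_mul]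

theorem isMarkovKernel_swapKernel (hp : ∀ k, Measurable (p k)) :
    IsMarkovKernel (swapKernel p hp) := by
  refine ⟨fun x => ⟨?_⟩⟩
  rw [← lintegral_one, lintegral_swapKernel hp x measurable_const]
  simp only [mul_one]
  rw [← ENNReal.ofNNReal_finsetSum, ← ENNReal.coe_add, add_tsub_cancel_of_le, ENNReal.coe_one]
  exact (sum_swapAccept_le p x).trans (by norm_num)

theorem half_le_lintegral_swapKernel (hp : ∀ k, Measurable (p k)) (x : Fin (N + 1) → X)
    {g : (Fin (N + 1) → X) → ℝ≥0∞} (hg : Measurable g) :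
    2⁻¹ * g x ≤ ∫⁻ y, g y ∂(swapKernel p hp x) := by
  rw [lintegral_swapKernel hp x hg]
  refine le_add_of_nonneg_of_le zero_le ?_
  gcongr
  have h : (2⁻¹ : ℝ≥0) ≤ 1 - ∑ k : Fin N, swapAccept p k x / (2 * N) := by
    refine le_tsub_of_add_le_left ?_
    calc _ ≤ (1 / 2 : ℝ≥0) + 2⁻¹ := by gcongr; exact sum_swapAccept_le p x
      _ = 1 := by rw [one_div, ← two_mul, mul_inv_cancel₀ two_ne_zero]
  calc (2⁻¹ : ℝ≥0∞) = ((2⁻¹ : ℝ≥0) : ℝ≥0∞) := by rw [ENNReal.coe_inv two_ne_zero]; rfl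
    _ ≤ _ := by exact_mod_cast h

theorem sqForm_swapKernel (hp : ∀ k, Measurable (p k)) (μ : Measure (Fin (N + 1) → X))
    {f : (Fin (N + 1) → X) → ℝ} (hf : Measurable f) :
    sqForm (swapKernel p hp) μ f = ∑ k : Fin N, ∫⁻ x, ((swapAccept p k x / (2 * N) : ℝ≥0) : ℝ≥0∞)
      * ENNReal.ofReal ((f x - f (swapState k x)) ^ 2) ∂μ := by
  rw [← lintegral_finsetSum]
  · refine lintegral_congr fun x => ?_
    rw [lintegral_swapKernel hp x ((measurable_const.fun_sub hf).pow_const 2).ennreal_ofReal]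
    simp
  · intro k _
    exact ((measurable_swapAccept hp k).div_const _).coe_nnreal_ennreal.mul
      ((hf.sub (hf.comp (measurable_swapState k))).pow_const 2).ennreal_ofReal

theorem lintegral_swapAccept_div_mul_swapState (hp : ∀ k, IsProbDensity ν (p k)) (k : Fin N)
    {g : (Fin (N + 1) → X) → ℝ≥0∞} (hg : Measurable g) :
    ∫⁻ x, ((swapAccept p k x / (2 * N) : ℝ≥0) : ℝ≥0∞) * g (swapState k x) ∂(swapMeasure ν p)
      = ∫⁻ x, ((swapAccept p k x / (2 * N) : ℝ≥0) : ℝ≥0∞) * g x ∂(swapMeasure ν p) := by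
  have e : ∀ x y, ((swapAccept p k x / (2 * N) : ℝ≥0) : ℝ≥0∞) * g y
      = ((2 * N : ℝ≥0)⁻¹ : ℝ≥0) * (swapAccept p k x * g y) := fun x y => by
    rw [div_eq_mul_inv, ENNReal.coe_mul, mul_comm (swapAccept p k x : ℝ≥0∞), mul_assoc]
  simp only [e]
  rw [lintegral_const_mul' _ _ ENNReal.coe_ne_top, lintegral_const_mul' _ _ ENNReal.coe_ne_top,
    lintegral_swapAccept_mul_swapState hp k hg]

theorem invariant_swapKernel (hp : ∀ k, IsProbDensity ν (p k)) :
    (swapKernel p fun k => (hp k).1).Invariant (swapMeasure ν p) := by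
  have ha : ∀ k : Fin N, Measurable fun x => ((swapAccept p k x / (2 * N) : ℝ≥0) : ℝ≥0∞) :=
    fun k => ((measurable_swapAccept (fun k => (hp k).1) k).div_const _).coe_nnreal_ennreal
  ext s hs
  have hg : Measurable (s.indicator (1 : (Fin (N + 1) → X) → ℝ≥0∞)) := measurable_one.indicator hs
  have e : ∀ x, swapKernel p (fun k => (hp k).1) x s
      = ∫⁻ y, s.indicator 1 y ∂(swapKernel p (fun k => (hp k).1) x) := fun x =>
    (lintegral_indicator_one hs).symm
  rw [Measure.bind_apply hs (Kernel.aemeasurable _), ← lintegral_indicator_one hs]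
  simp only [e, lintegral_swapKernel _ _ hg]
  have hm : ∀ k : Fin N, Measurable fun x => ((swapAccept p k x / (2 * N) : ℝ≥0) : ℝ≥0∞)
      * s.indicator (1 : (Fin (N + 1) → X) → ℝ≥0∞) (swapState k x) := fun k =>
    (ha k).mul (hg.comp (measurable_swapState k))
  rw [lintegral_add_left (Finset.measurable_fun_sum _ fun k _ => hm k),
    lintegral_finsetSum _ fun k _ => hm k]
  simp only [lintegral_swapAccept_div_mul_swapState hp _ hg]
  rw [← lintegral_finsetSum _ fun k _ => (ha k).fun_mul hg,
    ← lintegral_add_left (Finset.measurable_fun_sum _ fun k _ => (ha k).fun_mul hg)]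
  refine lintegral_congr fun x => ?_
  rw [← Finset.sum_mul, ← add_mul, ← ENNReal.ofNNReal_finsetSum, ← ENNReal.coe_add,
    add_tsub_cancel_of_le, ENNReal.coe_one, one_mul]
  exact (sum_swapAccept_le p x).trans (by norm_num)

/-- The general constant 4 improves to 2 because a swap is made with total probability at most 1/2.
-/
theorem sqForm_swapKernel_le (hp : ∀ k, IsProbDensity ν (p k)) {f : (Fin (N + 1) → X) → ℝ}
    (hf : Measurable f) :
    sqForm (swapKernel p fun k => (hp k).1) (swapMeasure ν p) f
      ≤ 2 * ∫⁻ x, ENNReal.ofReal (f x ^ 2) ∂(swapMeasure ν p) := by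
  have ha : ∀ k : Fin N, Measurable fun x => ((swapAccept p k x / (2 * N) : ℝ≥0) : ℝ≥0∞) :=
    fun k => ((measurable_swapAccept (fun k => (hp k).1) k).div_const _).coe_nnreal_ennreal
  have hg : Measurable fun x => ENNReal.ofReal (f x ^ 2) := (hf.pow_const 2).ennreal_ofReal
  have hag : ∀ k : Fin N, Measurable fun x => ((swapAccept p k x / (2 * N) : ℝ≥0) : ℝ≥0∞)
      * ENNReal.ofReal (f x ^ 2) := fun k => (ha k).mul hg
  rw [sqForm_swapKernel _ _ hf]
  calc _ ≤ ∑ k : Fin N, ∫⁻ x, (2 * (((swapAccept p k x / (2 * N) : ℝ≥0) : ℝ≥0∞)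
          * ENNReal.ofReal (f x ^ 2)) + 2 * (((swapAccept p k x / (2 * N) : ℝ≥0) : ℝ≥0∞)
          * ENNReal.ofReal (f (swapState k x) ^ 2))) ∂(swapMeasure ν p) := by
        refine Finset.sum_le_sum fun k _ => lintegral_mono fun x => ?_
        have h := ofReal_sq_add_le (f x) (-f (swapState k x))
        rw [neg_sq, ← sub_eq_add_neg] at h
        calc _ ≤ ((swapAccept p k x / (2 * N) : ℝ≥0) : ℝ≥0∞) * (2 * ENNReal.ofReal (f x ^ 2)
              + 2 * ENNReal.ofReal (f (swapState k x) ^ 2)) := by gcongr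
          _ = _ := by ring
    _ = ∑ k : Fin N, 4 * ∫⁻ x, ((swapAccept p k x / (2 * N) : ℝ≥0) : ℝ≥0∞)
          * ENNReal.ofReal (f x ^ 2) ∂(swapMeasure ν p) := by
        refine Finset.sum_congr rfl fun k _ => ?_
        rw [lintegral_add_left ((hag k).const_mul 2), lintegral_const_mul _ (hag k),
          lintegral_const_mul' _ _ (by simp), lintegral_swapAccept_div_mul_swapState hp k hg]
        ring
    _ = 4 * ∫⁻ x, ((∑ k : Fin N, swapAccept p k x / (2 * N) : ℝ≥0) : ℝ≥0∞)
          * ENNReal.ofReal (f x ^ 2) ∂(swapMeasure ν p) := by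
        rw [← Finset.mul_sum, ← lintegral_finsetSum _ fun k _ => hag k]
        simp only [← Finset.sum_mul, ENNReal.ofNNReal_finsetSum]
    _ ≤ 4 * ∫⁻ x, (2⁻¹ : ℝ≥0∞) * ENNReal.ofReal (f x ^ 2) ∂(swapMeasure ν p) := by
        gcongr with x
        have h := sum_swapAccept_le p x
        rw [one_div] at h
        calc ((∑ k : Fin N, swapAccept p k x / (2 * N) : ℝ≥0) : ℝ≥0∞)
            ≤ ((2⁻¹ : ℝ≥0) : ℝ≥0∞) := by exact_mod_cast h
          _ = 2⁻¹ := by rw [ENNReal.coe_inv two_ne_zero]; rfl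
    _ = _ := by
        rw [lintegral_const_mul _ hg, ← mul_assoc]
        congr 1
        rw [show (4 : ℝ≥0∞) = 2 * 2 by norm_num, mul_assoc,
          ENNReal.mul_inv_cancel two_ne_zero ENNReal.ofNat_ne_top, mul_one]

/-- The acceptance ratio is a product of a function of each of the two entries. Bounding it below by
a product of two minima makes it factorize over the coordinates. -/
theorem min_mul_min_le {X : Type*} (p : Fin (N + 1) → X → ℝ≥0) (k : Fin N) (x : Fin (N + 1) → X) :
    min 1 (p k.succ (x k.castSucc) / p k.castSucc (x k.castSucc))
      * min 1 (p k.castSucc (x k.succ) / p k.succ (x k.succ)) ≤ swapAccept p k x := by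
  refine le_min (mul_le_one' (min_le_left _ _) (min_le_left _ _)) ?_
  calc _ ≤ p k.succ (x k.castSucc) / p k.castSucc (x k.castSucc)
        * (p k.castSucc (x k.succ) / p k.succ (x k.succ)) :=
        mul_le_mul' (min_le_right _ _) (min_le_right _ _)
    _ = _ := by rw [div_mul_div_comm, mul_comm (p k.succ _)]

/-- Multiplying `min 1 (r / q)` by the density `q` gives `min q r`, so the conditional mean is
exactly the overlap of the two densities on the cell, divided by the mass of the cell. -/
theorem le_lintegral_min_cond {q r : X → ℝ≥0} (hq : IsProbDensity ν q) (hr : Measurable r)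
    {A : Set X} (hA : MeasurableSet A) (h0 : densityMeasure ν q A ≠ 0) {d : ℝ≥0∞}
    (hd : d * densityMeasure ν q A ≤ ∫⁻ z in A, ((min (q z) (r z) : ℝ≥0) : ℝ≥0∞) ∂ν) :
    d ≤ ∫⁻ z, ((min 1 (r z / q z) : ℝ≥0) : ℝ≥0∞) ∂(cond (densityMeasure ν q) A) := by
  have := isProbabilityMeasure_densityMeasure hq
  have hm : Measurable fun z => ((min 1 (r z / q z) : ℝ≥0) : ℝ≥0∞) :=
    (measurable_const.min (hr.div hq.1)).coe_nnreal_ennreal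
  have e : ∫⁻ z in A, ((min 1 (r z / q z) : ℝ≥0) : ℝ≥0∞) ∂(densityMeasure ν q)
      = ∫⁻ z in A, ((min (q z) (r z) : ℝ≥0) : ℝ≥0∞) ∂ν := by
    rw [densityMeasure, restrict_withDensity hA,
      lintegral_withDensity_eq_lintegral_mul _ hq.1.coe_nnreal_ennreal hm]
    refine lintegral_congr fun z => ?_
    simp only [Pi.mul_apply]
    rw [← ENNReal.coe_mul]
    congr 1
    by_cases hz : q z = 0
    · simp [hz]
    · rw [mul_min_of_nonneg _ _ zero_le, mul_one, mul_div_cancel₀ _ hz]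
  rw [ProbabilityTheory.cond, lintegral_smul_measure, smul_eq_mul, e, mul_comm, ← div_eq_mul_inv,
    ENNReal.le_div_iff_mul_le (Or.inl h0) (Or.inl (measure_ne_top _ _))]
  exact hd

/-- On a box the conditional law is a product, and the factorized lower bound for the acceptance
integrates to two overlaps, each at least `d`. The factors `g i` at the other levels are 1. -/
theorem sq_le_lintegral_swapAccept_cond (hp : ∀ k, IsProbDensity ν (p k)) (k : Fin N)
    {A : Fin (N + 1) → Set X} (hA : ∀ i, MeasurableSet (A i))
    (h0 : ∀ i, densityMeasure ν (p i) (A i) ≠ 0) {d : ℝ≥0∞}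
    (hd1 : d * densityMeasure ν (p k.castSucc) (A k.castSucc)
      ≤ ∫⁻ z in A k.castSucc, ((min (p k.castSucc z) (p k.succ z) : ℝ≥0) : ℝ≥0∞) ∂ν)
    (hd2 : d * densityMeasure ν (p k.succ) (A k.succ)
      ≤ ∫⁻ z in A k.succ, ((min (p k.succ z) (p k.castSucc z) : ℝ≥0) : ℝ≥0∞) ∂ν) :
    d ^ 2 ≤ ∫⁻ x, swapAccept p k x ∂(cond (swapMeasure ν p) (Set.univ.pi A)) := by
  have hprob := fun i => isProbabilityMeasure_densityMeasure (hp i)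
  have hc := fun i => cond_isProbabilityMeasure (h0 i)
  have hne : k.succ ≠ k.castSucc := (Fin.castSucc_lt_succ).ne'
  have hmem : k.succ ∈ Finset.univ.erase k.castSucc :=
    Finset.mem_erase.2 ⟨hne, Finset.mem_univ _⟩
  let g : Fin (N + 1) → X → ℝ≥0∞ := fun i z =>
    if i = k.castSucc then ((min 1 (p k.succ z / p k.castSucc z) : ℝ≥0) : ℝ≥0∞)
    else if i = k.succ then ((min 1 (p k.castSucc z / p k.succ z) : ℝ≥0) : ℝ≥0∞) else 1
  have hg : ∀ i, Measurable (g i) := fun i => by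
    simp only [g]
    split_ifs
    · exact (measurable_const.min ((hp _).1.div (hp _).1)).coe_nnreal_ennreal
    · exact (measurable_const.min ((hp _).1.div (hp _).1)).coe_nnreal_ennreal
    · exact measurable_const
  rw [swapMeasure, cond_pi _ hA h0]
  calc d ^ 2 ≤ ∏ i, ∫⁻ z, g i z ∂(cond (densityMeasure ν (p i)) (A i)) := by
        rw [← Finset.mul_prod_erase _ _ (Finset.mem_univ k.castSucc),
          ← Finset.mul_prod_erase _ _ hmem, Finset.prod_eq_one, mul_one, pow_two]
        · refine mul_le_mul' ?_ ?_
          · simp only [g, if_true]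
            exact le_lintegral_min_cond (hp _) (hp _).1 (hA _) (h0 _) hd1
          · simp only [g, if_neg hne, if_true]
            exact le_lintegral_min_cond (hp _) (hp _).1 (hA _) (h0 _) hd2
        · intro i hi
          simp only [Finset.mem_erase] at hi
          simp [g, hi.1, hi.2.1]
    _ = ∫⁻ x, ∏ i, g i (x i) ∂(Measure.pi fun i => cond (densityMeasure ν (p i)) (A i)) :=
        (lintegral_pi_prod _ hg).symm
    _ ≤ _ := by
        refine lintegral_mono fun x => ?_
        rw [← Finset.mul_prod_erase _ _ (Finset.mem_univ k.castSucc),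
          ← Finset.mul_prod_erase _ _ hmem, Finset.prod_eq_one, mul_one]
        · simp only [g, if_neg hne, if_true]
          exact_mod_cast min_mul_min_le p k x
        · intro i hi
          simp only [Finset.mem_erase] at hi
          simp [g, hi.1, hi.2.1]

/-- A function of the cells has a constant increment over a box under a given swap, so only the mean
acceptance over the box enters. -/
theorem le_sqForm_swapKernel_cells {I : Type*} [MeasurableSpace I] [MeasurableSingletonClass I]
    [Fintype I] (hp : ∀ k, IsProbDensity ν (p k)) {c : X → I} (hc : Measurable c)
    (h0 : ∀ k i, densityMeasure ν (p k) (c ⁻¹' {i}) ≠ 0) {d : ℝ≥0∞}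
    (hd : ∀ (k : Fin N) i, d * densityMeasure ν (p k.castSucc) (c ⁻¹' {i})
        ≤ ∫⁻ z in c ⁻¹' {i}, ((min (p k.castSucc z) (p k.succ z) : ℝ≥0) : ℝ≥0∞) ∂ν
      ∧ d * densityMeasure ν (p k.succ) (c ⁻¹' {i})
        ≤ ∫⁻ z in c ⁻¹' {i}, ((min (p k.succ z) (p k.castSucc z) : ℝ≥0) : ℝ≥0∞) ∂ν)
    (φ : (Fin (N + 1) → I) → ℝ) :
    ∑ k : Fin N, ∑ σ, swapMeasure ν p (cellVector c ⁻¹' {σ})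
        * (((2 * N : ℝ≥0)⁻¹ : ℝ≥0) * (d ^ 2 * ENNReal.ofReal ((φ σ - φ (swapState k σ)) ^ 2)))
      ≤ sqForm (swapKernel p fun k => (hp k).1) (swapMeasure ν p)
        (fun x => φ (cellVector c x)) := by
  have hprob := fun i => isProbabilityMeasure_densityMeasure (hp i)
  have : IsProbabilityMeasure (swapMeasure ν p) := by unfold swapMeasure; infer_instance
  have hC := measurable_cellVector (N := N) hc
  rw [sqForm_swapKernel _ _ (f := fun x => φ (cellVector c x))
    ((measurable_of_countable φ).comp hC)]
  refine Finset.sum_le_sum fun k _ => ?_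
  rw [lintegral_eq_sum_cells _ hC]
  refine Finset.sum_le_sum fun σ _ => ?_
  gcongr
  have hae : ∀ᵐ x ∂(cond (swapMeasure ν p) (cellVector c ⁻¹' {σ})), cellVector c x = σ :=
    ae_cond_mem (hC (measurableSet_singleton σ))
  calc _ ≤ (((2 * N : ℝ≥0)⁻¹ : ℝ≥0) : ℝ≥0∞) * ((∫⁻ x, swapAccept p k x
          ∂(cond (swapMeasure ν p) (cellVector c ⁻¹' {σ})))
          * ENNReal.ofReal ((φ σ - φ (swapState k σ)) ^ 2)) := by
        gcongr
        rw [cellVector_preimage]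
        exact sq_le_lintegral_swapAccept_cond hp k
          (fun i => hc (measurableSet_singleton _)) (fun i => h0 i _) (hd k _).1 (hd k _).2
    _ = ∫⁻ x, (((2 * N : ℝ≥0)⁻¹ : ℝ≥0) : ℝ≥0∞) * (swapAccept p k x
          * ENNReal.ofReal ((φ σ - φ (swapState k σ)) ^ 2))
          ∂(cond (swapMeasure ν p) (cellVector c ⁻¹' {σ})) := by
        rw [lintegral_const_mul' _ _ ENNReal.coe_ne_top,
          lintegral_mul_const' _ _ ENNReal.ofReal_ne_top]
    _ = _ := by
        refine lintegral_congr_ae ?_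
        filter_upwards [hae] with x hx
        rw [cellVector_swapState, hx, div_eq_mul_inv, ENNReal.coe_mul]
        ring

end SwapKernel

/-! ### Paths of adjacent swaps and their weights -/

section Paths

variable {N J : ℕ}

/-- The weight of a vector of cells under the product of the distributions `w i`. -/
def vectorWeight (w : Fin (N + 1) → Fin J → ℝ) (σ : Fin (N + 1) → Fin J) : ℝ :=
  ∏ i, w i (σ i)

/-- The level from which the entry at level `m` has come when an entry belonging to level `k`
has been moved up from level `0` to level `i`, each of the entries passed moving down by one. -/
def sourceLevel (k i m : Fin (N + 1)) : Fin (N + 1) :=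
  if m < i then m + 1 else if m = i then k else m

/-- The weight of a vector of cells with entry `m` measured at the level `sourceLevel k i m`. -/
def movedWeight (w : Fin (N + 1) → Fin J → ℝ) (k i : Fin (N + 1)) (σ : Fin (N + 1) → Fin J) : ℝ :=
  ∏ m, w (sourceLevel k i m) (σ m)

/-- One more adjacent swap moves the travelling entry from `i` to `i + 1`; the entry it passes drops
one level but is still measured at its original level. -/
theorem sourceLevel_swap (k : Fin (N + 1)) (i : Fin N) (m : Fin (N + 1)) :
    sourceLevel k i.succ (Equiv.swap i.castSucc i.succ m) = sourceLevel k i.castSucc m := by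
  unfold sourceLevel
  by_cases h1 : m = i.castSucc
  · subst h1; simp
  by_cases h2 : m = i.succ
  · subst h2
    simp [h1]
    intro h
    exact absurd h (by simp [Fin.lt_def])
  · rw [Equiv.swap_apply_of_ne_of_ne h1 h2]
    have h3 : m < i.succ ↔ m < i.castSucc := by
      simp only [Fin.lt_def, Fin.ext_iff, Fin.val_succ, Fin.val_castSucc] at *
      omega
    simp only [h3, h1, h2, if_false]

theorem movedWeight_swapState (w : Fin (N + 1) → Fin J → ℝ) (k : Fin (N + 1)) (i : Fin N)
    (σ : Fin (N + 1) → Fin J) :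
    movedWeight w k i.succ (swapState i σ) = movedWeight w k i.castSucc σ := by
  unfold movedWeight
  rw [← Equiv.prod_comp (Equiv.swap i.castSucc i.succ)]
  refine Finset.prod_congr rfl fun m _ => ?_
  rw [sourceLevel_swap]
  simp [swapState]

/-- With `i = 0`, the entries at levels 0 and `k` are both measured at level `k`, so their exchange
leaves the weight unchanged. -/
theorem movedWeight_swap (w : Fin (N + 1) → Fin J → ℝ) {k : Fin (N + 1)} (hk : k ≠ 0)
    (σ : Fin (N + 1) → Fin J) :
    movedWeight w k 0 (fun m => σ (Equiv.swap 0 k m)) = movedWeight w k 0 σ := by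
  unfold movedWeight
  conv_lhs => rw [← Equiv.prod_comp (Equiv.swap 0 k)]
  refine Finset.prod_congr rfl fun m _ => ?_
  simp only [Equiv.swap_apply_self]
  congr 1
  unfold sourceLevel
  by_cases h1 : m = 0
  · subst h1; simp [hk]
  by_cases h2 : m = k
  · subst h2; simp [h1]
  · rw [Equiv.swap_apply_of_ne_of_ne h1 h2]

/-- The cyclic permutation of the levels `0, …, l` that moves the entry at level `0` up to
level `l`. -/
def rotation : Fin (N + 1) → Equiv.Perm (Fin (N + 1)) :=
  Fin.induction 1 fun i P => P * Equiv.swap i.castSucc i.succ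

theorem rotation_zero : rotation (0 : Fin (N + 1)) = 1 := rfl

theorem rotation_succ (i : Fin N) :
    rotation i.succ = rotation i.castSucc * Equiv.swap i.castSucc i.succ := by
  simp [rotation, Fin.induction_succ]

theorem rotation_apply (l : Fin (N + 1)) :
    rotation l l = 0 ∧ ∀ m, l < m → rotation l m = m := by
  induction l using Fin.induction with
  | zero => simp [rotation_zero]
  | succ i ih =>
    rw [rotation_succ]
    refine ⟨by simpa using ih.1, fun m hm => ?_⟩
    have h1 : i.castSucc < m := Fin.castSucc_lt_succ.trans hm
    rw [Equiv.Perm.mul_apply, Equiv.swap_apply_of_ne_of_ne h1.ne' hm.ne', ih.2 m h1]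

/-- The transposition of levels 0 and `i + 1` is reached without a downward path: `σ` rotated up to
`i + 1` and the transposed state rotated up to `i` are the same state. -/
theorem rotation_succ_eq (i : Fin N) :
    rotation i.succ = Equiv.swap 0 i.succ * rotation i.castSucc := by
  rw [rotation_succ, Equiv.mul_swap_eq_swap_mul, (rotation_apply i.castSucc).1,
    (rotation_apply i.castSucc).2 _ Fin.castSucc_lt_succ]

theorem swapState_comp_rotation (i : Fin N) (σ : Fin (N + 1) → Fin J) :
    swapState i (σ ∘ rotation i.castSucc) = σ ∘ rotation i.succ := by
  rw [rotation_succ]; rfl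

/-- Each adjacent swap is a bijection carrying one moved weight to the next, so the weight starting
at level 0 is pushed forward to the one at level `l`. -/
theorem sum_movedWeight_rotation (w : Fin (N + 1) → Fin J → ℝ) (k l : Fin (N + 1))
    (F : (Fin (N + 1) → Fin J) → ℝ) :
    ∑ σ, movedWeight w k 0 σ * F (σ ∘ rotation l) = ∑ σ, movedWeight w k l σ * F σ := by
  induction l using Fin.induction generalizing F with
  | zero => rfl
  | succ i ih =>
    simp only [← swapState_comp_rotation]
    rw [ih fun σ => F (swapState i σ)]
    simp only [← movedWeight_swapState]
    exact Equiv.sum_comp (Function.Involutive.toPerm _ (swapState_swapState (X := Fin J) i))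
      fun σ => movedWeight w k i.succ σ * F σ

/-- Cauchy–Schwarz along a path of `l` adjacent swaps, proved one swap at a time. -/
theorem sq_sub_rotation_le (φ : (Fin (N + 1) → Fin J) → ℝ) (l : Fin (N + 1))
    (σ : Fin (N + 1) → Fin J) :
    (φ σ - φ (σ ∘ rotation l)) ^ 2 ≤ (l : ℕ) * ∑ i ∈ Finset.univ.filter fun i : Fin N =>
      i.castSucc < l, (φ (σ ∘ rotation i.castSucc) - φ (swapState i (σ ∘ rotation i.castSucc))) ^ 2
      := by
  induction l using Fin.induction with
  | zero => simp [rotation_zero]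
  | succ i ih =>
    have hfil : (Finset.univ.filter fun m : Fin N => m.castSucc < i.succ)
        = insert i (Finset.univ.filter fun m : Fin N => m.castSucc < i.castSucc) := by
      ext m
      simp only [Finset.mem_filter, Finset.mem_univ, true_and, Finset.mem_insert, Fin.lt_def,
        Fin.val_castSucc, Fin.val_succ, Fin.ext_iff]
      omega
    rw [hfil, Finset.sum_insert (by simp)]
    set s := ∑ m ∈ Finset.univ.filter fun m : Fin N => m.castSucc < i.castSucc,
      (φ (σ ∘ rotation m.castSucc) - φ (swapState m (σ ∘ rotation m.castSucc))) ^ 2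
    rw [← swapState_comp_rotation]
    set a := φ σ - φ (σ ∘ rotation i.castSucc) with ha
    set b := φ (σ ∘ rotation i.castSucc) - φ (swapState i (σ ∘ rotation i.castSucc)) with hb
    have e : φ σ - φ (swapState i (σ ∘ rotation i.castSucc)) = a + b := by rw [ha, hb]; ring
    rw [e]
    simp only [Fin.val_castSucc, Fin.val_succ] at ih ⊢
    push_cast
    have hs : 0 ≤ s := Finset.sum_nonneg fun _ _ => sq_nonneg _
    have hi : (0 : ℝ) ≤ (i : ℕ) := Nat.cast_nonneg _
    -- The cross term is handled by `2ab ≤ a²/i + i b²` with `a² ≤ i s`. For the empty path `i = 0`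
    -- the induction hypothesis forces `a = 0`.
    rcases hi.eq_or_lt with h0 | hpos
    · rw [← h0] at ih ⊢
      have : a = 0 := by nlinarith [sq_nonneg a]
      rw [this]; nlinarith
    · have : 2 * a * b ≤ s + (i : ℕ) * b ^ 2 := by
        refine le_of_mul_le_mul_left ?_ hpos
        nlinarith [sq_nonneg ((i : ℕ) * b - a)]
      nlinarith

variable {w : Fin (N + 1) → Fin J → ℝ} {g : ℝ}

theorem min_ratio_mul_le (hw : ∀ k j, 0 < w k j) (k : Fin N) (j : Fin J) :
    min 1 (w k.castSucc j / w k.succ j) * w k.succ j ≤ w k.castSucc j := by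
  calc _ ≤ w k.castSucc j / w k.succ j * w k.succ j := by
        gcongr
        · exact (hw _ _).le
        · exact min_le_right _ _
    _ = _ := div_mul_cancel₀ _ (hw _ _).ne'

theorem min_ratio_pos (hw : ∀ k j, 0 < w k j) (k : Fin N) (j : Fin J) :
    0 < min 1 (w k.castSucc j / w k.succ j) :=
  lt_min one_pos (div_pos (hw _ _) (hw _ _))

/-- The truncated ratios at the levels below `k` already allow descent from `k` to any `i ≤ k`. The
remaining factors are at most 1 and may be included for free. -/
theorem ratio_mul_le (hw : ∀ k j, 0 < w k j)
    (hg : ∀ j, g ≤ ∏ k : Fin N, min 1 (w k.castSucc j / w k.succ j))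
    {i k : Fin (N + 1)} (hik : i ≤ k) (j : Fin J) : g * w k j ≤ w i j := by
  have key : ∀ k i : Fin (N + 1), i ≤ k → (∏ m ∈ Finset.univ.filter fun m : Fin N =>
      m.castSucc < k, min 1 (w m.castSucc j / w m.succ j)) * w k j ≤ w i j := by
    intro k
    induction k using Fin.induction with
    | zero =>
      intro i hi
      obtain rfl : i = 0 := by simpa using hi
      simp
    | succ m ih =>
      intro i hi
      rcases hi.eq_or_lt with rfl | hlt
      · refine mul_le_of_le_one_left (hw _ _).le ?_
        exact Finset.prod_le_one (fun m _ => (min_ratio_pos hw m j).le) fun m _ => min_le_left _ _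
      · have hfil : (Finset.univ.filter fun n : Fin N => n.castSucc < m.succ)
            = insert m (Finset.univ.filter fun n : Fin N => n.castSucc < m.castSucc) := by
          ext n
          simp only [Finset.mem_filter, Finset.mem_univ, true_and, Finset.mem_insert, Fin.lt_def,
            Fin.val_castSucc, Fin.val_succ, Fin.ext_iff]
          omega
        rw [hfil, Finset.prod_insert (by simp), mul_comm (min 1 _), mul_assoc]
        refine le_trans ?_ (ih i (Fin.le_castSucc_iff.2 hlt))
        refine mul_le_mul_of_nonneg_left (min_ratio_mul_le hw m j) ?_
        exact Finset.prod_nonneg fun m _ => (min_ratio_pos hw m j).le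
  refine le_trans (mul_le_mul_of_nonneg_right ((hg j).trans ?_) (hw _ _).le) (key k i hik)
  rw [← Finset.prod_filter_mul_prod_filter_not Finset.univ fun m : Fin N => m.castSucc < k]
  refine mul_le_of_le_one_right (Finset.prod_nonneg fun m _ => (min_ratio_pos hw m j).le) ?_
  exact Finset.prod_le_one (fun m _ => (min_ratio_pos hw m j).le) fun m _ => min_le_left _ _

/-- At each level only the ratio of one cell appears. All truncated ratios are at most 1, so those
of the other cells may be inserted; regrouping the double product by cell gives `J` factors, each at
least `g`. This keeps the exponent independent of `N`. -/
theorem pow_le_prod_ratio (hw : ∀ k j, 0 < w k j) (hg0 : 0 < g)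
    (hg : ∀ j, g ≤ ∏ k : Fin N, min 1 (w k.castSucc j / w k.succ j))
    (σ : Fin (N + 1) → Fin J) :
    g ^ J ≤ ∏ m : Fin N,
      min 1 (w m.castSucc (σ m.castSucc) / w m.succ (σ m.castSucc)) := by
  calc g ^ J = ∏ _j : Fin J, g := by simp
    _ ≤ ∏ j : Fin J, ∏ m : Fin N, min 1 (w m.castSucc j / w m.succ j) :=
        Finset.prod_le_prod (fun _ _ => hg0.le) fun j _ => hg j
    _ = ∏ m : Fin N, ∏ j : Fin J, min 1 (w m.castSucc j / w m.succ j) := Finset.prod_comm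
    _ ≤ _ := by
        refine Finset.prod_le_prod (fun m _ => Finset.prod_nonneg fun j _ =>
          (min_ratio_pos hw m j).le) fun m _ => ?_
        rw [← Finset.mul_prod_erase _ _ (Finset.mem_univ (σ m.castSucc))]
        refine mul_le_of_le_one_right (min_ratio_pos hw m _).le ?_
        exact Finset.prod_le_one (fun j _ => (min_ratio_pos hw m j).le) fun j _ => min_le_left _ _

/-- Entries below `i` are measured one level too high, which costs `g ^ J` altogether by the
regrouping above. The travelling entry is measured at level `k ≥ i` and costs one more `g`. Entries
above `i` cost nothing. -/
theorem movedWeight_le (hw : ∀ k j, 0 < w k j) (hg0 : 0 < g)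
    (hg : ∀ j, g ≤ ∏ k : Fin N, min 1 (w k.castSucc j / w k.succ j))
    {i k : Fin (N + 1)} (hik : i ≤ k) (σ : Fin (N + 1) → Fin J) :
    g ^ (J + 1) * movedWeight w k i σ ≤ vectorWeight w σ := by
  let r : Fin (N + 1) → ℝ := fun m => if h : (m : ℕ) < N then
    min 1 (w (Fin.castSucc ⟨m, h⟩) (σ m) / w (Fin.succ ⟨m, h⟩) (σ m)) else 1
  have hr0 : ∀ m, 0 < r m := fun m => by
    simp only [r]; split_ifs
    · exact min_ratio_pos hw _ _
    · exact one_pos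
  have hr1 : ∀ m, r m ≤ 1 := fun m => by
    simp only [r]; split_ifs
    · exact min_le_left _ _
    · exact le_rfl
  have hprod : g ^ J ≤ ∏ m, r m := by
    refine (pow_le_prod_ratio hw hg0 hg σ).trans (le_of_eq ?_)
    rw [Fin.prod_univ_castSucc]
    simp [r, Fin.succ]
  have hstep : ∀ m, r m * (if m = i then g else 1) * w (sourceLevel k i m) (σ m) ≤ w m (σ m) := by
    intro m
    unfold sourceLevel
    by_cases h1 : m < i
    · have hm : (m : ℕ) < N := by have := i.2; rw [Fin.lt_def] at h1; omega
      -- Addition in `Fin (N + 1)` is cyclic; it does not wrap around here because `m < i`.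
      have e : m + 1 = Fin.succ ⟨m, hm⟩ := by
        ext; simp [Fin.val_add_one_of_lt (h1.trans_le (Fin.le_last i))]
      rw [if_pos h1, if_neg h1.ne, mul_one, e]
      simp only [r, dif_pos hm]
      exact min_ratio_mul_le hw ⟨m, hm⟩ (σ m)
    · rw [if_neg h1]
      by_cases h2 : m = i
      · rw [if_pos h2, if_pos h2, h2, mul_assoc]
        refine le_trans (mul_le_of_le_one_left ?_ (hr1 i)) (ratio_mul_le hw hg hik _)
        exact mul_nonneg hg0.le (hw _ _).le
      · rw [if_neg h2, if_neg h2, mul_one]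
        exact mul_le_of_le_one_left (hw _ _).le (hr1 m)
  calc g ^ (J + 1) * movedWeight w k i σ
      ≤ ((∏ m, r m) * g) * movedWeight w k i σ := by
        rw [pow_succ]
        gcongr
        exact Finset.prod_nonneg fun m _ => (hw _ _).le
    _ = ∏ m, r m * (if m = i then g else 1) * w (sourceLevel k i m) (σ m) := by
        rw [Finset.prod_mul_distrib, Finset.prod_mul_distrib, Finset.prod_ite_eq' Finset.univ i]
        simp [movedWeight]
    _ ≤ _ := Finset.prod_le_prod (fun m _ => by
        have := hr0 m
        have := hw (sourceLevel k i m) (σ m)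
        split_ifs <;> positivity) fun m _ => hstep m

theorem sum_sq_sub_rotation_le (hw : ∀ k j, 0 < w k j) (hg0 : 0 < g)
    (hg : ∀ j, g ≤ ∏ k : Fin N, min 1 (w k.castSucc j / w k.succ j))
    {k l : Fin (N + 1)} (hlk : l ≤ k)
    (φ : (Fin (N + 1) → Fin J) → ℝ) :
    g ^ (J + 1) * ∑ σ, movedWeight w k 0 σ * (φ σ - φ (σ ∘ rotation l)) ^ 2
      ≤ N * ∑ i : Fin N, ∑ σ, vectorWeight w σ * (φ σ - φ (swapState i σ)) ^ 2 := by
  have hM : ∀ i σ, 0 ≤ movedWeight w k i σ := fun i σ =>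
    Finset.prod_nonneg fun m _ => (hw _ _).le
  have hS : ∀ i : Fin N, 0 ≤ ∑ σ, vectorWeight w σ * (φ σ - φ (swapState i σ)) ^ 2 := fun i =>
    Finset.sum_nonneg fun σ _ => mul_nonneg (Finset.prod_nonneg fun m _ => (hw _ _).le)
      (sq_nonneg _)
  calc g ^ (J + 1) * ∑ σ, movedWeight w k 0 σ * (φ σ - φ (σ ∘ rotation l)) ^ 2
      ≤ g ^ (J + 1) * ∑ σ, movedWeight w k 0 σ * ((l : ℕ) * ∑ i ∈ Finset.univ.filter
          fun i : Fin N => i.castSucc < l, (φ (σ ∘ rotation i.castSucc)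
            - φ (swapState i (σ ∘ rotation i.castSucc))) ^ 2) := by
        gcongr with σ
        · exact hM 0 σ
        · exact sq_sub_rotation_le φ l σ
    _ = (l : ℕ) * ∑ i ∈ Finset.univ.filter fun i : Fin N => i.castSucc < l, g ^ (J + 1) *
          ∑ σ, movedWeight w k 0 σ * (φ (σ ∘ rotation i.castSucc)
            - φ (swapState i (σ ∘ rotation i.castSucc))) ^ 2 := by
        rw [← Finset.mul_sum, Finset.sum_comm]
        simp only [Finset.mul_sum]
        refine Finset.sum_congr rfl fun σ _ => Finset.sum_congr rfl fun i _ => ?_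
        ring
    _ = (l : ℕ) * ∑ i ∈ Finset.univ.filter fun i : Fin N => i.castSucc < l, g ^ (J + 1) *
          ∑ σ, movedWeight w k i.castSucc σ * (φ σ - φ (swapState i σ)) ^ 2 := by
        congr 1
        refine Finset.sum_congr rfl fun i _ => ?_
        rw [sum_movedWeight_rotation w k i.castSucc fun σ => (φ σ - φ (swapState i σ)) ^ 2]
    _ ≤ (l : ℕ) * ∑ i ∈ Finset.univ.filter fun i : Fin N => i.castSucc < l,
          ∑ σ, vectorWeight w σ * (φ σ - φ (swapState i σ)) ^ 2 := by
        gcongr with i hi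
        rw [Finset.mul_sum]
        refine Finset.sum_le_sum fun σ _ => ?_
        rw [← mul_assoc]
        gcongr
        refine movedWeight_le hw hg0 hg ?_ σ
        exact ((Finset.mem_filter.1 hi).2.le).trans hlk
    _ ≤ _ := by
        gcongr
        · exact Finset.sum_nonneg fun i _ => hS i
        · exact Nat.lt_succ_iff.1 l.2
        · exact fun i _ _ => hS i
        · exact Finset.filter_subset _ _

/-- Both the state and its transposition are joined to a common rotated state. Each leg contributes
at most `N` times the swap sum, and the squared triangle inequality doubles each of the two. -/
theorem sum_sq_sub_swap_le (hw : ∀ k j, 0 < w k j) (hg0 : 0 < g)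
    (hg : ∀ j, g ≤ ∏ k : Fin N, min 1 (w k.castSucc j / w k.succ j))
    {k : Fin (N + 1)} (hk : k ≠ 0) (φ : (Fin (N + 1) → Fin J) → ℝ) :
    g ^ (J + 1) * ∑ σ, movedWeight w k 0 σ * (φ σ - φ (fun m => σ (Equiv.swap 0 k m))) ^ 2
      ≤ 4 * (N * ∑ i : Fin N, ∑ σ, vectorWeight w σ * (φ σ - φ (swapState i σ)) ^ 2) := by
  obtain ⟨i, rfl⟩ := Fin.exists_succ_eq.2 hk
  have h1 := sum_sq_sub_rotation_le hw hg0 hg (le_refl i.succ) φ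
  have h2 := sum_sq_sub_rotation_le hw hg0 hg (Fin.castSucc_lt_succ (i := i)).le φ
  have hM : ∀ σ, 0 ≤ movedWeight w i.succ 0 σ := fun σ =>
    Finset.prod_nonneg fun m _ => (hw _ _).le
  -- Substituting the transposed state leaves the weight unchanged and turns the shorter rotation
  -- into a path from the transposed state to the common endpoint.
  have h3 : ∑ σ, movedWeight w i.succ 0 σ * (φ σ - φ (σ ∘ rotation i.castSucc)) ^ 2
      = ∑ σ, movedWeight w i.succ 0 σ * (φ (fun m => σ (Equiv.swap 0 i.succ m))
        - φ (σ ∘ rotation i.succ)) ^ 2 := by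
    have hinv : Function.Involutive fun (σ : Fin (N + 1) → Fin J) m =>
        σ (Equiv.swap 0 i.succ m) := fun σ => by funext m; simp
    rw [← Equiv.sum_comp (Function.Involutive.toPerm _ hinv)]
    refine Finset.sum_congr rfl fun σ _ => ?_
    simp only [Function.Involutive.coe_toPerm]
    rw [movedWeight_swap w hk, rotation_succ_eq]
    rfl
  rw [h3] at h2
  have h4 : ∑ σ, movedWeight w i.succ 0 σ * (φ σ - φ (fun m => σ (Equiv.swap 0 i.succ m))) ^ 2
      ≤ 2 * (∑ σ, movedWeight w i.succ 0 σ * (φ σ - φ (σ ∘ rotation i.succ)) ^ 2)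
        + 2 * ∑ σ, movedWeight w i.succ 0 σ * (φ (fun m => σ (Equiv.swap 0 i.succ m))
          - φ (σ ∘ rotation i.succ)) ^ 2 := by
    rw [Finset.mul_sum, Finset.mul_sum, ← Finset.sum_add_distrib]
    refine Finset.sum_le_sum fun σ _ => ?_
    have := hM σ
    set x := φ σ
    set y := φ (σ ∘ rotation i.succ)
    set z := φ (fun m => σ (Equiv.swap 0 i.succ m))
    have h : (x - z) ^ 2 ≤ 2 * (x - y) ^ 2 + 2 * (z - y) ^ 2 := by
      nlinarith [sq_nonneg (x - y + (z - y))]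
    nlinarith [mul_le_mul_of_nonneg_left h this]
  have h5 := mul_le_mul_of_nonneg_left h4 (pow_nonneg hg0.le (J + 1))
  linarith

end Paths

/-! ### Resampling at level k from resampling at level 0 and swaps -/

section Resampling

variable {N J : ℕ} {w : Fin (N + 1) → Fin J → ℝ} {g : ℝ}

/-- Interchanging the old entry at level `k` with the newly drawn one is an involution on pairs. -/
theorem sum_update_exchange (k : Fin (N + 1)) (K : (Fin (N + 1) → Fin J) → Fin J → ℝ) :
    ∑ σ, ∑ a, K (Function.update σ k a) (σ k) = ∑ σ, ∑ a, K σ a := by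
  rw [← Fintype.sum_prod_type', ← Fintype.sum_prod_type']
  have hinv : Function.Involutive fun q : (Fin (N + 1) → Fin J) × Fin J =>
      (Function.update q.1 k q.2, q.1 k) := fun q => by simp
  exact Equiv.sum_comp (Function.Involutive.toPerm _ hinv) fun q => K q.1 q.2

theorem vectorWeight_update (w : Fin (N + 1) → Fin J → ℝ) (k : Fin (N + 1))
    (σ : Fin (N + 1) → Fin J) (a : Fin J) :
    vectorWeight w (Function.update σ k a) = w k a * ∏ i ∈ Finset.univ.erase k, w i (σ i) := by
  rw [vectorWeight, ← Finset.mul_prod_erase _ _ (Finset.mem_univ k), Function.update_self]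
  congr 1
  exact Finset.prod_congr rfl fun i hi => by rw [Function.update_of_ne (Finset.ne_of_mem_erase hi)]

theorem vectorWeight_eq_mul (w : Fin (N + 1) → Fin J → ℝ) (k : Fin (N + 1))
    (σ : Fin (N + 1) → Fin J) :
    vectorWeight w σ = w k (σ k) * ∏ i ∈ Finset.univ.erase k, w i (σ i) :=
  (Finset.mul_prod_erase _ _ (Finset.mem_univ k)).symm

theorem movedWeight_zero (w : Fin (N + 1) → Fin J → ℝ) (k : Fin (N + 1))
    (σ : Fin (N + 1) → Fin J) :
    movedWeight w k 0 σ = w k (σ 0) * ∏ i ∈ Finset.univ.erase 0, w i (σ i) := by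
  rw [movedWeight, ← Finset.mul_prod_erase _ _ (Finset.mem_univ 0)]
  congr 1
  exact Finset.prod_congr rfl fun i hi => by simp [sourceLevel, Finset.ne_of_mem_erase hi]

/-- The quadratic form of the chain that resamples the entry at level `k` from `w k`. -/
def resampleForm (w : Fin (N + 1) → Fin J → ℝ) (φ : (Fin (N + 1) → Fin J) → ℝ)
    (k : Fin (N + 1)) : ℝ :=
  ∑ σ, ∑ a, vectorWeight w σ * w k a * (φ σ - φ (Function.update σ k a)) ^ 2

theorem resampleForm_nonneg (hw : ∀ k j, 0 < w k j) (φ : (Fin (N + 1) → Fin J) → ℝ)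
    (k : Fin (N + 1)) : 0 ≤ resampleForm w φ k :=
  Finset.sum_nonneg fun _ _ => Finset.sum_nonneg fun _ _ => mul_nonneg (mul_nonneg
    (Finset.prod_nonneg fun _ _ => (hw _ _).le) (hw _ _).le) (sq_nonneg _)

theorem comp_swap_update {k : Fin (N + 1)} (hk : k ≠ 0) (σ : Fin (N + 1) → Fin J) (a : Fin J) :
    (fun m => Function.update σ 0 a (Equiv.swap 0 k m))
      = Function.update (Function.update σ k a) 0 (σ k) := by
  funext m
  by_cases h0 : m = 0
  · subst h0; simp [hk]
  by_cases h1 : m = k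
  · subst h1; simp [hk]
  · rw [Equiv.swap_apply_of_ne_of_ne h0 h1]; simp [h0, h1]

/-- Replace the entry at level `k` by `a` in three moves: put `a` at level 0, transpose levels 0 and
`k`, then resample level 0 to restore its original entry. The outer moves draw from `w k` where
level 0 would draw from `w 0`, at a cost of `g`; the middle one is the path estimate. -/
theorem resampleForm_le (hw : ∀ k j, 0 < w k j) (hsum : ∀ k, ∑ j, w k j = 1) (hg0 : 0 < g)
    (hg1 : g ≤ 1) (hg : ∀ j, g ≤ ∏ k : Fin N, min 1 (w k.castSucc j / w k.succ j))
    (φ : (Fin (N + 1) → Fin J) → ℝ) (k : Fin (N + 1)) :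
    g ^ (J + 1) * resampleForm w φ k ≤ 8 * (resampleForm w φ 0
      + N * ∑ i : Fin N, ∑ σ, vectorWeight w σ * (φ σ - φ (swapState i σ)) ^ 2) := by
  have hW : ∀ σ, 0 < vectorWeight w σ := fun σ => Finset.prod_pos fun m _ => hw _ _
  have hR0 := resampleForm_nonneg hw φ 0
  have hS : 0 ≤ (N : ℝ) * ∑ i : Fin N, ∑ σ, vectorWeight w σ * (φ σ - φ (swapState i σ)) ^ 2 :=
    mul_nonneg (Nat.cast_nonneg N) (Finset.sum_nonneg fun i _ => Finset.sum_nonneg fun σ _ =>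
      mul_nonneg (hW σ).le (sq_nonneg _))
  have hgJ : g ^ (J + 1) ≤ 1 := pow_le_one₀ hg0.le hg1
  by_cases hk : k = 0
  · subst hk
    have := mul_le_of_le_one_left hR0 hgJ
    linarith
  set A := ∑ σ, ∑ a, vectorWeight w σ * w k a * (φ σ - φ (Function.update σ 0 a)) ^ 2 with hA
  have hA0 : 0 ≤ A := Finset.sum_nonneg fun σ _ => Finset.sum_nonneg fun a _ =>
    mul_nonneg (mul_nonneg (hW σ).le (hw _ _).le) (sq_nonneg _)
  have hAle : g * A ≤ resampleForm w φ 0 := by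
    rw [hA, resampleForm, Finset.mul_sum]
    refine Finset.sum_le_sum fun σ _ => ?_
    rw [Finset.mul_sum]
    refine Finset.sum_le_sum fun a _ => ?_
    have h := ratio_mul_le hw hg (Fin.zero_le k) a
    calc _ = vectorWeight w σ * (g * w k a) * (φ σ - φ (Function.update σ 0 a)) ^ 2 := by ring
      _ ≤ _ := by gcongr; exact (hW σ).le
  have hAle' : g ^ (J + 1) * A ≤ resampleForm w φ 0 := by
    refine le_trans ?_ hAle
    rw [pow_succ, mul_assoc]
    exact mul_le_of_le_one_left (mul_nonneg hg0.le hA0) (pow_le_one₀ hg0.le hg1)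
  -- The last move is the first one with the old and new entries at level `k` interchanged, and the
  -- joint weight is symmetric under this exchange.
  have hC : ∑ σ, ∑ a, vectorWeight w σ * w k a
      * (φ (Function.update σ k a) - φ (Function.update (Function.update σ k a) 0 (σ k))) ^ 2
      = A := by
    rw [hA, ← sum_update_exchange k fun σ a =>
      vectorWeight w σ * w k a * (φ σ - φ (Function.update σ 0 a)) ^ 2]
    refine Finset.sum_congr rfl fun σ _ => Finset.sum_congr rfl fun a _ => ?_
    rw [vectorWeight_update, vectorWeight_eq_mul w k σ]
    ring
  -- After the first move the former entry at level 0 is forgotten. Summing it out leaves a state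
  -- whose level 0 has weight `w k`, which is the moved weight at the start of the path.
  have hB : ∑ σ, ∑ a, vectorWeight w σ * w k a * (φ (Function.update σ 0 a)
      - φ (fun m => Function.update σ 0 a (Equiv.swap 0 k m))) ^ 2
      = ∑ σ, movedWeight w k 0 σ * (φ σ - φ (fun m => σ (Equiv.swap 0 k m))) ^ 2 := by
    have e : ∀ σ : Fin (N + 1) → Fin J, movedWeight w k 0 σ
        * (φ σ - φ (fun m => σ (Equiv.swap 0 k m))) ^ 2
        = ∑ a, vectorWeight w (Function.update σ 0 a) * w k (σ 0)
          * (φ σ - φ (fun m => σ (Equiv.swap 0 k m))) ^ 2 := fun σ => by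
      simp only [vectorWeight_update]
      rw [← Finset.sum_mul, ← Finset.sum_mul, ← Finset.sum_mul, hsum, movedWeight_zero]
      ring
    simp only [e]
    rw [← sum_update_exchange 0 fun σ a => vectorWeight w (Function.update σ 0 a) * w k (σ 0)
      * (φ σ - φ (fun m => σ (Equiv.swap 0 k m))) ^ 2]
    simp
  have hBle := sum_sq_sub_swap_le hw hg0 hg hk φ
  rw [← hB] at hBle
  set B := ∑ σ, ∑ a, vectorWeight w σ * w k a * (φ (Function.update σ 0 a)
      - φ (fun m => Function.update σ 0 a (Equiv.swap 0 k m))) ^ 2 with hBdef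
  have hmain : resampleForm w φ k ≤ 4 * A + 2 * B + 4 * A := by
    suffices h : resampleForm w φ k ≤ 4 * A + 2 * B + 4 * ∑ σ, ∑ a, vectorWeight w σ * w k a
        * (φ (Function.update σ k a) - φ (Function.update (Function.update σ k a) 0 (σ k))) ^ 2 by
      rwa [hC] at h
    rw [hA, hBdef]
    simp only [Finset.mul_sum, ← Finset.sum_add_distrib, resampleForm]
    refine Finset.sum_le_sum fun σ _ => Finset.sum_le_sum fun a _ => ?_
    rw [comp_swap_update hk]
    have hp : 0 ≤ vectorWeight w σ * w k a := mul_nonneg (hW σ).le (hw _ _).le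
    set x := φ σ
    set y := φ (Function.update σ 0 a)
    set z := φ (Function.update (Function.update σ k a) 0 (σ k))
    set t := φ (Function.update σ k a)
    -- Weighted Cauchy–Schwarz with `1/4 + 1/2 + 1/4 = 1`. The weights are chosen so that the outer
    -- moves give `8A` and the middle one `2B`, where `B` costs four path sums, hence a common
    -- factor 8.
    have h : (x - t) ^ 2 ≤ 4 * (x - y) ^ 2 + 2 * (y - z) ^ 2 + 4 * (t - z) ^ 2 := by
      nlinarith [sq_nonneg ((x - y) - (z - t)), sq_nonneg ((x - y) + (z - t) - (y - z))]
    nlinarith [mul_le_mul_of_nonneg_left h hp]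
  have h5 := mul_le_mul_of_nonneg_left hmain (pow_nonneg hg0.le (J + 1))
  linarith

end Resampling

/-! ### Compositions of lazy kernels -/

section LazyComposition

variable {Y : Type*} [MeasurableSpace Y]

/-- A step of `Q T Q` acts as `T` when both swaps hold, and as the first `Q` when the update and the
second swap hold. Each event keeps at least a quarter of the corresponding form, for any measure
`μ`. -/
theorem quarter_mul_sqForm_le_of_lazy {Q T : Kernel Y Y} [IsSFiniteKernel Q] [IsSFiniteKernel T]
    (hQ : ∀ x, ∀ g : Y → ℝ≥0∞, Measurable g → 2⁻¹ * g x ≤ ∫⁻ y, g y ∂(Q x))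
    (hT : ∀ x, ∀ g : Y → ℝ≥0∞, Measurable g → 2⁻¹ * g x ≤ ∫⁻ y, g y ∂(T x))
    (μ : Measure Y) {f : Y → ℝ} (hf : Measurable f) :
    2⁻¹ * (2⁻¹ * sqForm T μ f) ≤ sqForm (Kernel.comp Q (Kernel.comp T Q)) μ f
      ∧ 2⁻¹ * (2⁻¹ * sqForm Q μ f) ≤ sqForm (Kernel.comp Q (Kernel.comp T Q)) μ f := by
  have h2 : (2⁻¹ : ℝ≥0∞) ≠ ∞ := by simp
  have hcomp : ∀ x, ∀ g : Y → ℝ≥0∞, Measurable g →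
      ∫⁻ y, g y ∂(Kernel.comp Q (Kernel.comp T Q) x)
        = ∫⁻ y, ∫⁻ z, ∫⁻ u, g u ∂(Q z) ∂(T y) ∂(Q x) := fun x g hg => by
    rw [Kernel.lintegral_comp _ _ _ hg, Kernel.lintegral_comp _ _ _ hg.lintegral_kernel]
  constructor
  · simp only [sqForm]
    rw [← lintegral_const_mul' _ _ h2, ← lintegral_const_mul' _ _ h2]
    refine lintegral_mono fun x => ?_
    have hg : Measurable fun y => ENNReal.ofReal ((f x - f y) ^ 2) :=
      ((measurable_const.fun_sub hf).pow_const 2).ennreal_ofReal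
    rw [hcomp x _ hg]
    refine le_trans ?_ (hQ x _ hg.lintegral_kernel.lintegral_kernel)
    gcongr
    rw [← lintegral_const_mul' _ _ h2]
    exact lintegral_mono fun y => hQ y _ hg
  · simp only [sqForm]
    rw [← lintegral_const_mul' _ _ h2, ← lintegral_const_mul' _ _ h2]
    refine lintegral_mono fun x => ?_
    have hg : Measurable fun y => ENNReal.ofReal ((f x - f y) ^ 2) :=
      ((measurable_const.fun_sub hf).pow_const 2).ennreal_ofReal
    rw [hcomp x _ hg, ← lintegral_const_mul' _ _ h2, ← lintegral_const_mul' _ _ h2]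
    refine lintegral_mono fun y => ?_
    refine le_trans ?_ (hT y _ hg.lintegral_kernel)
    gcongr
    exact hQ y _ hg

end LazyComposition

/-! ### The update move -/

section UpdateKernel

variable {X : Type*} [MeasurableSpace X] {N : ℕ} (T : Fin (N + 1) → Kernel X X)
  [∀ k, IsMarkovKernel (T k)]

theorem lintegral_updateKernel (x : Fin (N + 1) → X) {g : (Fin (N + 1) → X) → ℝ≥0∞}
    (hg : Measurable g) :
    ∫⁻ y, g y ∂(updateKernel T x)
      = 2⁻¹ * g x + ∑ k, (2 * (N + 1) : ℝ≥0∞)⁻¹ * ∫⁻ y, g y ∂(coordKernel T k x) := by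
  have h : updateKernel T x = (2⁻¹ : ℝ≥0∞) • Measure.dirac x
    + ∑ k, ((2 * (N + 1) : ℝ≥0∞)⁻¹) • coordKernel T k x := rfl
  rw [h, lintegral_add_measure, lintegral_smul_measure, lintegral_dirac' _ hg,
    lintegral_finsetSum_measure]
  simp only [lintegral_smul_measure, smul_eq_mul]

theorem half_add_sum_eq_one (a : ℝ≥0∞) :
    2⁻¹ * a + ∑ _k : Fin (N + 1), (2 * (N + 1) : ℝ≥0∞)⁻¹ * a = a := by
  have h : ((N : ℝ≥0∞) + 1) * (2 * (N + 1) : ℝ≥0∞)⁻¹ = 2⁻¹ := by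
    rw [ENNReal.mul_inv (by simp) (by simp), mul_left_comm, ENNReal.mul_inv_cancel (by simp)
      (by finiteness), mul_one]
  rw [Finset.sum_const, Finset.card_univ, Fintype.card_fin, nsmul_eq_mul, ← mul_assoc]
  push_cast
  rw [h, ← add_mul, ENNReal.inv_two_add_inv_two, one_mul]

theorem isMarkovKernel_updateKernel : IsMarkovKernel (updateKernel T) := by
  refine ⟨fun x => ⟨?_⟩⟩
  rw [← lintegral_one, lintegral_updateKernel T x measurable_const]
  simpa using half_add_sum_eq_one (N := N) 1

theorem half_le_lintegral_updateKernel (x : Fin (N + 1) → X) {g : (Fin (N + 1) → X) → ℝ≥0∞}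
    (hg : Measurable g) : 2⁻¹ * g x ≤ ∫⁻ y, g y ∂(updateKernel T x) := by
  rw [lintegral_updateKernel T x hg]
  exact le_self_add

theorem sqForm_updateKernel (μ : Measure (Fin (N + 1) → X)) {f : (Fin (N + 1) → X) → ℝ}
    (hf : Measurable f) :
    sqForm (updateKernel T) μ f = (2 * (N + 1) : ℝ≥0∞)⁻¹ * ∑ k, sqForm (coordKernel T k) μ f := by
  have hne : (2 * (N + 1) : ℝ≥0∞)⁻¹ ≠ ∞ := by simp
  simp only [sqForm]
  rw [← lintegral_finsetSum _ fun k _ => measurable_lintegral_sq_sub (coordKernel T k) hf,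
    ← lintegral_const_mul' _ _ hne]
  refine lintegral_congr fun x => ?_
  rw [lintegral_updateKernel T x ((measurable_const.fun_sub hf).pow_const 2).ennreal_ofReal]
  simp [Finset.mul_sum]

theorem invariant_updateKernel (m : Fin (N + 1) → Measure X) [∀ k, IsProbabilityMeasure (m k)]
    (h : ∀ k, (T k).Invariant (m k)) : (updateKernel T).Invariant (Measure.pi m) := by
  have hne : (2 * (N + 1) : ℝ≥0∞)⁻¹ ≠ ∞ := by simp
  ext s hs
  have hg : Measurable (s.indicator (1 : (Fin (N + 1) → X) → ℝ≥0∞)) := measurable_one.indicator hs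
  rw [Measure.bind_apply hs (Kernel.aemeasurable _)]
  simp only [← lintegral_indicator_one hs, lintegral_updateKernel T _ hg]
  rw [lintegral_add_left (hg.const_mul _), lintegral_finsetSum _ fun k _ =>
    hg.lintegral_kernel.const_mul _, lintegral_const_mul _ hg]
  simp only [lintegral_const_mul' _ _ hne]
  simp only [lintegral_lintegral_of_invariant (invariant_coordKernel m T _ (h _)) hg]
  exact half_add_sum_eq_one _

end UpdateKernel

/-! ### Variance of the cell vector -/

section CellMeans

variable {X : Type*} [MeasurableSpace X] {N J : ℕ} (m : Fin (N + 1) → Measure X)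
  [∀ k, IsProbabilityMeasure (m k)] {c : X → Fin J}

theorem sqForm_coordKernel_const_map (φ : (Fin (N + 1) → Fin J) → ℝ) (k : Fin (N + 1))
    [∀ k, IsProbabilityMeasure ((m k).map c)] :
    sqForm (coordKernel (fun k => Kernel.const (Fin J) ((m k).map c)) k)
        (Measure.pi fun k => (m k).map c) φ
      = ENNReal.ofReal (resampleForm (fun k j => ((m k).map c).real {j}) φ k) := by
  have hV : ∀ σ, 0 ≤ vectorWeight (fun k j => ((m k).map c).real {j}) σ := fun σ =>
    Finset.prod_nonneg fun i _ => measureReal_nonneg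
  rw [sqForm_coordKernel _ k _ (measurable_of_countable φ), lintegral_fintype, resampleForm,
    ENNReal.ofReal_sum_of_nonneg fun σ _ => Finset.sum_nonneg fun a _ => mul_nonneg (mul_nonneg
      (hV σ) measureReal_nonneg) (sq_nonneg _)]
  refine Finset.sum_congr rfl fun σ _ => ?_
  simp only [Kernel.const_apply]
  rw [lintegral_fintype, Finset.sum_mul, ENNReal.ofReal_sum_of_nonneg fun a _ => mul_nonneg
    (mul_nonneg (hV σ) measureReal_nonneg) (sq_nonneg _)]
  refine Finset.sum_congr rfl fun a _ => ?_
  rw [ENNReal.ofReal_mul (mul_nonneg (hV σ) measureReal_nonneg), ENNReal.ofReal_mul (hV σ),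
    vectorWeight, ENNReal.ofReal_prod_of_nonneg fun i _ => measureReal_nonneg, Measure.pi_singleton]
  simp only [ofReal_measureReal (measure_ne_top _ _)]
  ring

/-- The Efron–Stein inequality on the finite product space of cell labels. -/
theorem two_mul_variance_map_le (hc : Measurable c) (φ : (Fin (N + 1) → Fin J) → ℝ) :
    2 * variance φ ((Measure.pi m).map (cellVector c))
      ≤ ∑ k, resampleForm (fun k j => (m k).real (c ⁻¹' {j})) φ k := by
  have hM : ∀ k, IsProbabilityMeasure ((m k).map c) := fun k =>
    Measure.isProbabilityMeasure_map hc.aemeasurable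
  have h := sqForm_const_pi_le (fun k => (m k).map c) (measurable_of_countable φ)
    MemLp.of_discrete
  rw [sqForm_const _ (measurable_of_countable φ) MemLp.of_discrete] at h
  simp only [sqForm_coordKernel_const_map] at h
  have e : (fun k j => ((m k).map c).real {j}) = fun k j => (m k).real (c ⁻¹' {j}) := by
    funext k j
    exact map_measureReal_apply hc (measurableSet_singleton j)
  rw [e] at h
  have hnn : ∀ k, 0 ≤ resampleForm (fun k j => (m k).real (c ⁻¹' {j})) φ k := fun k =>
    Finset.sum_nonneg fun σ _ => Finset.sum_nonneg fun a _ => mul_nonneg (mul_nonneg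
      (Finset.prod_nonneg fun i _ => measureReal_nonneg) measureReal_nonneg) (sq_nonneg _)
  rw [← ENNReal.ofReal_sum_of_nonneg fun k _ => hnn k,
    ENNReal.ofReal_le_ofReal_iff (Finset.sum_nonneg fun k _ => hnn k)] at h
  rwa [map_cellVector m hc]

end CellMeans

/-! ### From functions of cells back to functions of states -/

section CellMeanForms

theorem ofReal_sq_integral_le {Y : Type*} [MeasurableSpace Y] {μ : Measure Y}
    [IsProbabilityMeasure μ] {h : Y → ℝ} (hL : MemLp h 2 μ) :
    ENNReal.ofReal ((∫ y, h y ∂μ) ^ 2) ≤ ∫⁻ y, ENNReal.ofReal (h y ^ 2) ∂μ := by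
  rw [lintegral_ofReal_sq_eq hL]
  refine ENNReal.ofReal_le_ofReal ?_
  have := variance_nonneg h μ
  rw [variance_eq_sub hL] at this
  exact sub_nonneg.1 this

variable {X : Type*} [MeasurableSpace X] {N J : ℕ} (m : Fin (N + 1) → Measure X)
  [∀ k, IsProbabilityMeasure (m k)] {c : X → Fin J}

theorem pi_cellVector_ne_zero (h0 : ∀ k j, m k (c ⁻¹' {j}) ≠ 0) (σ : Fin (N + 1) → Fin J) :
    Measure.pi m (cellVector c ⁻¹' {σ}) ≠ 0 := by
  rw [cellVector_preimage, Measure.pi_pi]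
  exact Finset.prod_ne_zero_iff.2 fun i _ => h0 i (σ i)

theorem pi_cellVector_eq_ofReal (σ : Fin (N + 1) → Fin J) :
    Measure.pi m (cellVector c ⁻¹' {σ})
      = ENNReal.ofReal (vectorWeight (fun k j => (m k).real (c ⁻¹' {j})) σ) := by
  rw [cellVector_preimage, Measure.pi_pi, vectorWeight,
    ENNReal.ofReal_prod_of_nonneg fun i _ => measureReal_nonneg]
  simp only [ofReal_measureReal (measure_ne_top _ _)]

theorem cond_cellVector (hc : Measurable c) (h0 : ∀ k j, m k (c ⁻¹' {j}) ≠ 0)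
    (σ : Fin (N + 1) → Fin J) :
    ProbabilityTheory.cond (Measure.pi m) (cellVector c ⁻¹' {σ})
      = Measure.pi fun i => ProbabilityTheory.cond (m i) (c ⁻¹' {σ i}) := by
  rw [cellVector_preimage]
  exact cond_pi m (fun i => hc (measurableSet_singleton _)) fun i => h0 i (σ i)

/-- Couple the two boxes: draw `x` from box `σ` and an independent `t` from cell `j` of level `k`.
The updated state then has the law of the new box, and Jensen's inequality bounds the squared
difference of the means. -/
theorem ofReal_sq_cellMean_sub_le (hc : Measurable c) (h0 : ∀ k j, m k (c ⁻¹' {j}) ≠ 0)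
    {f : (Fin (N + 1) → X) → ℝ} (hf : Measurable f) (hL : MemLp f 2 (Measure.pi m))
    (k : Fin (N + 1)) (σ : Fin (N + 1) → Fin J) (j : Fin J) :
    ENNReal.ofReal ((cellMean (Measure.pi m) (cellVector c) f σ
        - cellMean (Measure.pi m) (cellVector c) f (Function.update σ k j)) ^ 2)
      ≤ ∫⁻ x, ∫⁻ t, ENNReal.ofReal ((f x - f (Function.update x k t)) ^ 2)
          ∂(ProbabilityTheory.cond (m k) (c ⁻¹' {j}))
          ∂(ProbabilityTheory.cond (Measure.pi m) (cellVector c ⁻¹' {σ})) := by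
  have hp : ∀ i a, IsProbabilityMeasure (ProbabilityTheory.cond (m i) (c ⁻¹' {a})) := fun i a =>
    cond_isProbabilityMeasure (h0 i a)
  have hs : ∀ τ, IsProbabilityMeasure
      (ProbabilityTheory.cond (Measure.pi m) (cellVector c ⁻¹' {τ})) := fun τ =>
    cond_isProbabilityMeasure (pi_cellVector_ne_zero m h0 τ)
  have hLs : ∀ τ, MemLp f 2 (ProbabilityTheory.cond (Measure.pi m) (cellVector c ⁻¹' {τ})) :=
    fun τ => memLp_cond (pi_cellVector_ne_zero m h0 τ) hL
  have hmp : MeasurePreserving (fun q : (Fin (N + 1) → X) × X => Function.update q.1 k q.2)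
      ((ProbabilityTheory.cond (Measure.pi m) (cellVector c ⁻¹' {σ})).prod
        (ProbabilityTheory.cond (m k) (c ⁻¹' {j})))
      (ProbabilityTheory.cond (Measure.pi m) (cellVector c ⁻¹' {Function.update σ k j})) := by
    have h := measurePreserving_update (fun i => ProbabilityTheory.cond (m i) (c ⁻¹' {σ i}))
      (ProbabilityTheory.cond (m k) (c ⁻¹' {j})) k
    rw [cond_cellVector m hc h0, cond_cellVector m hc h0]
    convert h using 2
    funext i
    by_cases hi : i = k
    · subst hi; simp
    · simp [Function.update_of_ne hi]
  have hfst := measurePreserving_fst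
    (μ := ProbabilityTheory.cond (Measure.pi m) (cellVector c ⁻¹' {σ}))
    (ν := ProbabilityTheory.cond (m k) (c ⁻¹' {j}))
  have h1 := (hLs σ).comp_measurePreserving hfst
  have h2 := (hLs (Function.update σ k j)).comp_measurePreserving hmp
  have hJ := ofReal_sq_integral_le (h1.sub h2)
  have hI : ∫ q, ((f ∘ Prod.fst : (Fin (N + 1) → X) × X → ℝ)
      - (f ∘ fun q : (Fin (N + 1) → X) × X => Function.update q.1 k q.2)) q
      ∂((ProbabilityTheory.cond (Measure.pi m)
        (cellVector c ⁻¹' {σ})).prod (ProbabilityTheory.cond (m k) (c ⁻¹' {j})))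
      = cellMean (Measure.pi m) (cellVector c) f σ
        - cellMean (Measure.pi m) (cellVector c) f (Function.update σ k j) := by
    rw [integral_sub' (h1.integrable one_le_two) (h2.integrable one_le_two)]
    congr 1
    · exact integral_comp_of_measurePreserving hfst hf
    · exact integral_comp_of_measurePreserving hmp hf
  rw [hI] at hJ
  refine hJ.trans_eq (lintegral_prod _ ?_)
  exact (((hf.comp measurable_fst).sub (hf.comp (measurable_update_pair k))).pow_const
    2).ennreal_ofReal.aemeasurable

theorem ofReal_resampleForm_cellMean_le (hc : Measurable c) (h0 : ∀ k j, m k (c ⁻¹' {j}) ≠ 0)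
    {f : (Fin (N + 1) → X) → ℝ} (hf : Measurable f) (hL : MemLp f 2 (Measure.pi m))
    (k : Fin (N + 1)) :
    ENNReal.ofReal (resampleForm (fun k j => (m k).real (c ⁻¹' {j}))
        (cellMean (Measure.pi m) (cellVector c) f) k)
      ≤ sqForm (coordKernel (fun k => Kernel.const X (m k)) k) (Measure.pi m) f := by
  have hV : ∀ σ, 0 ≤ vectorWeight (fun k j => (m k).real (c ⁻¹' {j})) σ := fun σ =>
    Finset.prod_nonneg fun i _ => measureReal_nonneg
  rw [sqForm_coordKernel _ k _ hf, lintegral_eq_sum_cells _ (measurable_cellVector hc),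
    resampleForm, ENNReal.ofReal_sum_of_nonneg fun σ _ => Finset.sum_nonneg fun a _ =>
      mul_nonneg (mul_nonneg (hV σ) measureReal_nonneg) (sq_nonneg _)]
  refine Finset.sum_le_sum fun σ _ => ?_
  simp only [Kernel.const_apply]
  have hmeas : ∀ j, Measurable fun x : Fin (N + 1) → X =>
      ∫⁻ t, ENNReal.ofReal ((f x - f (Function.update x k t)) ^ 2)
        ∂(ProbabilityTheory.cond (m k) (c ⁻¹' {j})) := fun j => by
    have := cond_isProbabilityMeasure (h0 k j)
    exact Measurable.lintegral_prod_right' (f := fun q : (Fin (N + 1) → X) × X =>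
      ENNReal.ofReal ((f q.1 - f (Function.update q.1 k q.2)) ^ 2))
      (((hf.comp measurable_fst).sub (hf.comp (measurable_update_pair k))).pow_const
        2).ennreal_ofReal
  simp only [lintegral_eq_sum_cells (m k) hc]
  rw [lintegral_finsetSum _ fun j _ => (hmeas j).const_mul _, Finset.mul_sum,
    ENNReal.ofReal_sum_of_nonneg fun a _ => mul_nonneg (mul_nonneg (hV σ) measureReal_nonneg)
      (sq_nonneg _)]
  refine Finset.sum_le_sum fun j _ => ?_
  rw [lintegral_const_mul _ (hmeas j), ENNReal.ofReal_mul (mul_nonneg (hV σ) measureReal_nonneg),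
    ENNReal.ofReal_mul (hV σ), ← pi_cellVector_eq_ofReal, ofReal_measureReal (measure_ne_top _ _),
    mul_assoc]
  gcongr
  exact ofReal_sq_cellMean_sub_le m hc h0 hf hL k σ j

/-- The Efron–Stein inequality inside each box, where a fresh draw from a factor is exactly a draw
from the current cell of that level. -/
theorem two_mul_sum_cells_variance_le (hc : Measurable c) (h0 : ∀ k j, m k (c ⁻¹' {j}) ≠ 0)
    [∀ k, IsMarkovKernel (cellKernel (m k) hc)]
    {f : (Fin (N + 1) → X) → ℝ} (hf : Measurable f) (hL : MemLp f 2 (Measure.pi m)) :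
    2 * ∑ σ, Measure.pi m (cellVector c ⁻¹' {σ}) * ENNReal.ofReal (variance f
        (ProbabilityTheory.cond (Measure.pi m) (cellVector c ⁻¹' {σ})))
      ≤ ∑ k, sqForm (coordKernel (fun k => cellKernel (m k) hc) k) (Measure.pi m) f := by
  have hp : ∀ i a, IsProbabilityMeasure (ProbabilityTheory.cond (m i) (c ⁻¹' {a})) := fun i a =>
    cond_isProbabilityMeasure (h0 i a)
  have e : ∀ k, sqForm (coordKernel (fun k => cellKernel (m k) hc) k) (Measure.pi m) f
      = ∑ σ, Measure.pi m (cellVector c ⁻¹' {σ}) *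
        sqForm (coordKernel (fun k => Kernel.const X
          (ProbabilityTheory.cond (m k) (c ⁻¹' {σ k}))) k)
          (ProbabilityTheory.cond (Measure.pi m) (cellVector c ⁻¹' {σ})) f := fun k => by
    rw [sqForm_coordKernel _ k _ hf, lintegral_eq_sum_cells _ (measurable_cellVector hc)]
    refine Finset.sum_congr rfl fun σ _ => ?_
    rw [sqForm_coordKernel _ k _ hf]
    congr 1
    refine lintegral_congr_ae ?_
    filter_upwards [ae_cond_mem (measurable_cellVector hc (measurableSet_singleton σ))] with x hx
    rw [cellKernel_apply, Kernel.const_apply, ← show cellVector c x = σ from hx]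
    rfl
  simp only [e]
  rw [Finset.sum_comm, Finset.mul_sum]
  refine Finset.sum_le_sum fun σ _ => ?_
  rw [← Finset.mul_sum, mul_left_comm]
  gcongr
  have hLσ := memLp_cond (pi_cellVector_ne_zero m h0 σ) hL
  rw [cond_cellVector m hc h0] at hLσ ⊢
  refine le_trans (le_of_eq ?_) (sqForm_const_pi_le _ hf hLσ)
  rw [sqForm_const _ hf hLσ, ENNReal.ofReal_mul zero_le_two, ENNReal.ofReal_ofNat]

end CellMeanForms

/-! ### Comparison of all forms with that of the swapping chain -/

section GapBound

/-- The arithmetic of the final assembly. In the application `n = N`, `a = γ^{J+3}`, `b = γ^{J+1}`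
and `d = δ²`; `l` and `G` are the restricted and projected gaps; `F`, `q`, `t`, `t₀` are the forms
of `QTQ`, of `Q`, of all coordinate updates together and of the one at level 0; `R` and `S` are the
resampling form at level 0 and the adjacent-swap sum of the box means. -/
theorem mul_variance_le_of_comparison {M n a b d l G F q t₀ t D V R S : ℝ}
    (hM : M = n + 1) (hn : 1 ≤ n) (ha : a ≤ b) (ha1 : a ≤ 1)
    (hd0 : 0 ≤ d) (hd1 : d ≤ 1) (hl0 : 0 ≤ l) (hl2 : l ≤ 2) (hG0 : 0 ≤ G) (hG2 : G ≤ 2)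
    (hF : 0 ≤ F) (hD : 0 ≤ D) (hV : 0 ≤ V) (hR : 0 ≤ R) (hq : q ≤ 4 * F) (ht₀ : t₀ ≤ t)
    (ht : t ≤ 8 * M * F) (h1 : l * (2 * D) ≤ t) (h2 : l * G * R ≤ 16 * t₀)
    (h3 : d * S ≤ 2 * n * (2 * q + 4 * D)) (h4 : b * (2 * V) ≤ 8 * M * (R + n * S)) :
    a * d * G * l * (2 * (D + V)) ≤ 2 ^ 12 * M ^ 4 * F := by
  have hlG0 : 0 ≤ l * G := mul_nonneg hl0 hG0
  have hlG4 : l * G ≤ 4 := by nlinarith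
  have hlD : l * G * (2 * D) ≤ 16 * M * F := by
    calc l * G * (2 * D) = G * (l * (2 * D)) := by ring
      _ ≤ G * (8 * M * F) := mul_le_mul_of_nonneg_left (h1.trans ht) hG0
      _ ≤ 2 * (8 * M * F) := mul_le_mul_of_nonneg_right hG2 (by subst hM; positivity)
      _ = _ := by ring
  have e1 : a * d * G * l * (2 * D) ≤ 16 * M * F := by
    have had : a * d ≤ 1 := mul_le_one₀ ha1 hd0 hd1
    calc a * d * G * l * (2 * D) = (a * d) * (l * G * (2 * D)) := by ring
      _ ≤ 1 * (l * G * (2 * D)) := mul_le_mul_of_nonneg_right had (by positivity)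
      _ ≤ _ := by rw [one_mul]; exact hlD
  have e2 : l * G * (d * R) ≤ 128 * M * F := by
    calc l * G * (d * R) ≤ l * G * (1 * R) := by gcongr
      _ ≤ 16 * t₀ := by rw [one_mul]; exact h2
      _ ≤ _ := by linarith
  have e3 : l * G * (d * S) ≤ 2 * n * (32 * F + 32 * M * F) := by
    calc l * G * (d * S) ≤ l * G * (2 * n * (2 * q + 4 * D)) := by gcongr
      _ = 2 * n * (2 * (l * G * q) + 2 * (l * G * (2 * D))) := by ring
      _ ≤ 2 * n * (2 * (4 * (4 * F)) + 2 * (16 * M * F)) := by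
        have : l * G * q ≤ 4 * (4 * F) := (mul_le_mul_of_nonneg_left hq hlG0).trans
          (mul_le_mul_of_nonneg_right hlG4 (by positivity))
        gcongr
      _ = _ := by ring
  have e4 : a * d * G * l * (2 * V)
      ≤ 8 * M * (128 * M * F + n * (2 * n * (32 * F + 32 * M * F))) := by
    have hM0 : 0 ≤ M := by linarith
    calc a * d * G * l * (2 * V) = (l * G * d) * (a * (2 * V)) := by ring
      _ ≤ (l * G * d) * (b * (2 * V)) := by gcongr
      _ ≤ (l * G * d) * (8 * M * (R + n * S)) := by gcongr
      _ = 8 * M * (l * G * (d * R) + n * (l * G * (d * S))) := by ring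
      _ ≤ _ := by gcongr
  have e5 : 16 * M + 8 * M * (128 * M + n * (2 * n * (32 + 32 * M))) ≤ 2 ^ 12 * M ^ 4 := by
    subst hM
    have : (0 : ℝ) ≤ n - 1 := by linarith
    -- As polynomials in `s = n - 1` the difference of the two sides has nonnegative coefficients.
    obtain ⟨s, rfl⟩ : ∃ s, n = s + 1 := ⟨n - 1, by ring⟩
    have hs : 0 ≤ s := by linarith
    have h := show (0 : ℝ) ≤ s ^ 4 + s ^ 3 + s ^ 2 + s by positivity
    have p2 : 0 ≤ s ^ 2 := by positivity
    have p3 : 0 ≤ s ^ 3 := by positivity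
    have p4 : 0 ≤ s ^ 4 := by positivity
    ring_nf
    linarith
  calc a * d * G * l * (2 * (D + V))
      = a * d * G * l * (2 * D) + a * d * G * l * (2 * V) := by ring
    _ ≤ 16 * M * F + 8 * M * (128 * M * F + n * (2 * n * (32 * F + 32 * M * F))) := add_le_add e1 e4
    _ = (16 * M + 8 * M * (128 * M + n * (2 * n * (32 + 32 * M)))) * F := by ring
    _ ≤ _ := mul_le_mul_of_nonneg_right e5 hF

variable {X : Type*} [MeasurableSpace X] {ν : Measure X} {N J : ℕ} {p : Fin (N + 1) → X → ℝ≥0}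
  {T : Fin (N + 1) → Kernel X X} [∀ k, IsMarkovKernel (T k)] {c : X → Fin J}

theorem isProbabilityMeasure_swapMeasure (hp : ∀ k, IsProbDensity ν (p k)) :
    IsProbabilityMeasure (swapMeasure ν p) := by
  have := fun k => isProbabilityMeasure_densityMeasure (hp k)
  unfold swapMeasure
  infer_instance

theorem isMarkovKernel_swappingKernel (hp : ∀ k, Measurable (p k)) :
    IsMarkovKernel (swappingKernel p hp T) := by
  have := isMarkovKernel_swapKernel hp
  have := isMarkovKernel_updateKernel T
  unfold swappingKernel
  infer_instance

theorem invariant_swappingKernel (hp : ∀ k, IsProbDensity ν (p k))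
    (hT : ∀ k, (T k).Invariant (densityMeasure ν (p k))) :
    (swappingKernel p (fun k => (hp k).1) T).Invariant (swapMeasure ν p) := by
  have := fun k => isProbabilityMeasure_densityMeasure (hp k)
  have := isMarkovKernel_swapKernel fun k => (hp k).1
  have := isMarkovKernel_updateKernel T
  have hQ := invariant_swapKernel hp
  exact hQ.comp ((invariant_updateKernel T _ hT).comp hQ)

/-- The constant is `4 · 2(N + 1)`: laziness of `Q`, and the probability `1/(2(N + 1))` of updating
a given level. -/
theorem sum_sqForm_coordKernel_le (hp : ∀ k, Measurable (p k))
    (μ : Measure (Fin (N + 1) → X)) {f : (Fin (N + 1) → X) → ℝ} (hf : Measurable f) :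
    ∑ k, sqForm (coordKernel T k) μ f ≤ 8 * (N + 1) * sqForm (swappingKernel p hp T) μ f := by
  have := isMarkovKernel_swapKernel hp
  have := isMarkovKernel_updateKernel T
  have h := (quarter_mul_sqForm_le_of_lazy (fun x g hg => half_le_lintegral_swapKernel hp x hg)
    (fun x g hg => half_le_lintegral_updateKernel T x hg) μ hf).1
  rw [sqForm_updateKernel T μ hf, ← mul_assoc, ← mul_assoc] at h
  have e : (8 * (N + 1) : ℝ≥0∞) * (2⁻¹ * 2⁻¹ * (2 * (N + 1) : ℝ≥0∞)⁻¹) = 1 := by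
    have h2 : (2 : ℝ≥0∞) * 2⁻¹ = 1 := ENNReal.mul_inv_cancel two_ne_zero ENNReal.ofNat_ne_top
    have hN : (2 * (N + 1) : ℝ≥0∞) * (2 * (N + 1) : ℝ≥0∞)⁻¹ = 1 :=
      ENNReal.mul_inv_cancel (by simp) (by finiteness)
    calc (8 * (N + 1) : ℝ≥0∞) * (2⁻¹ * 2⁻¹ * (2 * (N + 1) : ℝ≥0∞)⁻¹)
        = (2 * 2⁻¹) * (2 * 2⁻¹) * ((2 * (N + 1) : ℝ≥0∞) * (2 * (N + 1) : ℝ≥0∞)⁻¹) := by ring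
      _ = 1 := by rw [h2, hN, one_mul, one_mul]
  refine le_trans (le_of_eq ?_) (mul_le_mul_right h _)
  rw [← mul_assoc, e, one_mul]

theorem sqForm_swapKernel_le_swappingKernel (hp : ∀ k, Measurable (p k))
    (μ : Measure (Fin (N + 1) → X)) {f : (Fin (N + 1) → X) → ℝ} (hf : Measurable f) :
    sqForm (swapKernel p hp) μ f ≤ 4 * sqForm (swappingKernel p hp T) μ f := by
  have := isMarkovKernel_swapKernel hp
  have := isMarkovKernel_updateKernel T
  have h := (quarter_mul_sqForm_le_of_lazy (fun x g hg => half_le_lintegral_swapKernel hp x hg)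
    (fun x g hg => half_le_lintegral_updateKernel T x hg) μ hf).2
  have e : (4 : ℝ≥0∞) * (2⁻¹ * 2⁻¹) = 1 := by
    have h2 : (2 : ℝ≥0∞) * 2⁻¹ = 1 := ENNReal.mul_inv_cancel two_ne_zero ENNReal.ofNat_ne_top
    calc (4 : ℝ≥0∞) * (2⁻¹ * 2⁻¹) = (2 * 2⁻¹) * (2 * 2⁻¹) := by ring
      _ = 1 := by rw [h2, one_mul]
  refine le_trans (le_of_eq ?_) (mul_le_mul_right h _)
  rw [← mul_assoc, ← mul_assoc, mul_assoc 4, e, one_mul]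

/-- The box means differ from `f` by a function whose second moment is the variance inside the
boxes; the squared triangle inequality separates the two contributions. -/
theorem sqForm_swapKernel_cellMean_le (hp : ∀ k, IsProbDensity ν (p k)) (hc : Measurable c)
    (h0 : ∀ k j, densityMeasure ν (p k) (c ⁻¹' {j}) ≠ 0)
    {f : (Fin (N + 1) → X) → ℝ} (hf : Measurable f) (hL : MemLp f 2 (swapMeasure ν p)) :
    sqForm (swapKernel p fun k => (hp k).1) (swapMeasure ν p)
        (fun x => cellMean (swapMeasure ν p) (cellVector c) f (cellVector c x))
      ≤ 2 * sqForm (swapKernel p fun k => (hp k).1) (swapMeasure ν p) f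
        + 4 * ∑ σ, swapMeasure ν p (cellVector c ⁻¹' {σ}) * ENNReal.ofReal (variance f
          (ProbabilityTheory.cond (swapMeasure ν p) (cellVector c ⁻¹' {σ}))) := by
  have := fun k => isProbabilityMeasure_densityMeasure (hp k)
  have := isProbabilityMeasure_swapMeasure hp
  have := isMarkovKernel_swapKernel fun k => (hp k).1
  have hC := measurable_cellVector (N := N) hc
  have hpos : ∀ σ, swapMeasure ν p (cellVector c ⁻¹' {σ}) ≠ 0 := fun σ =>
    pi_cellVector_ne_zero (fun k => densityMeasure ν (p k)) h0 σ
  have hm := measurable_cellMean_comp (swapMeasure ν p) hC f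
  have h1 := sqForm_add_le (swapKernel p fun k => (hp k).1) (swapMeasure ν p) hf (hm.fun_sub hf)
  simp only [add_sub_cancel] at h1
  refine h1.trans (add_le_add le_rfl ?_)
  rw [← lintegral_sq_sub_cellMean _ hC hpos hL, show (4 : ℝ≥0∞) = 2 * 2 by norm_num, mul_assoc]
  gcongr
  refine (sqForm_swapKernel_le hp (hm.fun_sub hf)).trans_eq ?_
  simp only [sub_sq_comm]

theorem ofReal_mul_cells_variance_le (hp : ∀ k, IsProbDensity ν (p k))
    (hT : ∀ k, (T k).IsReversible (densityMeasure ν (p k))) (hc : Measurable c)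
    (h0 : ∀ k j, densityMeasure ν (p k) (c ⁻¹' {j}) ≠ 0) {l : ℝ}
    (hl : ∀ k j, l ≤ spectralGap (restrictKernel (T k) (hc (measurableSet_singleton j)))
      (restrictMeasure (densityMeasure ν (p k)) (c ⁻¹' {j})))
    {f : (Fin (N + 1) → X) → ℝ} (hf : Measurable f) (hL : MemLp f 2 (swapMeasure ν p)) :
    ENNReal.ofReal l * (2 * ∑ σ, swapMeasure ν p (cellVector c ⁻¹' {σ}) * ENNReal.ofReal
        (variance f (ProbabilityTheory.cond (swapMeasure ν p) (cellVector c ⁻¹' {σ}))))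
      ≤ ∑ k, sqForm (coordKernel T k) (swapMeasure ν p) f := by
  have := fun k => isProbabilityMeasure_densityMeasure (hp k)
  have := fun k => isMarkovKernel_cellKernel (densityMeasure ν (p k)) hc (h0 k)
  refine (mul_le_mul_right (two_mul_sum_cells_variance_le (fun k => densityMeasure ν (p k)) hc h0
    hf hL) _).trans ?_
  rw [Finset.mul_sum]
  refine Finset.sum_le_sum fun k _ => ?_
  have h := sqForm_coordKernel_mono (fun k => densityMeasure ν (p k)) T
    (fun k => cellKernel (densityMeasure ν (p k)) hc) k ENNReal.one_ne_top
    (ENNReal.ofReal_ne_top (r := l)) (fun g hg hgL => by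
      rw [one_mul]; exact le_sqForm_of_restrictedGap (hT k) hc (h0 k) (hl k) hg hgL) hf hL
  rwa [one_mul] at h

/-- Jensen's inequality passes from box means to a fresh draw at level `k`, and the decomposition of
the gap of `T k`, lifted to the product, bounds that draw by the actual update. -/
theorem ofReal_mul_resampleForm_le (hp : ∀ k, IsProbDensity ν (p k))
    (hT : ∀ k, (T k).IsReversible (densityMeasure ν (p k))) (hc : Measurable c)
    (h0 : ∀ k j, densityMeasure ν (p k) (c ⁻¹' {j}) ≠ 0) {l : ℝ} (hl0 : 0 ≤ l) (hl2 : l ≤ 2)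
    (k : Fin (N + 1))
    (hl : ∀ j, l ≤ spectralGap (restrictKernel (T k) (hc (measurableSet_singleton j)))
      (restrictMeasure (densityMeasure ν (p k)) (c ⁻¹' {j})))
    {f : (Fin (N + 1) → X) → ℝ} (hf : Measurable f) (hL : MemLp f 2 (swapMeasure ν p)) :
    ENNReal.ofReal (l * spectralGap (projKernel (T k) (densityMeasure ν (p k))
        (fun j => c ⁻¹' {j})) ((densityMeasure ν (p k)).map c))
      * ENNReal.ofReal (resampleForm (fun k j => (densityMeasure ν (p k)).real (c ⁻¹' {j}))
        (cellMean (swapMeasure ν p) (cellVector c) f) k)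
      ≤ 16 * sqForm (coordKernel T k) (swapMeasure ν p) f := by
  have := fun k => isProbabilityMeasure_densityMeasure (hp k)
  refine (mul_le_mul_right (ofReal_resampleForm_cellMean_le (fun k => densityMeasure ν (p k)) hc
    h0 hf hL k) _).trans ?_
  exact sqForm_coordKernel_mono (fun k => densityMeasure ν (p k)) T
    (fun k => Kernel.const X (densityMeasure ν (p k))) k (by finiteness)
    ENNReal.ofReal_ne_top (fun g hg hgL => le_sqForm_of_projectedGap (hT k).invariant hc (h0 k)
      hl0 hl2 hg hgL (le_sqForm_of_restrictedGap (hT k) hc (h0 k) hl hg hgL)) hf hL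

theorem mul_sum_swap_cellMean_le (hp : ∀ k, IsProbDensity ν (p k)) (hc : Measurable c)
    (hN : 1 ≤ N) (h0 : ∀ k j, densityMeasure ν (p k) (c ⁻¹' {j}) ≠ 0) {d : ℝ} (hd0 : 0 ≤ d)
    (hd : ∀ (k : Fin N) i, ENNReal.ofReal d * densityMeasure ν (p k.castSucc) (c ⁻¹' {i})
        ≤ ∫⁻ z in c ⁻¹' {i}, ((min (p k.castSucc z) (p k.succ z) : ℝ≥0) : ℝ≥0∞) ∂ν
      ∧ ENNReal.ofReal d * densityMeasure ν (p k.succ) (c ⁻¹' {i})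
        ≤ ∫⁻ z in c ⁻¹' {i}, ((min (p k.succ z) (p k.castSucc z) : ℝ≥0) : ℝ≥0∞) ∂ν)
    (φ : (Fin (N + 1) → Fin J) → ℝ) :
    ENNReal.ofReal (d ^ 2 * ∑ k : Fin N, ∑ σ,
        vectorWeight (fun k j => (densityMeasure ν (p k)).real (c ⁻¹' {j})) σ
          * (φ σ - φ (swapState k σ)) ^ 2)
      ≤ 2 * N * sqForm (swapKernel p fun k => (hp k).1) (swapMeasure ν p)
        (fun x => φ (cellVector c x)) := by
  have := fun k => isProbabilityMeasure_densityMeasure (hp k)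
  refine le_trans ?_ (mul_le_mul_right (le_sqForm_swapKernel_cells hp hc h0 hd φ) _)
  have hN0 : (N : ℝ≥0) ≠ 0 := by exact_mod_cast (by omega : N ≠ 0)
  have e : (2 * N : ℝ≥0∞) * (((2 * N : ℝ≥0)⁻¹ : ℝ≥0) : ℝ≥0∞) = 1 := by
    rw [show (2 * N : ℝ≥0∞) = ((2 * N : ℝ≥0) : ℝ≥0∞) by push_cast; rfl, ← ENNReal.coe_mul,
      mul_inv_cancel₀ (by simpa using hN0), ENNReal.coe_one]
  have hV : ∀ σ, 0 ≤ vectorWeight (fun k j => (densityMeasure ν (p k)).real (c ⁻¹' {j})) σ :=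
    fun σ => Finset.prod_nonneg fun i _ => measureReal_nonneg
  rw [ENNReal.ofReal_mul (sq_nonneg d), ENNReal.ofReal_sum_of_nonneg fun k _ =>
    Finset.sum_nonneg fun σ _ => mul_nonneg (hV σ) (sq_nonneg _), Finset.mul_sum, Finset.mul_sum]
  refine Finset.sum_le_sum fun k _ => ?_
  rw [ENNReal.ofReal_sum_of_nonneg fun σ _ => mul_nonneg (hV σ) (sq_nonneg _), Finset.mul_sum,
    Finset.mul_sum]
  refine Finset.sum_le_sum fun σ _ => le_of_eq ?_
  rw [ENNReal.ofReal_mul (hV σ), ← pi_cellVector_eq_ofReal, ENNReal.ofReal_pow hd0]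
  rw [mul_left_comm (2 * N : ℝ≥0∞), ← mul_assoc (2 * N : ℝ≥0∞), e, one_mul, mul_left_comm]
  rfl

end GapBound

/-! ### The gap bound for a partition given by a labelling -/

section GapBound

variable {X : Type*} [MeasurableSpace X] {ν : Measure X} {N J : ℕ} {p : Fin (N + 1) → X → ℝ≥0}
  {T : Fin (N + 1) → Kernel X X} [∀ k, IsMarkovKernel (T k)] {c : X → Fin J}

theorem sum_measureReal_cells (μ : Measure X) [IsProbabilityMeasure μ] (hc : Measurable c) :
    ∑ j, μ.real (c ⁻¹' {j}) = 1 := by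
  have h := integral_map_eq_sum μ hc fun _ => (1 : ℝ)
  have : IsProbabilityMeasure (μ.map c) := Measure.isProbabilityMeasure_map hc.aemeasurable
  simpa using h.symm

theorem mul_variance_le_sqForm_swappingKernel (hN : 1 ≤ N) (hp : ∀ k, IsProbDensity ν (p k))
    (hT : ∀ k, (T k).IsReversible (densityMeasure ν (p k))) (hc : Measurable c)
    (h0 : ∀ k j, densityMeasure ν (p k) (c ⁻¹' {j}) ≠ 0) {g d l : ℝ} (hg0 : 0 < g) (hg1 : g ≤ 1)
    (hg : ∀ j, g ≤ ∏ k : Fin N, min 1 ((densityMeasure ν (p k.castSucc)).real (c ⁻¹' {j})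
      / (densityMeasure ν (p k.succ)).real (c ⁻¹' {j})))
    (hd0 : 0 ≤ d) (hd1 : d ≤ 1)
    (hd : ∀ (k : Fin N) i, ENNReal.ofReal d * densityMeasure ν (p k.castSucc) (c ⁻¹' {i})
        ≤ ∫⁻ z in c ⁻¹' {i}, ((min (p k.castSucc z) (p k.succ z) : ℝ≥0) : ℝ≥0∞) ∂ν
      ∧ ENNReal.ofReal d * densityMeasure ν (p k.succ) (c ⁻¹' {i})
        ≤ ∫⁻ z in c ⁻¹' {i}, ((min (p k.succ z) (p k.castSucc z) : ℝ≥0) : ℝ≥0∞) ∂ν)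
    (hl0 : 0 ≤ l) (hl2 : l ≤ 2)
    (hl : ∀ k j, l ≤ spectralGap (restrictKernel (T k) (hc (measurableSet_singleton j)))
      (restrictMeasure (densityMeasure ν (p k)) (c ⁻¹' {j})))
    {f : (Fin (N + 1) → X) → ℝ} (hf : Measurable f) (hL : MemLp f 2 (swapMeasure ν p)) :
    g ^ (J + 3) * d ^ 2 * spectralGap (projKernel (T 0) (densityMeasure ν (p 0))
        (fun j => c ⁻¹' {j})) ((densityMeasure ν (p 0)).map c) * l
        * (2 * variance f (swapMeasure ν p))
      ≤ 2 ^ 12 * (N + 1 : ℝ) ^ 4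
        * (sqForm (swappingKernel p (fun k => (hp k).1) T) (swapMeasure ν p) f).toReal := by
  have hP := fun k => isProbabilityMeasure_densityMeasure (hp k)
  have hμ := isProbabilityMeasure_swapMeasure hp
  have := isMarkovKernel_swapKernel fun k => (hp k).1
  have hSC : IsMarkovKernel (swappingKernel p (fun k => (hp k).1) T) :=
    isMarkovKernel_swappingKernel fun k => (hp k).1
  have hC := measurable_cellVector (N := N) hc
  have hpos : ∀ σ, swapMeasure ν p (cellVector c ⁻¹' {σ}) ≠ 0 := fun σ =>
    pi_cellVector_ne_zero (fun k => densityMeasure ν (p k)) h0 σ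
  have hmap : IsProbabilityMeasure ((densityMeasure ν (p 0)).map c) :=
    Measure.isProbabilityMeasure_map hc.aemeasurable
  have := isMarkovKernel_projKernel (T 0) (densityMeasure ν (p 0)) hc (h0 0)
  have hproj := invariant_projKernel (hT 0).invariant hc
  have hw : ∀ k j, 0 < (densityMeasure ν (p k)).real (c ⁻¹' {j}) := fun k j =>
    ENNReal.toReal_pos (h0 k j) (measure_ne_top _ _)
  have hwsum : ∀ k, ∑ j, (densityMeasure ν (p k)).real (c ⁻¹' {j}) = 1 := fun k =>
    sum_measureReal_cells _ hc
  have hFt := sqForm_ne_top (invariant_swappingKernel hp fun k => (hT k).invariant) hf hL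
  have hqt := sqForm_ne_top (invariant_swapKernel hp) hf hL
  have htt : ∀ k, sqForm (coordKernel T k) (swapMeasure ν p) f ≠ ∞ := fun k =>
    sqForm_ne_top (invariant_coordKernel (fun k => densityMeasure ν (p k)) T k
      (hT k).invariant) hf hL
  set φ := cellMean (swapMeasure ν p) (cellVector c) f with hφ
  set w : Fin (N + 1) → Fin J → ℝ := fun k j => (densityMeasure ν (p k)).real (c ⁻¹' {j}) with hwdef
  set F := sqForm (swappingKernel p (fun k => (hp k).1) T) (swapMeasure ν p) f with hFdef
  set q := sqForm (swapKernel p fun k => (hp k).1) (swapMeasure ν p) f with hqdef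
  set G := spectralGap (projKernel (T 0) (densityMeasure ν (p 0)) (fun j => c ⁻¹' {j}))
    ((densityMeasure ν (p 0)).map c) with hGdef
  have hG0 : 0 ≤ G := spectralGap_nonneg hproj
  have hG2 : G ≤ 2 := spectralGap_le_two hproj
  set D := ∑ σ, (swapMeasure ν p).real (cellVector c ⁻¹' {σ}) * variance f
    (ProbabilityTheory.cond (swapMeasure ν p) (cellVector c ⁻¹' {σ})) with hD
  have hD0 : 0 ≤ D := Finset.sum_nonneg fun σ _ => mul_nonneg measureReal_nonneg
    (variance_nonneg _ _)
  set S := ∑ k : Fin N, ∑ σ, vectorWeight w σ * (φ σ - φ (swapState k σ)) ^ 2 with hS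
  have hR0 := resampleForm_nonneg hw φ 0
  have i1 : q.toReal ≤ 4 * F.toReal := by
    have h := ENNReal.toReal_mono (by finiteness) (sqForm_swapKernel_le_swappingKernel (T := T)
      (fun k => (hp k).1) (swapMeasure ν p) hf)
    simpa [ENNReal.toReal_mul] using h
  have i2 : ∑ k, (sqForm (coordKernel T k) (swapMeasure ν p) f).toReal
      ≤ 8 * (N + 1 : ℝ) * F.toReal := by
    have h := ENNReal.toReal_mono (by finiteness) (sum_sqForm_coordKernel_le (T := T)
      (fun k => (hp k).1) (swapMeasure ν p) hf)
    rw [ENNReal.toReal_sum fun k _ => htt k, ENNReal.toReal_mul, ENNReal.toReal_mul,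
      ENNReal.toReal_add (by finiteness) (by finiteness)] at h
    simpa using h
  have i3 : (sqForm (coordKernel T 0) (swapMeasure ν p) f).toReal
      ≤ ∑ k, (sqForm (coordKernel T k) (swapMeasure ν p) f).toReal :=
    Finset.single_le_sum (f := fun k => (sqForm (coordKernel T k) (swapMeasure ν p) f).toReal)
      (fun _ _ => ENNReal.toReal_nonneg) (Finset.mem_univ 0)
  have i4 : l * (2 * D) ≤ ∑ k, (sqForm (coordKernel T k) (swapMeasure ν p) f).toReal := by
    have h := ENNReal.toReal_mono (ENNReal.sum_ne_top.2 fun k _ => htt k)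
      (ofReal_mul_cells_variance_le hp hT hc h0 hl hf hL)
    rw [sum_cells_toReal, ENNReal.toReal_sum fun k _ => htt k, ENNReal.toReal_mul,
      ENNReal.toReal_mul, ENNReal.toReal_ofReal hl0, ENNReal.toReal_ofReal hD0] at h
    simpa using h
  have i5 : l * G * resampleForm w φ 0
      ≤ 16 * (sqForm (coordKernel T 0) (swapMeasure ν p) f).toReal := by
    have h := ENNReal.toReal_mono (ENNReal.mul_ne_top (by finiteness) (htt 0))
      (ofReal_mul_resampleForm_le hp hT hc h0 hl0 hl2 0 (hl 0) hf hL)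
    rw [ENNReal.toReal_mul, ENNReal.toReal_mul, ENNReal.toReal_ofReal (mul_nonneg hl0 hG0),
      ENNReal.toReal_ofReal hR0] at h
    simpa using h
  have i6 : d ^ 2 * S ≤ 2 * N * (2 * q.toReal + 4 * D) := by
    have hb : ENNReal.ofReal (d ^ 2 * S) ≤ 2 * N * (2 * q + 4 * ENNReal.ofReal D) := by
      refine (mul_sum_swap_cellMean_le hp hc hN h0 hd0 hd φ).trans (mul_le_mul_right ?_ _)
      have h := sqForm_swapKernel_cellMean_le hp hc h0 hf hL
      rwa [sum_cells_toReal] at h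
    have hS0 : 0 ≤ S := Finset.sum_nonneg fun k _ => Finset.sum_nonneg fun σ _ =>
      mul_nonneg (Finset.prod_nonneg fun i _ => (hw _ _).le) (sq_nonneg _)
    have h := ENNReal.toReal_mono (by finiteness) hb
    rw [ENNReal.toReal_ofReal (mul_nonneg (sq_nonneg d) hS0), ENNReal.toReal_mul,
      ENNReal.toReal_mul, ENNReal.toReal_add (by finiteness) (by finiteness), ENNReal.toReal_mul,
      ENNReal.toReal_mul, ENNReal.toReal_ofReal hD0] at h
    simpa using h
  have i7 : g ^ (J + 1) * (2 * variance φ ((swapMeasure ν p).map (cellVector c)))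
      ≤ 8 * (N + 1 : ℝ) * (resampleForm w φ 0 + N * S) := by
    calc g ^ (J + 1) * (2 * variance φ ((swapMeasure ν p).map (cellVector c)))
        ≤ g ^ (J + 1) * ∑ k, resampleForm w φ k := by
          gcongr
          exact two_mul_variance_map_le (fun k => densityMeasure ν (p k)) hc φ
      _ = ∑ k, g ^ (J + 1) * resampleForm w φ k := Finset.mul_sum _ _ _
      _ ≤ ∑ _k : Fin (N + 1), 8 * (resampleForm w φ 0 + N * S) :=
          Finset.sum_le_sum fun k _ => resampleForm_le hw hwsum hg0 hg1 hg φ k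
      _ = _ := by simp; ring
  -- Only the power `J + 1` is used by the path estimate; the weaker stated power follows from `g ≤
  -- 1`.
  have hg3 : g ^ (J + 3) ≤ g ^ (J + 1) := pow_le_pow_of_le_one hg0.le hg1 (by omega)
  rw [variance_eq_sum_cells _ hC hpos hL]
  exact mul_variance_le_of_comparison rfl (by exact_mod_cast hN) hg3 (pow_le_one₀ hg0.le hg1)
    (sq_nonneg d) (pow_le_one₀ hd0 hd1) hl0 hl2 hG0 hG2 ENNReal.toReal_nonneg hD0
    (variance_nonneg _ _) hR0 i1 i3 i2 i4 i5 i6 i7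

theorem le_spectralGap_swappingKernel_of_bounds (hN : 1 ≤ N) (hJ : 1 ≤ J)
    (hp : ∀ k, IsProbDensity ν (p k))
    (hT : ∀ k, (T k).IsReversible (densityMeasure ν (p k))) (hc : Measurable c)
    (h0 : ∀ k j, densityMeasure ν (p k) (c ⁻¹' {j}) ≠ 0) {g d l : ℝ} (hg0 : 0 < g) (hg1 : g ≤ 1)
    (hg : ∀ j, g ≤ ∏ k : Fin N, min 1 ((densityMeasure ν (p k.castSucc)).real (c ⁻¹' {j})
      / (densityMeasure ν (p k.succ)).real (c ⁻¹' {j})))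
    (hd0 : 0 ≤ d) (hd1 : d ≤ 1)
    (hd : ∀ (k : Fin N) i, ENNReal.ofReal d * densityMeasure ν (p k.castSucc) (c ⁻¹' {i})
        ≤ ∫⁻ z in c ⁻¹' {i}, ((min (p k.castSucc z) (p k.succ z) : ℝ≥0) : ℝ≥0∞) ∂ν
      ∧ ENNReal.ofReal d * densityMeasure ν (p k.succ) (c ⁻¹' {i})
        ≤ ∫⁻ z in c ⁻¹' {i}, ((min (p k.succ z) (p k.castSucc z) : ℝ≥0) : ℝ≥0∞) ∂ν)
    (hl0 : 0 ≤ l) (hl2 : l ≤ 2)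
    (hl : ∀ k j, l ≤ spectralGap (restrictKernel (T k) (hc (measurableSet_singleton j)))
      (restrictMeasure (densityMeasure ν (p k)) (c ⁻¹' {j}))) :
    g ^ (J + 3) * d ^ 2 / (2 ^ 12 * ((N : ℝ) + 1) ^ 4 * (J : ℝ) ^ 3)
        * spectralGap (projKernel (T 0) (densityMeasure ν (p 0)) (fun j => c ⁻¹' {j}))
          (projMeasure (densityMeasure ν (p 0)) (fun j => c ⁻¹' {j})) * l
      ≤ spectralGap (swappingKernel p (fun k => (hp k).1) T) (swapMeasure ν p) := by
  have hP := fun k => isProbabilityMeasure_densityMeasure (hp k)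
  have hμ := isProbabilityMeasure_swapMeasure hp
  have hSC : IsMarkovKernel (swappingKernel p (fun k => (hp k).1) T) :=
    isMarkovKernel_swappingKernel fun k => (hp k).1
  have hmap : IsProbabilityMeasure ((densityMeasure ν (p 0)).map c) :=
    Measure.isProbabilityMeasure_map hc.aemeasurable
  have := isMarkovKernel_projKernel (T 0) (densityMeasure ν (p 0)) hc (h0 0)
  have hproj := invariant_projKernel (hT 0).invariant hc
  have hinv := invariant_swappingKernel hp fun k => (hT k).invariant
  rw [projMeasure_eq_map _ hc]
  have key := fun f (hf : Measurable f) hL => mul_variance_le_sqForm_swappingKernel (f := f) hN hp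
    hT hc h0 hg0 hg1 hg hd0 hd1 hd hl0 hl2 hl hf hL
  set G := spectralGap (projKernel (T 0) (densityMeasure ν (p 0)) (fun j => c ⁻¹' {j}))
    ((densityMeasure ν (p 0)).map c) with hGdef
  have hG0 : 0 ≤ G := spectralGap_nonneg hproj
  have hG2 : G ≤ 2 := spectralGap_le_two hproj
  have hJ1 : (1 : ℝ) ≤ (J : ℝ) ^ 3 := one_le_pow₀ (by exact_mod_cast hJ)
  have hN1 : (1 : ℝ) ≤ ((N : ℝ) + 1) ^ 4 := one_le_pow₀ (by linarith [(N.cast_nonneg : (0:ℝ) ≤ N)])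
  have hden : (0 : ℝ) < 2 ^ 12 * ((N : ℝ) + 1) ^ 4 * (J : ℝ) ^ 3 := by positivity
  have e : g ^ (J + 3) * d ^ 2 / (2 ^ 12 * ((N : ℝ) + 1) ^ 4 * (J : ℝ) ^ 3) * G * l
      = g ^ (J + 3) * d ^ 2 * G * l / (2 ^ 12 * ((N : ℝ) + 1) ^ 4 * (J : ℝ) ^ 3) := by ring
  rw [e]
  refine le_spectralGap hinv ?_ fun f hf hL => ?_
  -- Both gaps are at most 2, so the numerator is at most 4, far below the denominator.
  · rw [div_le_one hden]
    have h1 : g ^ (J + 3) * d ^ 2 ≤ 1 :=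
      mul_le_one₀ (pow_le_one₀ hg0.le hg1) (sq_nonneg d) (pow_le_one₀ hd0 hd1)
    calc g ^ (J + 3) * d ^ 2 * G * l ≤ 1 * 2 * 2 := by gcongr
      _ ≤ 2 ^ 12 * 1 * 1 := by norm_num
      _ ≤ _ := by gcongr
  · rw [dirichletForm_eq_sqForm hinv hf hL, div_mul_eq_mul_div, div_le_iff₀ hden]
    have h := key f hf hL
    set F := (sqForm (swappingKernel p (fun k => (hp k).1) T) (swapMeasure ν p) f).toReal with hF
    have hF0 : 0 ≤ F := ENNReal.toReal_nonneg
    have hJF : 2 ^ 12 * ((N : ℝ) + 1) ^ 4 * F ≤ 2 ^ 12 * ((N : ℝ) + 1) ^ 4 * F * (J : ℝ) ^ 3 :=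
      le_mul_of_one_le_right (by positivity) hJ1
    linarith

end GapBound

/-! ### The overlap and the level ratio as numerical bounds -/

section Overlap

variable {X : Type*} [MeasurableSpace X] {ν : Measure X} {N J : ℕ} {p : Fin (N + 1) → X → ℝ≥0}
  {A : Fin J → Set X}

theorem setIntegral_min_eq_toReal {q r : X → ℝ≥0} (hq : Measurable q) (hr : Measurable r)
    (B : Set X) :
    ∫ z in B, ((min (q z) (r z) : ℝ≥0) : ℝ) ∂ν
      = (∫⁻ z in B, ((min (q z) (r z) : ℝ≥0) : ℝ≥0∞) ∂ν).toReal := by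
  rw [integral_eq_lintegral_of_nonneg_ae (.of_forall fun z => NNReal.coe_nonneg _)
    (hq.min hr).coe_nnreal_real.aestronglyMeasurable]
  simp only [ENNReal.ofReal_coe_nnreal]

theorem overlap_nonneg : 0 ≤ overlap ν p A :=
  Real.iInf_nonneg fun _ => div_nonneg (integral_nonneg fun _ => NNReal.coe_nonneg _)
    measureReal_nonneg

theorem overlap_le {k l : Fin (N + 1)} (h : |((k : ℕ) : ℤ) - ((l : ℕ) : ℤ)| = 1) (j : Fin J) :
    overlap ν p A ≤ (∫ z in A j, ((min (p k z) (p l z) : ℝ≥0) : ℝ) ∂ν) /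
      (densityMeasure ν (p k)).real (A j) :=
  ciInf_le (Set.finite_range _).bddBelow
    ((⟨(k, l), h⟩, j) : {q : Fin (N + 1) × Fin (N + 1) //
      |((q.1 : ℕ) : ℤ) - ((q.2 : ℕ) : ℤ)| = 1} × Fin J)

theorem ofReal_overlap_mul_le (hp : ∀ k, IsProbDensity ν (p k))
    (hpos : ∀ k j, 0 < densityMeasure ν (p k) (A j)) {k l : Fin (N + 1)}
    (h : |((k : ℕ) : ℤ) - ((l : ℕ) : ℤ)| = 1) (j : Fin J) :
    ENNReal.ofReal (overlap ν p A) * densityMeasure ν (p k) (A j)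
      ≤ ∫⁻ z in A j, ((min (p k z) (p l z) : ℝ≥0) : ℝ≥0∞) ∂ν := by
  have := isProbabilityMeasure_densityMeasure (hp k)
  have hr : 0 < (densityMeasure ν (p k)).real (A j) :=
    ENNReal.toReal_pos (hpos k j).ne' (measure_ne_top _ _)
  have h1 := (le_div_iff₀ hr).1 (overlap_le (ν := ν) (p := p) (A := A) h j)
  rw [setIntegral_min_eq_toReal (hp k).1 (hp l).1] at h1
  rw [← ofReal_measureReal (measure_ne_top _ _), ← ENNReal.ofReal_mul overlap_nonneg]
  exact (ENNReal.ofReal_le_ofReal h1).trans ENNReal.ofReal_toReal_le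

theorem overlap_le_one (hN : 1 ≤ N) (hp : ∀ k, IsProbDensity ν (p k))
    (hA : ∀ j, MeasurableSet (A j))
    (j : Fin J) : overlap ν p A ≤ 1 := by
  have := fun k => isProbabilityMeasure_densityMeasure (hp k)
  have h : |(((0 : Fin (N + 1)) : ℕ) : ℤ) - (((⟨1, by omega⟩ : Fin (N + 1)) : ℕ) : ℤ)| = 1 := by
    simp
  refine (overlap_le h j).trans (div_le_one_of_le₀ ?_ measureReal_nonneg)
  rw [setIntegral_min_eq_toReal (hp _).1 (hp _).1]
  refine ENNReal.toReal_mono (measure_ne_top _ _) ?_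
  rw [densityMeasure, withDensity_apply _ (hA j)]
  exact lintegral_mono fun z => ENNReal.coe_le_coe.2 (min_le_left _ _)

theorem levelRatio_nonneg : 0 ≤ levelRatio ν p A :=
  Real.iInf_nonneg fun _ => Finset.prod_nonneg fun _ _ =>
    le_min zero_le_one (div_nonneg measureReal_nonneg measureReal_nonneg)

theorem levelRatio_le (j : Fin J) :
    levelRatio ν p A ≤ ∏ k : Fin N, min 1 ((densityMeasure ν (p k.castSucc)).real (A j) /
      (densityMeasure ν (p k.succ)).real (A j)) :=
  ciInf_le (Set.finite_range _).bddBelow j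

theorem levelRatio_le_one (j : Fin J) : levelRatio ν p A ≤ 1 :=
  (levelRatio_le j).trans (Finset.prod_le_one
    (fun _ _ => le_min zero_le_one (div_nonneg measureReal_nonneg measureReal_nonneg))
    fun _ _ => min_le_left _ _)

end Overlap

/-! ### The gap bound for a partition given by sets -/

section Partition

variable {X : Type*} [MeasurableSpace X] {ν : Measure X} {N J : ℕ} {p : Fin (N + 1) → X → ℝ≥0}
  {T : Fin (N + 1) → Kernel X X} [∀ k, IsMarkovKernel (T k)]

theorem exists_measurable_preimage_singleton_eq {A : Fin J → Set X} (hA : ∀ j, MeasurableSet (A j))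
    (hdisj : Pairwise fun i j => Disjoint (A i) (A j)) (hcover : ⋃ j, A j = Set.univ) :
    ∃ c : X → Fin J, Measurable c ∧ A = fun j => c ⁻¹' {j} := by
  have h : ∀ x, ∃ j, x ∈ A j := fun x => Set.mem_iUnion.1 (hcover ▸ Set.mem_univ x)
  choose c hc using h
  have e : A = fun j => c ⁻¹' {j} := by
    funext j
    ext x
    refine ⟨fun hx => ?_, fun hx => ?_⟩
    · by_contra hne
      exact Set.disjoint_left.1 (hdisj hne) (hc x) hx
    · rw [← show c x = j from hx]
      exact hc x
  exact ⟨c, measurable_to_countable' fun j => by simpa [e] using hA j, e⟩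

theorem le_spectralGap_swappingKernel (hN : 1 ≤ N) {A : Fin J → Set X}
    (hA : ∀ j, MeasurableSet (A j)) (hdisj : Pairwise fun i j => Disjoint (A i) (A j))
    (hcover : ⋃ j, A j = Set.univ) (hp : ∀ k, IsProbDensity ν (p k))
    (hT : ∀ k, (T k).IsReversible (densityMeasure ν (p k)))
    (hpos : ∀ k j, 0 < densityMeasure ν (p k) (A j)) :
    levelRatio ν p A ^ (J + 3) * overlap ν p A ^ 2 /
          (2 ^ 12 * ((N : ℝ) + 1) ^ 4 * (J : ℝ) ^ 3) *
        spectralGap (projKernel (T 0) (densityMeasure ν (p 0)) A)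
          (projMeasure (densityMeasure ν (p 0)) A) *
        minRestrictedGap ν p T A hA ≤
      spectralGap (swappingKernel p (fun k => (hp k).1) T) (swapMeasure ν p) := by
  have hP := fun k => isProbabilityMeasure_densityMeasure (hp k)
  have hμ := isProbabilityMeasure_swapMeasure hp
  have hSC : IsMarkovKernel (swappingKernel p (fun k => (hp k).1) T) :=
    isMarkovKernel_swappingKernel fun k => (hp k).1
  -- If the level ratio is 0 the left side vanishes; otherwise it may serve as the positive constant
  -- `g`.
  rcases (levelRatio_nonneg (ν := ν) (p := p) (A := A)).eq_or_lt with hg | hg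
  · rw [← hg, zero_pow (by omega)]
    simpa using spectralGap_nonneg (invariant_swappingKernel hp fun k => (hT k).invariant)
  obtain ⟨c, hc, rfl⟩ := exists_measurable_preimage_singleton_eq hA hdisj hcover
  have h0 : ∀ k j, densityMeasure ν (p k) (c ⁻¹' {j}) ≠ 0 := fun k j => (hpos k j).ne'
  -- A probability measure lives on a nonempty space; the cell of this point shows `1 ≤ J` and
  -- selects an index at which the minima are bounded above.
  obtain ⟨x⟩ : Nonempty X := (densityMeasure ν (p 0)).nonempty_of_neZero
  have hres : ∀ k j, 0 ≤ spectralGap (restrictKernel (T k) (hA j))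
        (restrictMeasure (densityMeasure ν (p k)) (c ⁻¹' {j}))
      ∧ spectralGap (restrictKernel (T k) (hA j))
        (restrictMeasure (densityMeasure ν (p k)) (c ⁻¹' {j})) ≤ 2 := fun k j => by
    have := isMarkovKernel_restrictKernel (T k) (hA j)
    have := isProbabilityMeasure_restrictMeasure (densityMeasure ν (p k)) (hA j) (h0 k j)
    exact ⟨spectralGap_nonneg (invariant_restrictKernel (hT k) (hA j)),
      spectralGap_le_two (invariant_restrictKernel (hT k) (hA j))⟩
  have hl : ∀ k j, minRestrictedGap ν p T (fun j => c ⁻¹' {j}) hA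
      ≤ spectralGap (restrictKernel (T k) (hA j))
        (restrictMeasure (densityMeasure ν (p k)) (c ⁻¹' {j})) := fun k j =>
    ciInf_le (Set.finite_range _).bddBelow ((k, j) : Fin (N + 1) × Fin J)
  refine le_spectralGap_swappingKernel_of_bounds hN (c x).pos hp hT hc h0 hg
    (levelRatio_le_one (c x)) levelRatio_le overlap_nonneg (overlap_le_one hN hp hA (c x))
    (fun k i => ⟨ofReal_overlap_mul_le hp hpos (by simp) i,
      ofReal_overlap_mul_le hp hpos (by simp) i⟩)
    (Real.iInf_nonneg fun q => (hres q.1 q.2).1) ((hl 0 (c x)).trans (hres 0 (c x)).2) hl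

end Partition

/-! ### Tempered densities -/

section Tempering

variable {X : Type*} [MeasurableSpace X] {ν : Measure X}

/-- For `z ≤ 1` the power with the smaller exponent dominates, and for `z ≥ 1` the exponent 1 does.
The point `z = 0` is treated apart because `0 ^ 0 = 1`. -/
theorem rpow_le_rpow_add_self (z : ℝ≥0) {a b : ℝ} (hab : a ≤ b) (hb : b ≤ 1) (ha : 0 ≤ a) :
    z ^ b ≤ z ^ a + z := by
  rcases eq_or_ne z 0 with rfl | hz
  · rcases ha.eq_or_lt with rfl | ha'
    · rw [NNReal.rpow_zero]
      exact (NNReal.rpow_le_one zero_le_one (ha.trans hab)).trans le_self_add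
    · rw [NNReal.zero_rpow (ha'.trans_le hab).ne']
      exact zero_le
  rcases le_total z 1 with h | h
  · exact (NNReal.rpow_le_rpow_of_exponent_ge (pos_iff_ne_zero.2 hz) h hab).trans le_self_add
  · calc z ^ b ≤ z ^ (1 : ℝ) := NNReal.rpow_le_rpow_of_exponent_le h hb
      _ = z := NNReal.rpow_one z
      _ ≤ _ := le_add_self

/-- The normalizing constant is finite, because `π^b ≤ π^a + π` with both terms integrable. It is
nonzero, because otherwise `π` would vanish almost everywhere. -/
theorem isProbDensity_temperedDensity {π : X → ℝ≥0} (hπ : IsProbDensity ν π) {a b : ℝ}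
    (ha : 0 ≤ a) (hab : a ≤ b) (hb : b ≤ 1)
    (hfin : ∫⁻ z, ((π z ^ a : ℝ≥0) : ℝ≥0∞) ∂ν < ∞) : IsProbDensity ν (temperedDensity ν π b) := by
  refine ⟨measurable_temperedDensity ν hπ.1 b, ?_⟩
  have hm : ∀ b : ℝ, Measurable fun z => ((π z ^ b : ℝ≥0) : ℝ≥0∞) := fun b =>
    (hπ.1.pow_const b).coe_nnreal_ennreal
  have htop : ∫⁻ z, ((π z ^ b : ℝ≥0) : ℝ≥0∞) ∂ν ≠ ∞ := by
    refine ne_top_of_le_ne_top ?_ (lintegral_mono (g := fun z => ((π z ^ a : ℝ≥0) : ℝ≥0∞) + π z)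
      fun z => by
        beta_reduce
        rw [← ENNReal.coe_add]
        exact ENNReal.coe_le_coe.2 (rpow_le_rpow_add_self (π z) hab hb ha))
    rw [lintegral_add_left (hm a), hπ.2]
    exact ENNReal.add_ne_top.2 ⟨hfin.ne, ENNReal.one_ne_top⟩
  have hne : ∫⁻ z, ((π z ^ b : ℝ≥0) : ℝ≥0∞) ∂ν ≠ 0 := fun h => by
    rw [lintegral_eq_zero_iff (hm b)] at h
    have h' : ∫⁻ z, (π z : ℝ≥0∞) ∂ν = 0 := by
      rw [lintegral_eq_zero_iff hπ.1.coe_nnreal_ennreal]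
      filter_upwards [h] with z hz
      have hz' : π z ^ b = 0 := by simpa using hz
      simpa using (NNReal.rpow_eq_zero_iff.1 hz').1
    rw [hπ.2] at h'
    exact one_ne_zero h'
  set Z := (∫⁻ w, ((π w ^ b : ℝ≥0) : ℝ≥0∞) ∂ν).toNNReal with hZ
  have hZ' : (Z : ℝ≥0∞) = ∫⁻ w, ((π w ^ b : ℝ≥0) : ℝ≥0∞) ∂ν := ENNReal.coe_toNNReal htop
  have hZ0 : Z ≠ 0 := fun h => hne (by rw [← hZ', h, ENNReal.coe_zero])
  have e : ∀ z, ((temperedDensity ν π b z : ℝ≥0) : ℝ≥0∞)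
      = ((Z⁻¹ : ℝ≥0) : ℝ≥0∞) * ((π z ^ b : ℝ≥0) : ℝ≥0∞) := fun z => by
    rw [← ENNReal.coe_mul, temperedDensity, div_eq_inv_mul]
  simp only [e]
  rw [lintegral_const_mul _ (hm b), ← hZ', ← ENNReal.coe_mul, inv_mul_cancel₀ hZ0, ENNReal.coe_one]

end Tempering

end SwappingChain

end

theorem theorem3p1 {X : Type*} [MeasurableSpace X] (ν : Measure X)
    (N : ℕ) (hN : 1 ≤ N)
    (J : ℕ) (A : Fin J → Set X) (hA : ∀ j, MeasurableSet (A j))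
    (hdisj : Pairwise fun i j => Disjoint (A i) (A j)) (hcover : ⋃ j, A j = Set.univ)
    (T : Fin (N + 1) → Kernel X X) [∀ k, IsMarkovKernel (T k)] :
    -- the swapping chain, for arbitrary densities
    (∀ (p : Fin (N + 1) → X → ℝ≥0) (hp : ∀ k, SwappingChain.IsProbDensity ν (p k)),
      (∀ k, (T k).IsReversible (SwappingChain.densityMeasure ν (p k))) →
      (∀ k j, 0 < SwappingChain.densityMeasure ν (p k) (A j)) →
      SwappingChain.levelRatio ν p A ^ (J + 3) * SwappingChain.overlap ν p A ^ 2 /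
            (2 ^ 12 * ((N : ℝ) + 1) ^ 4 * (J : ℝ) ^ 3) *
          SwappingChain.spectralGap
            (SwappingChain.projKernel (T 0) (SwappingChain.densityMeasure ν (p 0)) A)
            (SwappingChain.projMeasure (SwappingChain.densityMeasure ν (p 0)) A) *
          SwappingChain.minRestrictedGap ν p T A hA ≤
        SwappingChain.spectralGap
          (SwappingChain.swappingKernel p (fun k => (hp k).1) T)
          (SwappingChain.swapMeasure ν p)) ∧
    -- parallel tempering: the densities are proportional to the powers `π ^ β k`
    (∀ (π : X → ℝ≥0) (hπ : SwappingChain.IsProbDensity ν π) (β : Fin (N + 1) → ℝ)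
        (p : Fin (N + 1) → X → ℝ≥0)
        (hp : ∀ k, p k = SwappingChain.temperedDensity ν π (β k)),
      0 ≤ β 0 → StrictMono β → β (Fin.last N) = 1 →
      ∫⁻ z, ((π z ^ β 0 : ℝ≥0) : ℝ≥0∞) ∂ν < ∞ →
      (∀ k, (T k).IsReversible (SwappingChain.densityMeasure ν (p k))) →
      (∀ k j, 0 < SwappingChain.densityMeasure ν (p k) (A j)) →
      SwappingChain.levelRatio ν p A ^ (J + 3) * SwappingChain.overlap ν p A ^ 2 /
            (2 ^ 12 * ((N : ℝ) + 1) ^ 4 * (J : ℝ) ^ 3) *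
          SwappingChain.spectralGap
            (SwappingChain.projKernel (T 0) (SwappingChain.densityMeasure ν (p 0)) A)
            (SwappingChain.projMeasure (SwappingChain.densityMeasure ν (p 0)) A) *
          SwappingChain.minRestrictedGap ν p T A hA ≤
        SwappingChain.spectralGap
          (SwappingChain.swappingKernel p
            (SwappingChain.measurable_of_eq_temperedDensity hπ hp) T)
          (SwappingChain.swapMeasure ν p)) := by
  refine ⟨fun p hp hT hpos => SwappingChain.le_spectralGap_swappingKernel hN hA hdisj hcover hp hT
    hpos, fun π hπ β p hp hβ0 hβ hβ1 hfin hT hpos => ?_⟩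
  -- Monotonicity places every `β k` between `β 0` and 1, so finiteness at `β 0` makes all levels
  -- normalizable.
  have hdens : ∀ k, SwappingChain.IsProbDensity ν (p k) := fun k => by
    rw [hp k]
    exact SwappingChain.isProbDensity_temperedDensity hπ hβ0 (hβ.monotone (Fin.zero_le k))
      (hβ1 ▸ hβ.monotone (Fin.le_last k)) hfin
  exact SwappingChain.le_spectralGap_swappingKernel hN hA hdisj hcover hdens hT hpos
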